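/- Let $K$ be a field with algebraic closure $\overline K$, let $\phi\in K(x)$ be a rational function of degree $d\ge 2$ with $\operatorname{char}K\nmid d$, and let $m\ge 2$ be an integer. For $b\in\mathbb P^1(K)$ let $\phi^{-\infty}(b)=\bigcup_{n\ge 0}\{z\in\mathbb P^1(\overline K):\phi^n(z)=b\}$ be its full backward orbit, and let $K(\phi^{-\infty}(b))$ be the field generated over $K$ by the elements of $\phi^{-\infty}(b)$ other than $\infty$. Call $b$ exceptional for $\phi$ if $\phi^{-\infty}(b)$ is finite. Let $\mu_{m^\infty}$ be the set of all $\zeta\in\overline K$ with $\zeta^{m^k}=1$ for some $k\ge 1$. (1) Suppose that $\psi=g\circ\phi\circ g^{-1}$ lies in $\overline K(x^m)$ for some Möbius transformation $g$ over $\overline K$, and that $0$ and $\infty$ are periodic under $\psi$. Put $\alpha=g^{-1}(0)$ and $\beta=g^{-1}(\infty)$. Then for every non-exceptional $b\in\mathbb P^1(K)$ the compositum of $K(\alpha,\beta)$ and $K(\phi^{-\infty}(b))$ contains $K(\mu_{m^\infty})$; in particular $K(\mu_{m^\infty})$ is contained in a finite extension of $K(\phi^{-\infty}(b))$. (2) Let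 $T_d$ be the monic Chebyshev polynomial of degree $d$, so that $T_d(x+1/x)=x^d+1/x^d$. For every $b\in K$, the field $K(T_d^{-\infty}(b))$ contains $\zeta+\zeta^{-1}$ for all $\zeta\in\mu_{d^\infty}$, and $K(\mu_{d^\infty})$ is contained in an extension of $K(T_d^{-\infty}(b))$ of degree at most $2$. Moreover, if $m\mid d$ and $\phi$ is conjugate to $T_d$ by a Möbius transformation over $\overline K$, then for every non-exceptional $b\in\mathbb P^1(K)$ the field $K(\mu_{m^\infty})$ is contained in a finite extension of $K(\phi^{-\infty}(b))$. (3) Suppose that $m\mid d$ and that $\phi$ is a flexible Lattès map, that is, there are an elliptic curve $E$ over $K$, a finite separable covering $\pi:E\to\mathbb P^1$ of degree $2$ defined over $K$ with $\pi(P)=\pi(-P)$ for all $P\in E(\overline K)$, an integer $e\ge 2$ and a point $Q\in E(\overline K)$ such that $\phi(\pi(P))=\pi([e]P+Q)$ for all $P\in E(\overline K)$. Then for every $b\in\mathbb P^1(K)$ the field $K(\mu_{m^\infty})$ is contained in an extension of $K(\phi^{-\infty}(b))$ of degree at most $8$. -/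

import Mathlib

open scoped OnePoint MatrixGroups

noncomputable section

namespace IteratedExt

/-- The degree of a rational function as a self-map of the projective line. -/
def ratDegree {K : Type*} [Field K] (φ : RatFunc K) : ℕ :=
  max φ.num.natDegree φ.denom.natDegree

/-- The self-map of `ℙ¹(Ω) = Ω ∪ {∞}` induced by a rational function `φ ∈ K(x)`, for an extension
`Ω` of `K`.  At `∞` one divides numerator and denominator by `x ^ deg φ`. -/
def ratMap {K : Type*} [Field K] (Ω : Type*) [Field Ω] [DecidableEq Ω] [Algebra K Ω]
    (φ : RatFunc K) : OnePoint Ω → OnePoint Ω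
  | ∞ =>
    if algebraMap K Ω (φ.denom.coeff (ratDegree φ)) = 0 then ∞
    else ((algebraMap K Ω (φ.num.coeff (ratDegree φ)) /
      algebraMap K Ω (φ.denom.coeff (ratDegree φ)) : Ω) : OnePoint Ω)
  | (z : Ω) =>
    if Polynomial.aeval z φ.denom = 0 then ∞
    else ((Polynomial.aeval z φ.num / Polynomial.aeval z φ.denom : Ω) : OnePoint Ω)

section Orbits

variable {K : Type*} [Field K] (Ω : Type*) [Field Ω] [DecidableEq Ω] [Algebra K Ω]

/-- The full backward orbit `φ^{-∞}(b) = ⋃_{n ≥ 0} φ^{-n}(b)` in `ℙ¹(Ω)` of a point `b ∈ ℙ¹(K)`. -/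
def backwardOrbit (φ : RatFunc K) (b : OnePoint K) : Set (OnePoint Ω) :=
  {z | ∃ n : ℕ, (ratMap Ω φ)^[n] z = OnePoint.map (algebraMap K Ω) b}

/-- `b` is exceptional for `φ` if its full backward orbit (over an algebraic closure) is finite. -/
def IsExceptional (φ : RatFunc K) (b : OnePoint K) : Prop :=
  (backwardOrbit Ω φ b).Finite

/-- The field generated over `K` by a set of points of `ℙ¹(Ω)`; the point `∞` contributes
nothing. -/
def fieldOfPoints (K : Type*) [Field K] {Ω : Type*} [Field Ω] [Algebra K Ω]
    (S : Set (OnePoint Ω)) : IntermediateField K Ω :=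
  IntermediateField.adjoin K {z : Ω | (z : OnePoint Ω) ∈ S}

/-- The iterated extension `K(φ^{-∞}(b))`. -/
def iteratedField (φ : RatFunc K) (b : OnePoint K) : IntermediateField K Ω :=
  fieldOfPoints K (backwardOrbit Ω φ b)

/-- `ψ = g ∘ φ ∘ g⁻¹` for the Möbius transformation `g` with coefficients in `Ω`.  Over an
algebraically closed (hence infinite) field, equality of rational functions is equality of the
maps they induce on `ℙ¹(Ω)`. -/
def IsConjVia (g : GL (Fin 2) Ω) (φ : RatFunc K) (ψ : RatFunc Ω) : Prop :=
  ∀ z : OnePoint Ω, g • ratMap Ω φ z = ratMap Ω ψ (g • z)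

end Orbits

section RootsOfUnity

variable (K : Type*) [Field K] (Ω : Type*) [Field Ω] [Algebra K Ω]

/-- `μ_{m^∞}`: the roots in `Ω` of `x ^ (m ^ k) - 1` for `k ≥ 1`. -/
def muInfty (m : ℕ) : Set Ω :=
  {ζ | ∃ k : ℕ, 1 ≤ k ∧ ζ ^ (m ^ k) = 1}

/-- `K(μ_{m^∞})`. -/
def cyclotomicField (m : ℕ) : IntermediateField K Ω :=
  IntermediateField.adjoin K (muInfty Ω m)

/-- `K(ζ_{m^∞} + ζ_{m^∞}⁻¹)`. -/
def realCyclotomicField (m : ℕ) : IntermediateField K Ω :=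
  IntermediateField.adjoin K ((fun ζ : Ω => ζ + ζ⁻¹) '' muInfty Ω m)

variable {K Ω}

/-- `M` is contained in a finite extension of `L` (all fields inside `Ω`). -/
def InFiniteExtension (L M : IntermediateField K Ω) : Prop :=
  ∃ F : IntermediateField L Ω, FiniteDimensional L F ∧ M ≤ F.restrictScalars K

/-- `M` is contained in an extension of `L` of degree at most `n` (all fields inside `Ω`). -/
def InExtensionOfDegreeLE (L M : IntermediateField K Ω) (n : ℕ) : Prop :=
  ∃ F : IntermediateField L Ω,
    FiniteDimensional L F ∧ Module.finrank L F ≤ n ∧ M ≤ F.restrictScalars K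

end RootsOfUnity

/-- The monic Chebyshev polynomial `T_d` of degree `d`, characterized by
`T_d(x + 1/x) = x ^ d + 1 / x ^ d`, as a rational function.  (Mathlib calls it
`Polynomial.Chebyshev.C`.) -/
def chebyshevT (K : Type*) [Field K] (d : ℕ) : RatFunc K :=
  algebraMap (Polynomial K) (RatFunc K) (Polynomial.Chebyshev.C K d)

section Lattes

variable {K : Type*} [Field K]

/-- The coordinate functions `(x, y, 1)` in the function field of a Weierstrass curve. -/
def genericCoords (E : WeierstrassCurve K) : Fin 3 → E.toAffine.FunctionField :=
  ![algebraMap _ _ (WeierstrassCurve.Affine.CoordinateRing.mk E.toAffine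
      (Polynomial.C Polynomial.X)),
    algebraMap _ _ (WeierstrassCurve.Affine.CoordinateRing.mk E.toAffine Polynomial.X), 1]

/-- Homogeneous coordinates of a point: `(0 : 1 : 0)` for the point at infinity and `(x : y : 1)`
for an affine point. -/
def homogCoords {Ω : Type*} [Field Ω] {W : WeierstrassCurve Ω} : W.toAffine.Point → Fin 3 → Ω
  | .zero => ![0, 1, 0]
  | .some x y _ => ![x, y, 1]

/-- `v ∈ ℙ¹(Ω)` is the value at the point `P ∈ E(Ω)` of the function `f ∈ K(E)`: near `P` the
function `f` is a quotient `F / G` of homogeneous polynomials over `K` of the same degree that do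
not both vanish at `P`, and `v = (F(P) : G(P))`. -/
def IsValueAt {Ω : Type*} [Field Ω] [DecidableEq Ω] [Algebra K Ω] {E : WeierstrassCurve K}
    (f : E.toAffine.FunctionField) (P : (E.baseChange Ω).toAffine.Point) (v : OnePoint Ω) : Prop :=
  ∃ (n : ℕ) (F G : MvPolynomial (Fin 3) K), F.IsHomogeneous n ∧ G.IsHomogeneous n ∧
    f * MvPolynomial.aeval (genericCoords E) G = MvPolynomial.aeval (genericCoords E) F ∧
    ¬ (MvPolynomial.aeval (homogCoords P) F = 0 ∧ MvPolynomial.aeval (homogCoords P) G = 0) ∧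
    v = if MvPolynomial.aeval (homogCoords P) G = 0 then ∞
      else ((MvPolynomial.aeval (homogCoords P) F / MvPolynomial.aeval (homogCoords P) G : Ω) :
        OnePoint Ω)

open IntermediateField in
/-- `φ ∈ K(x)` is a flexible Lattès map: there are an elliptic curve `E` over `K` and a finite
separable covering `π : E → ℙ¹` of degree two over `K`, given by a function `f ∈ K(E)`, with
`π(P) = π(-P)`, such that `φ ∘ π = π ∘ ψ`, where `ψ(P) = [e]P + Q` with an integer `e ≥ 2` and
`Q ∈ E(Ω)`, for `Ω` an algebraic closure of `K`. -/
def IsFlexibleLattes (Ω : Type*) [Field Ω] [DecidableEq Ω] [Algebra K Ω] (φ : RatFunc K) : Prop :=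
  ∃ (E : WeierstrassCurve K) (_ : E.IsElliptic) (f : E.toAffine.FunctionField)
    (π : (E.baseChange Ω).toAffine.Point → OnePoint Ω)
    (e : ℕ) (Q : (E.baseChange Ω).toAffine.Point),
    Module.finrank K⟮f⟯ E.toAffine.FunctionField = 2 ∧
    Algebra.IsSeparable K⟮f⟯ E.toAffine.FunctionField ∧
    (∀ P, IsValueAt f P (π P)) ∧
    (∀ P, π P = π (-P)) ∧
    2 ≤ e ∧
    ∀ P, ratMap Ω φ (π P) = π (e • P + Q)

end Lattes

end IteratedExt

end

/-! Maps in `x ^ m`. Up to a scalar, the bracket of `ψ z` with `c` is the product of the brackets of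
`z` with the points of the fibre over `c`. Hence the cross ratio of `c, c'` with `ψ a, ψ b` is a
product of cross ratios of fibre points with `a, b` (`crossRatio_ratMap_mem`). For `a = 0`, `b = ∞`
and `ψ = χ(x ^ m)` the factors can be taken over the fibres of `χ`, where each is an `m`-th power
`(x / x') ^ m` (`crossRatio_power_mem`). Since `0` and `∞` are periodic, `c / c'` for `c, c'` in the
backward orbit is thus a product of `m`-th powers of quotients of the same kind, and by induction an
`m ^ k`-th power in the compositum for every `k` (`exists_pow_eq_div`). The orbit contains `ζ * c`
along with `c` when `ζ ^ m = 1`, so every such `ζ` has `m ^ k`-th roots in the compositum.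

Chebyshev maps. If `b = w + 1/w`, the orbit contains `z * y + 1/(z * y)` whenever `y ^ d ^ n = w`
and `z ^ d ^ n = 1`. Adding the terms for `z = ζ` and `z = ζ⁻¹` gives `(ζ + 1/ζ) * (y + 1/y)`, so `ζ
+ 1/ζ` is a quotient of orbit sums. One root of unity of order above two then generates the others.

Lattès maps. The covering `π` is the `x`-coordinate up to a Möbius map, so an automorphism `σ`
fixing the orbit acts by pointwise signs on a coset of `E[e ^ k]`. It follows that it acts by one
sign on the `l`-power torsion for each prime `l` dividing `e` (`exists_sign_of_fixes`). Counting a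
generic fibre shows that `[e]` has a kernel of `deg φ` elements, which supplies points of order `l ^
n` for every prime `l` dividing `deg φ`. By the Weil pairing, `σ` should act on roots of unity by
the determinant of `±1`, which is `1`.

The pairing is replaced by a direct argument (`map_eq_of_torsion`). For `S` of order `N` and `ζ ^ N
= 1`, choose a function `g` with `g(P + S) = ζ * g(P)` and divisor supported on `E[N ^ 2]`. Twisting
by `σ` and the sign preserves this divisor, hence multiplies `g` by a constant; comparing
eigenvalues yields `σ ζ = ζ`. So the roots of unity lie in the iterated field itself.

The divisor theory needed is built by hand: the valuation at infinity is the degree of the norm, the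
valuation at `P` is its transport by translation, and Abel's theorem comes from the injection of the
group of points into the class group. -/

noncomputable section

set_option linter.unusedSectionVars false

namespace IteratedExt

open Polynomial WeierstrassCurve WeierstrassCurve.Affine
open scoped nonZeroDivisors WithZero

/-! ### The valuation at the point at infinity. -/

section OrderAtInfinity

variable {k : Type*} [Field k] (W : WeierstrassCurve.Affine k)

lemma norm_ne_zero {u : W.CoordinateRing} (hu : u ≠ 0) : Algebra.norm k[X] u ≠ 0 := by
  have : Module.Finite k[X] W.CoordinateRing := .of_basis (CoordinateRing.basis W)
  exact Algebra.norm_ne_zero_iff.mpr hu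

/-- The norm of `p + q * y` has degree `max (2 * deg p) (2 * deg q + 3)`: one entry is even and the
other odd, so leading terms never cancel. This makes the degree of the norm ultrametric. -/
lemma degree_norm_add_le (u v : W.CoordinateRing) :
    (Algebra.norm k[X] (u + v)).degree ≤
      max (Algebra.norm k[X] u).degree (Algebra.norm k[X] v).degree := by
  obtain ⟨p, q, rfl⟩ := CoordinateRing.exists_smul_basis_eq u
  obtain ⟨r, s, rfl⟩ := CoordinateRing.exists_smul_basis_eq v
  rw [show p • (1 : W.CoordinateRing) + q • CoordinateRing.mk W X + (r • 1 + s • CoordinateRing.mk W X)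
    = (p + r) • 1 + (q + s) • CoordinateRing.mk W X by rw [add_smul, add_smul]; abel]
  simp only [CoordinateRing.degree_norm_smul_basis]
  have h1 := degree_add_le p r
  have h2 := degree_add_le q s
  refine max_le ?_ ?_
  · rcases le_max_iff.mp h1 with h | h
    · exact le_trans (nsmul_le_nsmul_right h 2) (le_trans (le_max_left _ _) (le_max_left _ _))
    · exact le_trans (nsmul_le_nsmul_right h 2) (le_trans (le_max_left _ _) (le_max_right _ _))
  · rcases le_max_iff.mp h2 with h | h
    · exact le_trans (add_le_add_left (nsmul_le_nsmul_right h 2) 3)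
        (le_trans (le_max_right _ _) (le_max_left _ _))
    · exact le_trans (add_le_add_left (nsmul_le_nsmul_right h 2) 3)
        (le_trans (le_max_right _ _) (le_max_right _ _))

open scoped Classical in
/-- The valuation at the point at infinity on the coordinate ring of a Weierstrass curve: the
order of the pole of `u` is the degree of its norm. -/
def ringInftyVal : Valuation W.CoordinateRing ℤᵐ⁰ where
  toFun u := if u = 0 then 0 else WithZero.exp ((Algebra.norm k[X] u).natDegree : ℤ)
  map_zero' := by simp
  map_one' := by simp
  map_mul' u v := by
    by_cases hu : u = 0
    · simp [hu]
    by_cases hv : v = 0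
    · simp [hv]
    rw [if_neg (mul_ne_zero hu hv), if_neg hu, if_neg hv, map_mul,
      natDegree_mul (norm_ne_zero W hu) (norm_ne_zero W hv), Nat.cast_add, WithZero.exp_add]
  map_add_le_max' u v := by
    by_cases huv : u + v = 0
    · simp [huv]
    by_cases hu : u = 0
    · simp [hu]
    by_cases hv : v = 0
    · simp [hv]
    rw [if_neg huv, if_neg hu, if_neg hv, le_max_iff, WithZero.exp_le_exp, WithZero.exp_le_exp,
      Nat.cast_le, Nat.cast_le]
    rcases le_max_iff.mp (degree_norm_add_le W u v) with h | h
    · exact Or.inl (natDegree_le_natDegree h)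
    · exact Or.inr (natDegree_le_natDegree h)

lemma ringInftyVal_of_ne_zero {u : W.CoordinateRing} (hu : u ≠ 0) :
    ringInftyVal W u = WithZero.exp ((Algebra.norm k[X] u).natDegree : ℤ) := if_neg hu

/-- The valuation at infinity on the function field of a Weierstrass curve. -/
def inftyVal : Valuation W.FunctionField ℤᵐ⁰ :=
  (ringInftyVal W).extendToLocalization (S := W.CoordinateRing⁰) (fun u hu => by
    rw [Ideal.mem_primeCompl_iff, Valuation.mem_supp_iff,
      ringInftyVal_of_ne_zero W (nonZeroDivisors.ne_zero hu)]
    exact WithZero.exp_ne_zero) W.FunctionField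

lemma inftyVal_algebraMap (u : W.CoordinateRing) :
    inftyVal W (algebraMap _ _ u) = ringInftyVal W u :=
  Valuation.extendToLocalization_apply_map_apply _ _ _ _

/-- The coordinate function `x`. -/
def xGen : W.FunctionField := algebraMap _ _ (CoordinateRing.mk W (C X))

/-- The coordinate function `y`. -/
def yGen : W.FunctionField := algebraMap _ _ (CoordinateRing.mk W X)

lemma inftyVal_smul_basis (p q : k[X]) (h : p • (1 : W.CoordinateRing) + q • CoordinateRing.mk W X ≠ 0) :
    inftyVal W (algebraMap _ _ (p • (1 : W.CoordinateRing) + q • CoordinateRing.mk W X)) =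
      WithZero.exp (((max (2 • p.degree) (2 • q.degree + 3)).unbotD 0 : ℕ) : ℤ) := by
  rw [inftyVal_algebraMap, ringInftyVal_of_ne_zero W h, natDegree,
    CoordinateRing.degree_norm_smul_basis]

lemma inftyVal_xGen : inftyVal W (xGen W) = WithZero.exp 2 := by
  have h : CoordinateRing.mk W (C X) = (X : k[X]) • (1 : W.CoordinateRing) + (0 : k[X]) • CoordinateRing.mk W X := by
    rw [CoordinateRing.smul]; simp
  have h0 : CoordinateRing.mk W (C X) ≠ 0 := by
    simpa [CoordinateRing.XClass] using CoordinateRing.XClass_ne_zero (W' := W) (0 : k)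
  rw [xGen, h, inftyVal_smul_basis W _ _ (h ▸ h0)]
  simp

lemma inftyVal_yGen : inftyVal W (yGen W) = WithZero.exp 3 := by
  have h : CoordinateRing.mk W X = (0 : k[X]) • (1 : W.CoordinateRing) + (1 : k[X]) • CoordinateRing.mk W X := by
    simp
  have h0 : CoordinateRing.mk W X ≠ 0 := by
    simpa [CoordinateRing.YClass] using CoordinateRing.YClass_ne_zero (W' := W) (0 : k[X])
  rw [yGen, h, inftyVal_smul_basis W _ _ (h ▸ h0)]
  simp

lemma algebraMap_eq_C_smul_one (c : k) :
    algebraMap k W.CoordinateRing c = (C c : k[X]) • (1 : W.CoordinateRing) := by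
  rw [IsScalarTower.algebraMap_apply k k[X], Algebra.algebraMap_eq_smul_one (A := W.CoordinateRing)]
  rfl

lemma inftyVal_const {c : k} (hc : c ≠ 0) : inftyVal W (algebraMap k _ c) = 1 := by
  have h : algebraMap k W.CoordinateRing c = (C c : k[X]) • (1 : W.CoordinateRing) + (0 : k[X]) • CoordinateRing.mk W X := by
    rw [zero_smul, add_zero, ← algebraMap_eq_C_smul_one]
  have h0 : algebraMap k W.CoordinateRing c ≠ 0 := by
    simpa using hc
  rw [IsScalarTower.algebraMap_apply k W.CoordinateRing, h, inftyVal_smul_basis W _ _ (h ▸ h0)]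
  simp [degree_C hc]

lemma inftyVal_const_le (c : k) : inftyVal W (algebraMap k _ c) ≤ 1 := by
  by_cases hc : c = 0
  · simp [hc]
  · exact (inftyVal_const W hc).le

/-- A function regular on the affine curve and without a pole at infinity is constant: the degree
formula leaves no room for a `y`-part or for a nonconstant polynomial in `x`. -/
lemma algebraMap_mem_range_of_inftyVal_le {u : W.CoordinateRing}
    (hu : ringInftyVal W u ≤ 1) : ∃ c : k, u = algebraMap k _ c := by
  by_cases h0 : u = 0
  · exact ⟨0, by simp [h0]⟩
  rw [ringInftyVal_of_ne_zero W h0, ← WithZero.exp_zero, WithZero.exp_le_exp] at hu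
  have hn : (Algebra.norm k[X] u).degree ≤ 0 := natDegree_eq_zero_iff_degree_le_zero.mp (by omega)
  obtain ⟨p, q, rfl⟩ := CoordinateRing.exists_smul_basis_eq u
  rw [CoordinateRing.degree_norm_smul_basis, max_le_iff] at hn
  have hq : q = 0 := by
    by_contra hq
    rw [degree_eq_natDegree hq] at hn
    have := hn.2
    norm_cast at this
  have hp : p.natDegree = 0 := by
    by_cases hp : p = 0
    · simp [hp]
    rw [degree_eq_natDegree hp] at hn
    have := hn.1
    rw [nsmul_eq_mul] at this
    norm_cast at this
    omega
  obtain ⟨c, rfl⟩ := natDegree_eq_zero.mp hp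
  exact ⟨c, by rw [hq, zero_smul, add_zero, ← algebraMap_eq_C_smul_one]⟩

end OrderAtInfinity

end IteratedExt

/-! ### Ideals of points and unique factorization in the coordinate ring. -/

namespace IteratedExt

open Polynomial WeierstrassCurve WeierstrassCurve.Affine
open scoped nonZeroDivisors WithZero

lemma exists_eq_span_singleton_mul {R : Type*} [CommRing R] {a : R} {I : Ideal R}
    (h : I ≤ Ideal.span {a}) : ∃ J, I = Ideal.span {a} * J := by
  refine ⟨Submodule.comap (LinearMap.mulLeft R a) I, ?_⟩
  rw [Ideal.eq_span_singleton_mul]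
  refine ⟨fun i hi => ?_, fun j hj => hj⟩
  obtain ⟨j, rfl⟩ := Ideal.mem_span_singleton'.mp (h hi)
  exact ⟨j, by simpa [mul_comm] using hi, mul_comm _ _⟩

section PointIdeals

variable {k : Type*} [Field k] {W : WeierstrassCurve.Affine k}

/-- The ideal of functions vanishing at a point; the unit ideal for the point at infinity. -/
def ptIdeal : W.Point → Ideal W.CoordinateRing
  | 0 => ⊤
  | .some x y _ => CoordinateRing.XYIdeal W x (C y)

lemma ptIdeal_zero : ptIdeal (0 : W.Point) = ⊤ := rfl

lemma ptIdeal_some {x y : k} (h : W.Nonsingular x y) :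
    ptIdeal (.some x y h) = CoordinateRing.XYIdeal W x (C y) := rfl

lemma exists_sub_algebraMap_mem_ptIdeal {P : W.Point} (hP : P ≠ 0) (u : W.CoordinateRing) :
    ∃ c : k, u - algebraMap k _ c ∈ ptIdeal P := by
  obtain _ | ⟨x, y, h⟩ := P
  · exact absurd rfl hP
  let e := CoordinateRing.quotientXYIdealEquiv (W' := W) (x := x) (y := C y) h.1
  refine ⟨e (Ideal.Quotient.mk _ u), ?_⟩
  rw [ptIdeal_some, ← Ideal.Quotient.mk_eq_mk_iff_sub_mem]
  apply e.injective
  rw [show Ideal.Quotient.mk (CoordinateRing.XYIdeal W x (C y)) (algebraMap k _ (e (Ideal.Quotient.mk _ u))) =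
    algebraMap k _ (e (Ideal.Quotient.mk _ u)) from rfl, AlgEquiv.commutes]
  rfl

lemma isMaximal_ptIdeal {P : W.Point} (hP : P ≠ 0) : (ptIdeal P).IsMaximal := by
  obtain _ | ⟨x, y, h⟩ := P
  · exact absurd rfl hP
  let e := CoordinateRing.quotientXYIdealEquiv (W' := W) (x := x) (y := C y) h.1
  rw [ptIdeal_some]
  exact Ideal.Quotient.maximal_of_isField _ (e.toMulEquiv.isField (Field.toIsField k))

lemma algebraMap_mem_ptIdeal_iff {P : W.Point} (hP : P ≠ 0) {c : k} :
    algebraMap k _ c ∈ ptIdeal P ↔ c = 0 := by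
  refine ⟨fun h => ?_, fun h => by simp [h]⟩
  by_contra hc
  refine (isMaximal_ptIdeal hP).ne_top ((Ideal.eq_top_iff_one _).mpr ?_)
  have := Ideal.mul_mem_left _ (algebraMap k _ c⁻¹) h
  rwa [← map_mul, inv_mul_cancel₀ hc, map_one] at this

lemma XClass_eq (x : k) : CoordinateRing.XClass W x = CoordinateRing.mk W (C X) - algebraMap k _ x := by
  rw [CoordinateRing.XClass, C_sub, map_sub]; rfl

lemma YClass_eq (y : k) : CoordinateRing.YClass W (C y) = CoordinateRing.mk W X - algebraMap k _ y := by
  rw [CoordinateRing.YClass, map_sub]; rfl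

lemma XClass_mem_ptIdeal {x y : k} (h : W.Nonsingular x y) :
    CoordinateRing.XClass W x ∈ ptIdeal (.some x y h) :=
  Ideal.subset_span (by simp)

lemma YClass_mem_ptIdeal {x y : k} (h : W.Nonsingular x y) :
    CoordinateRing.YClass W (C y) ∈ ptIdeal (.some x y h) :=
  Ideal.subset_span (by simp)

lemma ptIdeal_le_iff {P Q : W.Point} (hP : P ≠ 0) (hQ : Q ≠ 0) : ptIdeal P ≤ ptIdeal Q ↔ P = Q := by
  refine ⟨fun hle => ?_, fun h => h ▸ le_rfl⟩
  obtain _ | ⟨x, y, h⟩ := P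
  · exact absurd rfl hP
  obtain _ | ⟨x', y', h'⟩ := Q
  · exact absurd rfl hQ
  have h1 := Ideal.sub_mem _ (hle (XClass_mem_ptIdeal h)) (XClass_mem_ptIdeal h')
  have h2 := Ideal.sub_mem _ (hle (YClass_mem_ptIdeal h)) (YClass_mem_ptIdeal h')
  rw [XClass_eq, XClass_eq, sub_sub_sub_cancel_left, ← map_sub, algebraMap_mem_ptIdeal_iff hQ,
    sub_eq_zero] at h1
  rw [YClass_eq, YClass_eq, sub_sub_sub_cancel_left, ← map_sub, algebraMap_mem_ptIdeal_iff hQ,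
    sub_eq_zero] at h2
  subst h1 h2
  rfl

lemma ptIdeal_mul_neg {x y : k} (h : W.Nonsingular x y) :
    ptIdeal (.some x y h) * ptIdeal (-.some x y h) = Ideal.span {CoordinateRing.XClass W x} := by
  rw [mul_comm, Point.neg_some, ptIdeal_some, ptIdeal_some, CoordinateRing.XYIdeal_neg_mul h]
  rfl

/-- To contain is to divide. The ideals of `P` and `-P` multiply to the principal ideal of `x - x₀`,
so after multiplication by the ideal of `-P` the claim becomes divisibility by a nonzero element,
which can be cancelled. -/
lemma exists_eq_ptIdeal_mul {P : W.Point} {I : Ideal W.CoordinateRing} (h : I ≤ ptIdeal P) :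
    ∃ J, I = ptIdeal P * J := by
  obtain _ | ⟨x, y, hP⟩ := P
  · exact ⟨I, by rw [← Point.zero_def, ptIdeal_zero, Ideal.top_mul]⟩
  have hle : ptIdeal (-.some x y hP) * I ≤ Ideal.span {CoordinateRing.XClass W x} := by
    rw [← ptIdeal_mul_neg hP, mul_comm]
    exact Ideal.mul_mono_left h
  obtain ⟨J, hJ⟩ := exists_eq_span_singleton_mul hle
  refine ⟨J, ?_⟩
  have hx := CoordinateRing.XClass_ne_zero (W' := W) x
  apply (Ideal.span_singleton_mul_right_inj hx).mp
  rw [← ptIdeal_mul_neg hP, mul_assoc, hJ, ← ptIdeal_mul_neg hP]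
  ring

instance : IsNoetherianRing W.CoordinateRing :=
  have : Module.Finite k[X] W.CoordinateRing := .of_basis (CoordinateRing.basis W)
  .of_finite k[X] W.CoordinateRing

/-- Nakayama in a domain: an element congruent to `1` modulo the ideal of `P` and killing `J ≠ 0`
would be zero. -/
lemma ptIdeal_mul_ne {P : W.Point} (hP : P ≠ 0) {J : Ideal W.CoordinateRing} (hJ : J ≠ ⊥) :
    ptIdeal P * J ≠ J := by
  intro h
  obtain ⟨r, hr, hr'⟩ := Submodule.exists_sub_one_mem_and_smul_eq_zero_of_fg_of_le_smul
    (ptIdeal P) J (IsNoetherian.noetherian J) (by rw [smul_eq_mul, h])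
  obtain ⟨j, hj, hj0⟩ := Submodule.exists_mem_ne_zero_of_ne_bot hJ
  have h0 := hr' j hj
  rw [smul_eq_mul, mul_eq_zero, or_iff_left hj0] at h0
  rw [h0, zero_sub, neg_mem_iff] at hr
  exact (isMaximal_ptIdeal hP).ne_top ((Ideal.eq_top_iff_one _).mpr hr)

variable [IsAlgClosed k] [W.IsElliptic]

/-- The Nullstellensatz: the residue field of a maximal ideal is finite over the algebraically
closed `k`, hence equal to it, and the residues of `x` and `y` are the coordinates of a point,
nonsingular because the curve is elliptic. -/
lemma exists_le_ptIdeal {I : Ideal W.CoordinateRing} (hI : I ≠ ⊤) :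
    ∃ P : W.Point, P ≠ 0 ∧ I ≤ ptIdeal P := by
  obtain ⟨M, hM, hIM⟩ := Ideal.exists_le_maximal I hI
  let _ : Field (W.CoordinateRing ⧸ M) := Ideal.Quotient.field M
  have : Module.Finite k[X] W.CoordinateRing := .of_basis (CoordinateRing.basis W)
  have : Algebra.FiniteType k W.CoordinateRing := .trans (S := k[X]) inferInstance inferInstance
  have : Algebra.FiniteType k (W.CoordinateRing ⧸ M) := inferInstance
  have : Module.Finite k (W.CoordinateRing ⧸ M) := finite_of_finite_type_of_isJacobsonRing _ _
  have hb := (IsAlgClosed.algebraMap_bijective_of_isIntegral (k := k) (K := W.CoordinateRing ⧸ M)).2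
  obtain ⟨x, hx⟩ := hb (Ideal.Quotient.mk M (CoordinateRing.mk W (C X)))
  obtain ⟨y, hy⟩ := hb (Ideal.Quotient.mk M (CoordinateRing.mk W X))
  have hX : CoordinateRing.XClass W x ∈ M := by
    rw [XClass_eq, ← Ideal.Quotient.mk_eq_mk_iff_sub_mem, ← hx]; rfl
  have hY : CoordinateRing.YClass W (C y) ∈ M := by
    rw [YClass_eq, ← Ideal.Quotient.mk_eq_mk_iff_sub_mem, ← hy]; rfl
  have heq : W.Equation x y := by
    have h0 : (W.polynomial.map ((mapRingHom ((Ideal.Quotient.mk M).comp (algebraMap k _))))).evalEval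
        (Ideal.Quotient.mk M (CoordinateRing.mk W (C X))) (Ideal.Quotient.mk M (CoordinateRing.mk W X)) = 0 := by
      have : Ideal.Quotient.mk M (CoordinateRing.mk W W.polynomial) = 0 := by simp
      rw [← this]
      simp [evalEval, WeierstrassCurve.Affine.polynomial]
      rfl
    rw [← hx, ← hy] at h0
    have h1 : ((Ideal.Quotient.mk M).comp (algebraMap k _)) (W.polynomial.evalEval x y) = 0 := by
      rw [← h0]
      exact (map_mapRingHom_evalEval ((Ideal.Quotient.mk M).comp (algebraMap k _)) _ _ _).symm
    exact (map_eq_zero _).mp h1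
  have hns : W.Nonsingular x y := equation_iff_nonsingular.mp heq
  refine ⟨.some x y hns, Point.some_ne_zero _, hIM.trans (Eq.ge ?_)⟩
  refine (isMaximal_ptIdeal (Point.some_ne_zero hns)).eq_of_le hM.ne_top ?_
  rw [ptIdeal_some, CoordinateRing.XYIdeal, Ideal.span_le]
  rintro u (rfl | rfl)
  exacts [hX, hY]

/-- Noetherian induction: splitting off the ideal of a point leaves a cofactor that is strictly
larger. -/
lemma exists_prod_ptIdeal {I : Ideal W.CoordinateRing} (hI : I ≠ ⊥) :
    ∃ s : Multiset W.Point, 0 ∉ s ∧ I = (s.map ptIdeal).prod := by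
  induction I using IsNoetherian.induction with
  | hgt I ih =>
  by_cases htop : I = ⊤
  · exact ⟨0, by simp, by simp [htop]⟩
  obtain ⟨P, hP, hle⟩ := exists_le_ptIdeal htop
  obtain ⟨J, rfl⟩ := exists_eq_ptIdeal_mul hle
  have hJ : J ≠ ⊥ := fun h => hI (by rw [h, Ideal.mul_bot])
  obtain ⟨s, hs0, hs⟩ := ih J (lt_of_le_of_ne Ideal.mul_le_right (ptIdeal_mul_ne hP hJ)) hJ
  refine ⟨P ::ₘ s, by simp [hs0, hP.symm], by rw [Multiset.map_cons, Multiset.prod_cons, ← hs]⟩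

end PointIdeals

/-! ### Abel's theorem through the class group. -/

section Classes

variable {k : Type*} [Field k] {W : WeierstrassCurve.Affine k}

/-- The invertible fractional ideal of a point. -/
def ptUnit : W.Point → (FractionalIdeal W.CoordinateRing⁰ W.FunctionField)ˣ
  | 0 => 1
  | .some _ _ h => CoordinateRing.XYIdeal' h

lemma coe_ptUnit (P : W.Point) :
    (ptUnit P : FractionalIdeal W.CoordinateRing⁰ W.FunctionField) = ptIdeal P := by
  obtain _ | ⟨x, y, h⟩ := P
  · exact (FractionalIdeal.coeIdeal_top _).symm
  · rfl

lemma coe_prod_ptUnit (s : Multiset W.Point) :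
    ((s.map ptUnit).prod : FractionalIdeal W.CoordinateRing⁰ W.FunctionField) =
      (s.map ptIdeal).prod := by
  induction s using Multiset.induction with
  | empty => simp
  | cons P s ih => 
    simp only [Multiset.map_cons, Multiset.prod_cons, Units.val_mul, ih, coe_ptUnit,
      FractionalIdeal.coeIdeal_mul]

variable [DecidableEq k]

lemma toClass_sum (s : Multiset W.Point) :
    Point.toClass s.sum = Additive.ofMul (ClassGroup.mk W.FunctionField (s.map ptUnit).prod) := by
  induction s using Multiset.induction with
  | empty => simp
  | cons P s ih =>
    rw [Multiset.sum_cons, map_add, ih, Multiset.map_cons, Multiset.prod_cons, map_mul, ofMul_mul]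
    congr 1
    obtain _ | ⟨x, y, h⟩ := P
    · change Point.toClass (0 : W.Point) = Additive.ofMul (ClassGroup.mk W.FunctionField 1)
      rw [map_zero, map_one]; rfl
    · rfl

/-- The map from points to ideal classes is an injective homomorphism. The point at infinity
contributes the unit ideal, so it may occur in `s` without effect. -/
lemma sum_eq_zero_iff (s : Multiset W.Point) :
    s.sum = 0 ↔ ∃ u : W.CoordinateRing, u ≠ 0 ∧ (s.map ptIdeal).prod = Ideal.span {u} := by
  rw [← Point.toClass_eq_zero, toClass_sum, ofMul_eq_zero]
  exact ClassGroup.mk_eq_one_of_coe_ideal (coe_prod_ptUnit s)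

end Classes

end IteratedExt

namespace IteratedExt

open Polynomial WeierstrassCurve WeierstrassCurve.Affine
open scoped nonZeroDivisors WithZero

/-! ### Endomorphisms of the function field from points over it. -/

section Substitution

variable {K Ω : Type*} [Field K] [Field Ω] [Algebra K Ω] (E : WeierstrassCurve K)

variable (Ω) in
/-- The function field of a curve over `K` after base change to `Ω`. -/
abbrev FF : Type _ := (E.baseChange Ω).toAffine.FunctionField

lemma equation_gen :
    (E.baseChange (FF Ω E)).toAffine.Equation (xGen (E.baseChange Ω).toAffine)
      (yGen (E.baseChange Ω).toAffine) := by
  have h : algebraMap _ (FF Ω E)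
    (CoordinateRing.mk (E.baseChange Ω).toAffine (E.baseChange Ω).toAffine.polynomial) = 0 := by simp
  rw [equation_iff]
  simp only [WeierstrassCurve.Affine.polynomial, map_sub, map_add, map_mul, map_pow] at h
  have e : ∀ a : K, algebraMap _ (FF Ω E) (CoordinateRing.mk (E.baseChange Ω).toAffine
      (C (C (algebraMap K Ω a)))) = algebraMap K (FF Ω E) a := fun a =>
    (IsScalarTower.algebraMap_apply K Ω (FF Ω E) a).symm
  simp only [show (E.baseChange Ω).toAffine.a₁ = algebraMap K Ω E.a₁ from rfl,
    show (E.baseChange Ω).toAffine.a₂ = algebraMap K Ω E.a₂ from rfl,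
    show (E.baseChange Ω).toAffine.a₃ = algebraMap K Ω E.a₃ from rfl,
    show (E.baseChange Ω).toAffine.a₄ = algebraMap K Ω E.a₄ from rfl,
    show (E.baseChange Ω).toAffine.a₆ = algebraMap K Ω E.a₆ from rfl, e] at h
  change (yGen _) ^ 2 + algebraMap K _ E.a₁ * xGen _ * yGen _ + algebraMap K _ E.a₃ * yGen _ =
    xGen _ ^ 3 + algebraMap K _ E.a₂ * xGen _ ^ 2 + algebraMap K _ E.a₄ * xGen _ +
      algebraMap K _ E.a₆
  rw [xGen, yGen]
  linear_combination h

instance isElliptic_baseChange (A : Type*) [Field A] [Algebra K A] [E.IsElliptic] :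
    (E.baseChange A).IsElliptic :=
  inferInstanceAs (E.map (algebraMap K A)).IsElliptic

/-- The generic point of an elliptic curve. -/
def genPoint [E.IsElliptic] : (E.baseChange (FF Ω E)).toAffine.Point :=
  .some (xGen _) (yGen _) (equation_iff_nonsingular.mp (equation_gen E))

lemma eval₂_polynomial_eq_zero {A : Type*} [Field A] [Algebra K A] (s : Ω →ₐ[K] A) {x y : A}
    (h : (E.baseChange A).toAffine.Equation x y) :
    eval₂ (eval₂RingHom (s : Ω →+* A) x) y (E.baseChange Ω).toAffine.polynomial = 0 := by
  rw [equation_iff] at h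
  have e : ∀ a : K, s (algebraMap K Ω a) = algebraMap K A a := s.commutes
  simp [WeierstrassCurve.Affine.polynomial, e, eval₂_add, eval₂_mul, eval₂_pow] at h ⊢
  linear_combination h

/-- Evaluation of a function in the coordinate ring at a point, with the constants mapped by `s`. -/
def evalHom {A : Type*} [Field A] [Algebra K A] (s : Ω →ₐ[K] A) {x y : A}
    (h : (E.baseChange A).toAffine.Equation x y) : (E.baseChange Ω).toAffine.CoordinateRing →ₐ[K] A :=
  AlgHom.mk (AdjoinRoot.lift _ y (eval₂_polynomial_eq_zero E s h)) (fun r => by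
    have : algebraMap K (E.baseChange Ω).toAffine.CoordinateRing r =
      AdjoinRoot.of _ (C (algebraMap K Ω r)) := rfl
    rw [this]
    simp)

section

variable {A : Type*} [Field A] [Algebra K A] (s : Ω →ₐ[K] A) {x y : A}
    (h : (E.baseChange A).toAffine.Equation x y)

lemma evalHom_poly (p : Polynomial Ω) :
    evalHom E s h (CoordinateRing.mk _ (C p)) = p.eval₂ (s : Ω →+* A) x := by
  refine (AdjoinRoot.lift_mk (eval₂_polynomial_eq_zero E s h) _).trans ?_
  rw [eval₂_C]
  rfl

lemma evalHom_X : evalHom E s h (CoordinateRing.mk _ (C X)) = x := by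
  rw [evalHom_poly, eval₂_X]

lemma evalHom_Y : evalHom E s h (CoordinateRing.mk _ X) = y := by
  refine (AdjoinRoot.lift_mk (eval₂_polynomial_eq_zero E s h) _).trans ?_
  rw [eval₂_X]

lemma evalHom_const (c : Ω) : evalHom E s h (algebraMap Ω _ c) = s c := by
  change evalHom E s h (CoordinateRing.mk _ (C (C c))) = _
  rw [evalHom_poly, eval₂_C]
  rfl

end

instance decEqFF : DecidableEq (FF Ω E) := Classical.decEq _

/-- The inclusion of the constants in the function field. -/
def constHom : Ω →ₐ[K] FF Ω E := IsScalarTower.toAlgHom K Ω (FF Ω E)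

lemma constHom_apply (c : Ω) : constHom E c = algebraMap Ω (FF Ω E) c := rfl

lemma mem_range_of_eval_eq_zero [IsAlgClosed Ω] {A : Type*} [Field A] [Algebra Ω A] {a : A}
    {p : Polynomial Ω} (hp : p ≠ 0) (ha : aeval a p = 0) : ∃ c : Ω, algebraMap Ω A c = a := by
  have hInt : IsIntegral Ω a := isAlgebraic_iff_isIntegral.mp ⟨p, hp, ha⟩
  exact minpoly.mem_range_of_degree_eq_one Ω a
    (IsAlgClosed.degree_eq_one_of_irreducible Ω (minpoly.irreducible hInt))

lemma dvd_norm (W : WeierstrassCurve.Affine Ω) (u : W.CoordinateRing) :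
    u ∣ CoordinateRing.mk W (C (Algebra.norm (Polynomial Ω) u)) := by
  obtain ⟨p, q, rfl⟩ := CoordinateRing.exists_smul_basis_eq u
  have := CoordinateRing.coe_norm_smul_basis (W' := W) p q
  rw [map_mul] at this
  refine ⟨CoordinateRing.mk W (C p + C q * (-X - C (C W.a₁ * X + C W.a₃))), this.trans ?_⟩
  simp [CoordinateRing.smul]

/-- The constants and the two coordinates of the generic point generate the function field.
Identities between endomorphisms thereby become identities in the group of points over the function
field. -/
lemma substitution_ext [E.IsElliptic] {θ θ' : FF Ω E →ₐ[K] FF Ω E}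
    (hc : ∀ c : Ω, θ (algebraMap Ω _ c) = θ' (algebraMap Ω _ c))
    (hg : Point.map θ (genPoint E) = Point.map θ' (genPoint E)) : θ = θ' := by
  rw [genPoint, Point.map_some, Point.map_some, Point.some.injEq] at hg
  apply IsLocalization.algHom_ext (E.baseChange Ω).toAffine.CoordinateRing⁰
  have key : ((θ : FF Ω E →+* FF Ω E).comp (algebraMap _ _)).comp 
      (CoordinateRing.mk (E.baseChange Ω).toAffine) =
      ((θ' : FF Ω E →+* FF Ω E).comp (algebraMap _ _)).comp
        (CoordinateRing.mk (E.baseChange Ω).toAffine) := by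
    refine Polynomial.ringHom_ext' (Polynomial.ringHom_ext' (RingHom.ext fun c => hc c) hg.1) hg.2
  refine AlgHom.ext fun u => ?_
  obtain ⟨p, rfl⟩ := AdjoinRoot.mk_surjective u
  exact congr($key p)

variable [DecidableEq Ω] [IsAlgClosed Ω] [E.IsElliptic]

/-- A nonconstant point `P` over the function field can be substituted for the generic point, with
`σ` applied to the coefficients. If a function `u ≠ 0` vanished at `P`, its norm would be a nonzero
polynomial vanishing at `x(P)` after twisting, so `x(P)`, and then `y(P)`, would be constant. Hence
substitution is injective and extends to fractions. -/
lemma exists_substitution (σ : Ω →ₐ[K] Ω) (P : (E.baseChange (FF Ω E)).toAffine.Point)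
    (hP : ∀ P₀ : (E.baseChange Ω).toAffine.Point, Point.map (constHom E) P₀ ≠ P) :
    ∃ θ : FF Ω E →ₐ[K] FF Ω E, (∀ c, θ (algebraMap Ω _ c) = algebraMap Ω _ (σ c)) ∧
      Point.map θ (genPoint E) = P := by
  obtain _ | ⟨x, y, h⟩ := P
  · exact absurd rfl (hP 0)
  let f := evalHom E ((constHom E).comp σ) h.1
  have hf : Function.Injective f := by
    rw [injective_iff_map_eq_zero]
    intro u hu
    by_contra hu0
    obtain ⟨v, hv⟩ := dvd_norm _ u
    have h0 : f (CoordinateRing.mk _ (C (Algebra.norm (Polynomial Ω) u))) = 0 := by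
      rw [hv, map_mul, hu, zero_mul]
    rw [evalHom_poly] at h0
    obtain ⟨x₀, rfl⟩ := mem_range_of_eval_eq_zero
      (p := (Algebra.norm (Polynomial Ω) u).map (σ : Ω →+* Ω)) (a := x)
      ((Polynomial.map_ne_zero_iff σ.toRingHom.injective).mpr (norm_ne_zero _ hu0))
      (by rw [aeval_def, eval₂_map]; exact h0)
    have heq := h.1
    rw [equation_iff] at heq
    change _ + algebraMap K _ E.a₁ * _ * _ + algebraMap K _ E.a₃ * _ = 
      _ + algebraMap K _ E.a₂ * _ + algebraMap K _ E.a₄ * _ + algebraMap K _ E.a₆ at heq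
    obtain ⟨y₀, rfl⟩ := mem_range_of_eval_eq_zero (a := y)
      (p := X ^ 2 + (C (algebraMap K Ω E.a₁ * x₀ + algebraMap K Ω E.a₃) * X -
        C (x₀ ^ 3 + algebraMap K Ω E.a₂ * x₀ ^ 2 + algebraMap K Ω E.a₄ * x₀ + algebraMap K Ω E.a₆)))
      (Monic.ne_zero (monic_X_pow_add (by compute_degree!))) (by
        simp [← IsScalarTower.algebraMap_apply]
        linear_combination heq)
    refine hP (.some x₀ y₀ ?_) rfl
    have hinj : Function.Injective (constHom (Ω := Ω) E) := (algebraMap Ω (FF Ω E)).injective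
    exact (E.toAffine.baseChange_nonsingular hinj x₀ y₀).mp h
  refine ⟨IsFractionRing.liftAlgHom hf, fun c => ?_, ?_⟩
  · rw [IsScalarTower.algebraMap_apply Ω (E.baseChange Ω).toAffine.CoordinateRing (FF Ω E) c,
      IsFractionRing.liftAlgHom_apply, IsFractionRing.lift_algebraMap]
    exact evalHom_const ..
  · rw [genPoint, Point.map_some]
    simp only [Point.some.injEq]
    constructor
    · rw [xGen, IsFractionRing.liftAlgHom_apply, IsFractionRing.lift_algebraMap]
      exact evalHom_X ..
    · rw [yGen, IsFractionRing.liftAlgHom_apply, IsFractionRing.lift_algebraMap]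
      exact evalHom_Y ..

end Substitution

end IteratedExt

namespace IteratedExt

open Polynomial WeierstrassCurve WeierstrassCurve.Affine
open scoped nonZeroDivisors WithZero

/-! ### Translations and Galois twists of the function field. -/

section Translation

/-- A polynomial in the coordinate function `x`. -/
def polyFn {k : Type*} [Field k] (W : WeierstrassCurve.Affine k) : k[X] →+* W.FunctionField :=
  (algebraMap W.CoordinateRing W.FunctionField).comp ((CoordinateRing.mk W).comp C)

lemma algebraMap_smul_basis {k : Type*} [Field k] (W : WeierstrassCurve.Affine k) (p q : k[X]) :
    algebraMap _ W.FunctionField (p • (1 : W.CoordinateRing) + q • CoordinateRing.mk W X) =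
      polyFn W p + polyFn W q * yGen W := by
  rw [CoordinateRing.smul, CoordinateRing.smul, mul_one, map_add, map_mul]
  rfl

lemma exists_algebraMap_eq {k : Type*} [Field k] (W : WeierstrassCurve.Affine k)
    (u : W.CoordinateRing) :
    ∃ p q : k[X], algebraMap _ W.FunctionField u = polyFn W p + polyFn W q * yGen W := by
  obtain ⟨p, q, rfl⟩ := CoordinateRing.exists_smul_basis_eq u
  exact ⟨p, q, algebraMap_smul_basis W p q⟩

lemma polyFn_C {k : Type*} [Field k] (W : WeierstrassCurve.Affine k) (c : k) :
    polyFn W (C c) = algebraMap k _ c := rfl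

lemma polyFn_X {k : Type*} [Field k] (W : WeierstrassCurve.Affine k) :
    polyFn W X = xGen W := rfl

lemma inftyVal_poly {k : Type*} [Field k] (W : WeierstrassCurve.Affine k) {p : k[X]} (hp : p ≠ 0) :
    inftyVal W (polyFn W p) = WithZero.exp (2 * p.natDegree : ℤ) := by
  have h : CoordinateRing.mk W (C p) = p • (1 : W.CoordinateRing) + (0 : k[X]) • CoordinateRing.mk W X := by
    rw [CoordinateRing.smul]; simp
  have h0 : CoordinateRing.mk W (C p) ≠ 0 := fun h0 =>
    hp (CoordinateRing.smul_basis_eq_zero (h ▸ h0)).1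
  rw [show polyFn W p = algebraMap _ _ (CoordinateRing.mk W (C p)) from rfl, h, inftyVal_smul_basis W _ _ (h ▸ h0), degree_eq_natDegree hp]
  simp only [degree_zero, nsmul_eq_mul]
  norm_num

/-- Even and odd pole orders at infinity do not cancel. -/
lemma inftyVal_poly_add {k : Type*} [Field k] (W : WeierstrassCurve.Affine k) (p q : k[X])
    {y : W.FunctionField} (hy : inftyVal W y = WithZero.exp 3) :
    inftyVal W (polyFn W p +
      polyFn W q * y) =
    max (inftyVal W (polyFn W p))
      (inftyVal W (polyFn W q) * WithZero.exp 3) := by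
  by_cases hp : p = 0
  · simp [hp, hy]
  by_cases hq : q = 0
  · simp [hq]
  rw [← hy, ← map_mul]
  apply Valuation.map_add_of_distinct_val
  rw [map_mul, hy, inftyVal_poly W hp, inftyVal_poly W hq, ← WithZero.exp_add]
  intro h
  have := WithZero.exp_injective h
  omega

variable {K Ω : Type*} [Field K] [Field Ω] [Algebra K Ω] (E : WeierstrassCurve K)
  [DecidableEq Ω] [E.IsElliptic]

lemma map_constHom_ne_genPoint (P : (E.baseChange Ω).toAffine.Point) :
    Point.map (constHom E) P ≠ genPoint E := by
  obtain _ | ⟨x, y, h⟩ := P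
  · exact (Point.some_ne_zero _).symm
  rw [Point.map_some, genPoint]
  intro heq
  rw [Point.some.injEq] at heq
  have h1 := inftyVal_const_le (E.baseChange Ω).toAffine x
  rw [← constHom_apply, heq.1, inftyVal_xGen, ← WithZero.exp_zero,
    WithZero.exp_le_exp] at h1
  norm_num at h1

variable {E}

lemma map_constHom_injective : Function.Injective (Point.map (W' := E) (constHom (Ω := Ω) E)) :=
  Point.map_injective _

variable [IsAlgClosed Ω]

lemma exists_translation (P : (E.baseChange Ω).toAffine.Point) :
    ∃ θ : FF Ω E →ₐ[K] FF Ω E, (∀ c, θ (algebraMap Ω _ c) = algebraMap Ω _ c) ∧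
      Point.map θ (genPoint E) = genPoint E + Point.map (constHom E) P :=
  exists_substitution E (AlgHom.id K Ω) _ fun P₀ h => map_constHom_ne_genPoint E (P₀ - P) (by
    rw [map_sub, h, add_sub_cancel_right])

/-- Translation by a point, `f ↦ f(· + P)`, on the function field. -/
def translation (P : (E.baseChange Ω).toAffine.Point) : FF Ω E →ₐ[K] FF Ω E :=
  (exists_translation P).choose

lemma translation_const (P : (E.baseChange Ω).toAffine.Point) (c : Ω) :
    translation P (algebraMap Ω _ c) = algebraMap Ω _ c :=
  (exists_translation P).choose_spec.1 c

lemma map_translation_genPoint (P : (E.baseChange Ω).toAffine.Point) :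
    Point.map (translation P) (genPoint E) = genPoint E + Point.map (constHom E) P :=
  (exists_translation P).choose_spec.2

lemma map_translation_const (P Q : (E.baseChange Ω).toAffine.Point) :
    Point.map (translation P) (Point.map (constHom E) Q) = Point.map (constHom E) Q := by
  rw [Point.map_map]
  congr 1
  congr 1
  ext c
  exact translation_const P c

lemma translation_add (P Q : (E.baseChange Ω).toAffine.Point) :
    translation (P + Q) = (translation P).comp (translation Q) := by
  apply substitution_ext
  · intro c
    simp only [AlgHom.comp_apply, translation_const]
  · rw [← Point.map_map, map_translation_genPoint, map_translation_genPoint, map_add, map_add,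
      map_translation_genPoint, map_translation_const, add_assoc]

lemma translation_add_apply (P Q : (E.baseChange Ω).toAffine.Point) (f : FF Ω E) :
    translation (P + Q) f = translation P (translation Q f) := by
  rw [translation_add]; rfl

lemma translation_zero : translation (0 : (E.baseChange Ω).toAffine.Point) = AlgHom.id K _ := by
  apply substitution_ext
  · intro c
    exact translation_const 0 c
  · rw [map_translation_genPoint, map_zero, add_zero]
    rfl

lemma translation_injective :
    Function.Injective (translation : (E.baseChange Ω).toAffine.Point → FF Ω E →ₐ[K] FF Ω E) := by
  intro P Q h
  have := map_translation_genPoint P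
  rw [h, map_translation_genPoint, add_right_inj] at this
  exact map_constHom_injective this.symm

/-- The curve is defined over `K`, so points over the function field may be transported by any
`K`-homomorphism, in particular by one that is only `σ`-semilinear over `Ω`. -/
lemma exists_twist (σ : Ω ≃ₐ[K] Ω) (ε : ℤˣ) :
    ∃ θ : FF Ω E →ₐ[K] FF Ω E, (∀ c, θ (algebraMap Ω _ c) = algebraMap Ω _ (σ c)) ∧
      Point.map θ (genPoint (Ω := Ω) E) = (ε : ℤ) • genPoint (Ω := Ω) E :=
  exists_substitution E (σ : Ω →ₐ[K] Ω) _ fun P₀ h =>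
    map_constHom_ne_genPoint E ((ε : ℤ) • P₀) (by
      rw [map_zsmul, h, smul_smul, Int.units_coe_mul_self, one_smul])

/-- The semilinear automorphism of the function field that acts as `σ` on the constants and
takes the generic point to `±` itself. -/
def twist (σ : Ω ≃ₐ[K] Ω) (ε : ℤˣ) : FF Ω E →ₐ[K] FF Ω E :=
  (exists_twist σ ε).choose

lemma twist_const (σ : Ω ≃ₐ[K] Ω) (ε : ℤˣ) (c : Ω) :
    twist (E := E) σ ε (algebraMap Ω _ c) = algebraMap Ω _ (σ c) :=
  (exists_twist σ ε).choose_spec.1 c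

lemma map_twist_genPoint (σ : Ω ≃ₐ[K] Ω) (ε : ℤˣ) :
    Point.map (twist σ ε) (genPoint (Ω := Ω) E) = (ε : ℤ) • genPoint (Ω := Ω) E :=
  (exists_twist σ ε).choose_spec.2

lemma map_twist_const (σ : Ω ≃ₐ[K] Ω) (ε : ℤˣ) (P : (E.baseChange Ω).toAffine.Point) :
    Point.map (twist σ ε) (Point.map (constHom E) P) =
      Point.map (constHom E) (Point.map (W' := E) (σ : Ω →ₐ[K] Ω) P) := by
  rw [Point.map_map, Point.map_map]
  congr 1
  congr 1
  ext c
  exact twist_const σ ε c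

/-- Both sides send the generic point `G` to `ε • (G + P')`. This commutation rule is what relates
the eigenvalues of a translation before and after twisting. -/
lemma twist_translation (σ : Ω ≃ₐ[K] Ω) (ε : ℤˣ) {P P' : (E.baseChange Ω).toAffine.Point}
    (h : Point.map (W' := E) (σ : Ω →ₐ[K] Ω) P = (ε : ℤ) • P') (f : FF Ω E) :
    twist σ ε (translation P f) = translation P' (twist σ ε f) := by
  suffices H : (twist (E := E) σ ε).comp (translation P) = (translation P').comp (twist σ ε) from
    congr($H f)
  apply substitution_ext
  · intro c
    simp only [AlgHom.comp_apply, translation_const, twist_const]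
  · rw [← Point.map_map, ← Point.map_map, map_translation_genPoint, map_twist_genPoint, map_add,
      map_zsmul, map_twist_genPoint, map_translation_genPoint, map_twist_const, h, map_zsmul,
      smul_add]

lemma twist_xGen (σ : Ω ≃ₐ[K] Ω) (ε : ℤˣ) :
    twist (E := E) σ ε (xGen (E.baseChange Ω).toAffine) = xGen (E.baseChange Ω).toAffine := by
  have h := map_twist_genPoint (E := E) σ ε
  obtain rfl | rfl := Int.units_eq_one_or ε
  · rw [Units.val_one, one_smul, genPoint, Point.map_some, Point.some.injEq] at h
    exact h.1
  · rw [Units.val_neg, Units.val_one, neg_smul, one_smul, genPoint, Point.map_some,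
      Point.neg_some, Point.some.injEq] at h
    exact h.1

lemma inftyVal_algebraMap_base_le (a : K) :
    inftyVal (E.baseChange Ω).toAffine (algebraMap K (FF Ω E) a) ≤ 1 := by
  rw [IsScalarTower.algebraMap_apply K Ω (FF Ω E)]
  exact inftyVal_const_le _ _

lemma inftyVal_twist_yGen (σ : Ω ≃ₐ[K] Ω) (ε : ℤˣ) :
    inftyVal (E.baseChange Ω).toAffine (twist (E := E) σ ε (yGen (E.baseChange Ω).toAffine)) =
      WithZero.exp 3 := by
  have h := map_twist_genPoint (E := E) σ ε
  obtain rfl | rfl := Int.units_eq_one_or ε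
  · rw [Units.val_one, one_smul, genPoint, Point.map_some, Point.some.injEq] at h
    rw [h.2, inftyVal_yGen]
  · rw [Units.val_neg, Units.val_one, neg_smul, one_smul, genPoint, Point.map_some,
      Point.neg_some, Point.some.injEq] at h
    rw [h.2, negY, ← inftyVal_yGen (E.baseChange Ω).toAffine, sub_sub,
      ← Valuation.map_neg _ (yGen (E.baseChange Ω).toAffine)]
    apply Valuation.map_sub_eq_of_lt_left
    rw [Valuation.map_neg, inftyVal_yGen]
    refine lt_of_le_of_lt (Valuation.map_add _ _ _) (max_lt ?_ ?_)
    · rw [map_mul, inftyVal_xGen]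
      refine lt_of_le_of_lt (mul_le_mul_left (inftyVal_algebraMap_base_le E.a₁) _) ?_
      rw [one_mul, WithZero.exp_lt_exp]
      norm_num
    · refine lt_of_le_of_lt (inftyVal_algebraMap_base_le E.a₃) ?_
      rw [← WithZero.exp_zero, WithZero.exp_lt_exp]
      norm_num

lemma twist_polyFn (σ : Ω ≃ₐ[K] Ω) (ε : ℤˣ) (p : Polynomial Ω) :
    twist (E := E) σ ε (polyFn (E.baseChange Ω).toAffine p) =
      polyFn (E.baseChange Ω).toAffine (p.map (σ : Ω →+* Ω)) := by
  induction p using Polynomial.induction_on' with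
  | add p q hp hq => simp only [map_add, hp, hq, Polynomial.map_add]
  | monomial n c =>
    rw [← C_mul_X_pow_eq_monomial]
    simp only [map_mul, map_pow, polyFn_C, polyFn_X, twist_const, twist_xGen, Polynomial.map_mul,
      Polynomial.map_pow, map_X, map_C]
    rfl

/-- The twist fixes `x`, preserves degrees of polynomials in `x`, and sends `y` to a function with
the same pole order `3`; since even and odd pole orders cannot cancel, the valuation is unchanged.
-/
lemma inftyVal_twist (σ : Ω ≃ₐ[K] Ω) (ε : ℤˣ) (f : FF Ω E) :
    inftyVal (E.baseChange Ω).toAffine (twist σ ε f) = inftyVal (E.baseChange Ω).toAffine f := by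
  have key : ∀ u : (E.baseChange Ω).toAffine.CoordinateRing,
      inftyVal (E.baseChange Ω).toAffine (twist σ ε (algebraMap _ (FF Ω E) u)) =
        inftyVal (E.baseChange Ω).toAffine (algebraMap _ _ u) := by
    intro u
    obtain ⟨p, q, h⟩ := exists_algebraMap_eq _ u
    have hmap : ∀ p : Polynomial Ω, inftyVal (E.baseChange Ω).toAffine
        (polyFn (E.baseChange Ω).toAffine (p.map (σ : Ω →+* Ω))) =
          inftyVal (E.baseChange Ω).toAffine (polyFn (E.baseChange Ω).toAffine p) := by
      intro p
      by_cases hp : p = 0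
      · simp [hp]
      have hp' : p.map (σ : Ω →+* Ω) ≠ 0 :=
        (Polynomial.map_ne_zero_iff (σ : Ω →+* Ω).injective).mpr hp
      rw [inftyVal_poly _ hp, inftyVal_poly _ hp', natDegree_map]
    rw [h, map_add, map_mul, twist_polyFn, twist_polyFn,
      inftyVal_poly_add _ _ _ (inftyVal_twist_yGen σ ε), hmap, hmap,
      ← inftyVal_poly_add _ p q (inftyVal_yGen _)]
  obtain ⟨u, w, _, rfl⟩ :=
    IsFractionRing.div_surjective (A := (E.baseChange Ω).toAffine.CoordinateRing) f
  rw [map_div₀, map_div₀, map_div₀, key, key]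

end Translation

end IteratedExt

namespace IteratedExt

open Polynomial WeierstrassCurve WeierstrassCurve.Affine
open scoped nonZeroDivisors WithZero

/-! ### The valuation at an arbitrary point. -/

section Bounds

variable {F : Type*} [Field F] (v : Valuation F ℤᵐ⁰)

lemma val_add_le_exp {n : ℤ} {a b : F} (ha : v a ≤ WithZero.exp n) (hb : v b ≤ WithZero.exp n) :
    v (a + b) ≤ WithZero.exp n := Valuation.map_add_le v ha hb

lemma val_sub_le_exp {n : ℤ} {a b : F} (ha : v a ≤ WithZero.exp n) (hb : v b ≤ WithZero.exp n) :
    v (a - b) ≤ WithZero.exp n := Valuation.map_sub_le v ha hb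

lemma val_mul_le_exp {l m n : ℤ} {a b : F} (ha : v a ≤ WithZero.exp m) (hb : v b ≤ WithZero.exp n)
    (h : m + n ≤ l) : v (a * b) ≤ WithZero.exp l := by
  rw [map_mul]
  refine (mul_le_mul' ha hb).trans ?_
  rw [← WithZero.exp_add, WithZero.exp_le_exp]
  exact h

end Bounds

section PointValuation

variable {K Ω : Type*} [Field K] [Field Ω] [Algebra K Ω] {E : WeierstrassCurve K}
  [DecidableEq Ω] [E.IsElliptic] [IsAlgClosed Ω]

/-- The valuation of the function field at a point, normalized so that functions with a pole
have valuation greater than one. -/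
def ptVal (P : (E.baseChange Ω).toAffine.Point) : Valuation (FF Ω E) ℤᵐ⁰ :=
  (inftyVal (E.baseChange Ω).toAffine).comap (translation P).toRingHom

lemma ptVal_apply (P : (E.baseChange Ω).toAffine.Point) (f : FF Ω E) :
    ptVal P f = inftyVal (E.baseChange Ω).toAffine (translation P f) := rfl

lemma ptVal_const_le (P : (E.baseChange Ω).toAffine.Point) (c : Ω) :
    ptVal P (algebraMap Ω (FF Ω E) c) ≤ 1 := by
  rw [ptVal_apply, translation_const]
  exact inftyVal_const_le _ c

lemma ptVal_const (P : (E.baseChange Ω).toAffine.Point) {c : Ω} (hc : c ≠ 0) :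
    ptVal P (algebraMap Ω (FF Ω E) c) = 1 := by
  rw [ptVal_apply, translation_const]
  exact inftyVal_const _ hc

lemma inftyVal_sub_const (f : FF Ω E) (c : Ω) {n : ℤ} (hn : 0 < n)
    (hf : inftyVal (E.baseChange Ω).toAffine f = WithZero.exp n) :
    inftyVal (E.baseChange Ω).toAffine (f - algebraMap Ω _ c) = WithZero.exp n := by
  rw [← hf]
  apply Valuation.map_sub_eq_of_lt_left
  refine lt_of_le_of_lt (inftyVal_const_le _ c) ?_
  rw [hf, ← WithZero.exp_zero, WithZero.exp_lt_exp]
  exact hn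

/-- This ties the valuation defined by translation to actual vanishing at `P`. By the addition
formula, `x(G + P) - x₀` and `y(G + P) - y₀` are explicit functions of the generic point `G`, and
they are shown to vanish at infinity. -/
lemma ptVal_sub_lt_one {x₀ y₀ : Ω} (h : (E.baseChange Ω).toAffine.Nonsingular x₀ y₀) :
    ptVal (.some x₀ y₀ h) (xGen (E.baseChange Ω).toAffine - algebraMap Ω (FF Ω E) x₀) < 1 ∧
    ptVal (.some x₀ y₀ h) (yGen (E.baseChange Ω).toAffine - algebraMap Ω (FF Ω E) y₀) < 1 := by
  set v := inftyVal (E.baseChange Ω).toAffine with hv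
  set x := xGen (E.baseChange Ω).toAffine with hx
  set y := yGen (E.baseChange Ω).toAffine with hy
  have hm := map_translation_genPoint (E := E) (.some x₀ y₀ h)
  have hX : v (x - algebraMap Ω (FF Ω E) x₀) = WithZero.exp 2 :=
    inftyVal_sub_const _ _ (by norm_num) (inftyVal_xGen _)
  have hY : v (y - algebraMap Ω (FF Ω E) y₀) = WithZero.exp 3 :=
    inftyVal_sub_const _ _ (by norm_num) (inftyVal_yGen _)
  have hX0 : x - algebraMap Ω (FF Ω E) x₀ ≠ 0 := by
    intro h0
    rw [h0, map_zero] at hX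
    exact WithZero.exp_ne_zero hX.symm
  have hne : x ≠ constHom E x₀ := sub_ne_zero.mp hX0
  rw [genPoint, Point.map_some, Point.map_some, Point.add_of_X_ne hne, Point.some.injEq,
    slope_of_X_ne hne, ← hx, ← hy] at hm
  rw [ptVal_apply, ptVal_apply, map_sub (translation _), map_sub (translation _), translation_const, translation_const, hm.1, hm.2]
  simp only [addY, negAddY, negY, addX, constHom_apply]
  have hgen := equation_gen (Ω := Ω) E
  rw [equation_iff, ← hx, ← hy] at hgen
  have h₀ : (E.baseChange (FF Ω E)).toAffine.Equation (algebraMap Ω (FF Ω E) x₀)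
      (algebraMap Ω (FF Ω E) y₀) :=
    (E.toAffine.baseChange_equation (f := constHom E) (algebraMap Ω (FF Ω E)).injective x₀ y₀).mpr h.1
  rw [equation_iff] at h₀
  have hc : ∀ c : Ω, v (algebraMap Ω (FF Ω E) c) ≤ WithZero.exp 0 := fun c => inftyVal_const_le _ c
  have ha₁ : (E.baseChange (FF Ω E)).toAffine.a₁ = algebraMap Ω (FF Ω E) (algebraMap K Ω E.a₁) :=
    IsScalarTower.algebraMap_apply K Ω (FF Ω E) _
  have ha₂ : (E.baseChange (FF Ω E)).toAffine.a₂ = algebraMap Ω (FF Ω E) (algebraMap K Ω E.a₂) :=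
    IsScalarTower.algebraMap_apply K Ω (FF Ω E) _
  have ha₃ : (E.baseChange (FF Ω E)).toAffine.a₃ = algebraMap Ω (FF Ω E) (algebraMap K Ω E.a₃) :=
    IsScalarTower.algebraMap_apply K Ω (FF Ω E) _
  have ha₄ : (E.baseChange (FF Ω E)).toAffine.a₄ = algebraMap Ω (FF Ω E) (algebraMap K Ω E.a₄) :=
    IsScalarTower.algebraMap_apply K Ω (FF Ω E) _
  have ha₆ : (E.baseChange (FF Ω E)).toAffine.a₆ = algebraMap Ω (FF Ω E) (algebraMap K Ω E.a₆) :=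
    IsScalarTower.algebraMap_apply K Ω (FF Ω E) _
  rw [ha₁, ha₂, ha₃, ha₄, ha₆] at hgen h₀
  rw [ha₁, ha₂, ha₃]
  generalize algebraMap K Ω E.a₁ = a₁ at *
  generalize algebraMap K Ω E.a₂ = a₂ at *
  generalize algebraMap K Ω E.a₃ = a₃ at *
  generalize algebraMap K Ω E.a₄ = a₄ at *
  generalize algebraMap K Ω E.a₆ = a₆ at *
  set X := x - algebraMap Ω (FF Ω E) x₀ with hXdef
  set Y := y - algebraMap Ω (FF Ω E) y₀ with hYdef
  set b : Ω := 2 * y₀ + a₁ * x₀ + a₃ with hb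
  set c : Ω := 3 * x₀ ^ 2 + 2 * a₂ * x₀ + a₄ - a₁ * y₀ with hcdef
  set d : Ω := 3 * x₀ + a₂ with hd
  have h2 : algebraMap Ω (FF Ω E) 2 = 2 := map_ofNat (algebraMap Ω (FF Ω E)) 2
  have h3 : algebraMap Ω (FF Ω E) 3 = 3 := map_ofNat (algebraMap Ω (FF Ω E)) 3
  have hb' : algebraMap Ω (FF Ω E) b = 2 * algebraMap Ω _ y₀ + algebraMap Ω _ a₁ * algebraMap Ω _ x₀ +
    algebraMap Ω _ a₃ := by simp [hb, h2]
  have hc' : algebraMap Ω (FF Ω E) c = 3 * algebraMap Ω _ x₀ ^ 2 + 2 * algebraMap Ω _ a₂ *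
    algebraMap Ω _ x₀ + algebraMap Ω _ a₄ - algebraMap Ω _ a₁ * algebraMap Ω _ y₀ := by simp [hcdef, h2, h3]
  have hd' : algebraMap Ω (FF Ω E) d = 3 * algebraMap Ω _ x₀ + algebraMap Ω _ a₂ := by simp [hd, h3]
  have hxX : x = X + algebraMap Ω _ x₀ := by rw [hXdef]; ring
  have hyY : y = Y + algebraMap Ω _ y₀ := by rw [hYdef]; ring
  -- The Weierstrass equation expanded about `(x₀, y₀)`. It has no constant term because that point
  -- lies on the curve.
  have key : Y ^ 2 + algebraMap Ω _ b * Y + algebraMap Ω _ a₁ * X * Y =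
      X ^ 3 + algebraMap Ω _ d * X ^ 2 + algebraMap Ω _ c * X := by
    rw [hb', hc', hd', hXdef, hYdef]
    linear_combination hgen - h₀
  have hXi : v X⁻¹ = WithZero.exp (-2) := by rw [map_inv₀, hX, WithZero.exp_neg]
  -- The expanded equation cancels the leading poles: the numerator on the right has pole order at
  -- most `3`, while division by `X ^ 2` lowers the order by `4`.
  have e₁ : (Y / X) ^ 2 + algebraMap Ω (FF Ω E) a₁ * (Y / X) - algebraMap Ω _ a₂ - x -
      algebraMap Ω _ x₀ - algebraMap Ω _ x₀ =
        (algebraMap Ω _ c * X - algebraMap Ω _ b * Y) * (X⁻¹ * X⁻¹) := by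
    rw [hxX]
    rw [hd'] at key
    field_simp
    linear_combination key
  have v₁ : v ((algebraMap Ω _ c * X - algebraMap Ω _ b * Y) * (X⁻¹ * X⁻¹)) ≤ WithZero.exp (-1) := by
    refine val_mul_le_exp v (m := 3) (n := -4) ?_ ?_ (by norm_num)
    · exact val_sub_le_exp v (val_mul_le_exp v (hc c) hX.le (by norm_num))
        (val_mul_le_exp v (hc b) hY.le (by norm_num))
    · exact val_mul_le_exp v hXi.le hXi.le (by norm_num)
  have hlt : (WithZero.exp (-1) : ℤᵐ⁰) < 1 := by
    rw [← WithZero.exp_zero, WithZero.exp_lt_exp]; norm_num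
  constructor
  · rw [e₁]
    exact lt_of_le_of_lt v₁ hlt
  -- The same cancellation for `y`, now with a numerator of pole order at most `5` over `X ^ 3`,
  -- which lowers it by `6`.
  · have e₂ : -(Y / X * ((Y / X) ^ 2 + algebraMap Ω (FF Ω E) a₁ * (Y / X) - algebraMap Ω _ a₂ - x -
      algebraMap Ω _ x₀ - x) + y) - algebraMap Ω _ a₁ * ((Y / X) ^ 2 + algebraMap Ω (FF Ω E) a₁ * (Y / X) - algebraMap Ω _ a₂ - x -
      algebraMap Ω _ x₀) - algebraMap Ω _ a₃ - algebraMap Ω _ y₀ =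
        (algebraMap Ω _ b * (algebraMap Ω _ d * (X * X) + algebraMap Ω _ c * X - algebraMap Ω _ b * Y
          - algebraMap Ω _ a₁ * (X * Y)) - algebraMap Ω _ c * (X * Y)) * (X⁻¹ * (X⁻¹ * X⁻¹)) -
        algebraMap Ω _ a₁ * ((algebraMap Ω _ c * X - algebraMap Ω _ b * Y) * (X⁻¹ * X⁻¹)) := by
      have e₃ : (algebraMap Ω (FF Ω E) b * (algebraMap Ω _ d * (X * X) + algebraMap Ω _ c * X - algebraMap Ω _ b * Y
          - algebraMap Ω _ a₁ * (X * Y)) - algebraMap Ω _ c * (X * Y)) = 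
          - Y * (algebraMap Ω _ c * X - algebraMap Ω _ b * Y) - algebraMap Ω _ b * X ^ 3 := by
        linear_combination - algebraMap Ω (FF Ω E) b * key
      rw [e₃, ← e₁, sub_mul, neg_mul, neg_mul, show Y * (algebraMap Ω _ c * X - algebraMap Ω _ b * Y) * (X⁻¹ * (X⁻¹ * X⁻¹))
        = (Y / X) * ((algebraMap Ω _ c * X - algebraMap Ω _ b * Y) * (X⁻¹ * X⁻¹)) by
          field_simp, ← e₁, hb', hxX, hyY]
      field_simp
      ring
    rw [e₂]
    refine lt_of_le_of_lt (val_sub_le_exp v (val_mul_le_exp v (m := 5) (n := -6) ?_ ?_ (by norm_num))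
      (val_mul_le_exp v (hc _) v₁ (by norm_num))) hlt
    · refine val_sub_le_exp v (val_mul_le_exp v (m := 0) (n := 5) (hc _) ?_ (by norm_num))
        (val_mul_le_exp v (m := 0) (n := 5) (hc _) ?_ (by norm_num))
      · refine val_sub_le_exp v (val_sub_le_exp v (val_add_le_exp v ?_ ?_) ?_) ?_
        · exact val_mul_le_exp v (m := 0) (n := 4) (hc _) (val_mul_le_exp v hX.le hX.le (by norm_num)) (by norm_num)
        · exact val_mul_le_exp v (hc _) hX.le (by norm_num)
        · exact val_mul_le_exp v (hc _) hY.le (by norm_num)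
        · exact val_mul_le_exp v (m := 0) (n := 5) (hc _) (val_mul_le_exp v hX.le hY.le (by norm_num)) (by norm_num)
      · exact val_mul_le_exp v hX.le hY.le (by norm_num)
    · exact val_mul_le_exp v hXi.le (val_mul_le_exp v (l := -4) hXi.le hXi.le (by norm_num)) (by norm_num)

end PointValuation

end IteratedExt

namespace IteratedExt

open Polynomial WeierstrassCurve WeierstrassCurve.Affine
open scoped nonZeroDivisors WithZero

/-! ### Orders and divisors of functions. -/

section Divisors

variable {K Ω : Type*} [Field K] [Field Ω] [Algebra K Ω] {E : WeierstrassCurve K}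
  [DecidableEq Ω] [E.IsElliptic] [IsAlgClosed Ω]

/-- The order of vanishing of a function at a point. -/
def ord (P : (E.baseChange Ω).toAffine.Point) (f : FF Ω E) : ℤ := -WithZero.log (ptVal P f)

lemma ord_mul (P : (E.baseChange Ω).toAffine.Point) {f g : FF Ω E} (hf : f ≠ 0) (hg : g ≠ 0) :
    ord P (f * g) = ord P f + ord P g := by
  rw [ord, ord, ord, map_mul, WithZero.log_mul ((Valuation.ne_zero_iff _).mpr hf)
    ((Valuation.ne_zero_iff _).mpr hg), neg_add]

lemma ord_one (P : (E.baseChange Ω).toAffine.Point) : ord P (1 : FF Ω E) = 0 := by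
  rw [ord, map_one, WithZero.log_one, neg_zero]

lemma ord_inv (P : (E.baseChange Ω).toAffine.Point) (f : FF Ω E) :
    ord P f⁻¹ = -ord P f := by
  rw [ord, ord, map_inv₀, WithZero.log_inv]

lemma ord_div (P : (E.baseChange Ω).toAffine.Point) {f g : FF Ω E} (hf : f ≠ 0) (hg : g ≠ 0) :
    ord P (f / g) = ord P f - ord P g := by
  rw [div_eq_mul_inv, ord_mul P hf (inv_ne_zero hg), ord_inv, sub_eq_add_neg]

lemma ord_pow (P : (E.baseChange Ω).toAffine.Point) (f : FF Ω E) (n : ℕ) :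
    ord P (f ^ n) = n * ord P f := by
  rw [ord, ord, map_pow, WithZero.log_pow]
  simp

lemma ord_prod {ι : Type*} (P : (E.baseChange Ω).toAffine.Point) (s : Finset ι) {f : ι → FF Ω E}
    (hf : ∀ i ∈ s, f i ≠ 0) : ord P (∏ i ∈ s, f i) = ∑ i ∈ s, ord P (f i) := by
  classical
  induction s using Finset.induction_on with
  | empty => simp [ord_one]
  | insert i s hi ih =>
    rw [Finset.prod_insert hi, Finset.sum_insert hi, ord_mul P (hf i (by simp))
      (Finset.prod_ne_zero_iff.mpr fun j hj => hf j (by simp [hj])), ih fun j hj => hf j (by simp [hj])]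

lemma translation_ne_zero (P : (E.baseChange Ω).toAffine.Point) {f : FF Ω E} (hf : f ≠ 0) :
    translation P f ≠ 0 := (_root_.map_ne_zero _).mpr hf

lemma ord_translation (P Q : (E.baseChange Ω).toAffine.Point) (f : FF Ω E) :
    ord P (translation Q f) = ord (P + Q) f := by
  rw [ord, ord, ptVal_apply, ptVal_apply, translation_add_apply]

lemma ord_const (P : (E.baseChange Ω).toAffine.Point) {c : Ω} (hc : c ≠ 0) :
    ord P (algebraMap Ω (FF Ω E) c) = 0 := by
  rw [ord, ptVal_const P hc, WithZero.log_one, neg_zero]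

lemma ord_twist (σ : Ω ≃ₐ[K] Ω) (ε : ℤˣ) {P P' : (E.baseChange Ω).toAffine.Point}
    (h : Point.map (W' := E) (σ : Ω →ₐ[K] Ω) P = (ε : ℤ) • P') (f : FF Ω E) :
    ord P' (twist σ ε f) = ord P f := by
  rw [ord, ord, ptVal_apply, ptVal_apply, ← twist_translation σ ε h, inftyVal_twist]

/-- An element of the coordinate ring, as a function. -/
abbrev toFn (u : (E.baseChange Ω).toAffine.CoordinateRing) : FF Ω E := algebraMap _ _ u

lemma toFn_ne_zero {u : (E.baseChange Ω).toAffine.CoordinateRing} (hu : u ≠ 0) : toFn u ≠ 0 :=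
  (map_ne_zero_iff _ (IsFractionRing.injective _ _)).mpr hu

lemma ptVal_toFn_le_one {P : (E.baseChange Ω).toAffine.Point} (hP : P ≠ 0)
    (u : (E.baseChange Ω).toAffine.CoordinateRing) : ptVal P (toFn u) ≤ 1 := by
  obtain _ | ⟨x₀, y₀, h⟩ := P
  · exact absurd rfl hP
  obtain ⟨hx, hy⟩ := ptVal_sub_lt_one h
  set v := ptVal (E := E) (.some x₀ y₀ h)
  have hx' : v (xGen (E.baseChange Ω).toAffine) ≤ 1 := by
    rw [← sub_add_cancel (xGen (E.baseChange Ω).toAffine) (algebraMap Ω (FF Ω E) x₀)]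
    exact Valuation.map_add_le v hx.le (ptVal_const_le _ _)
  have hy' : v (yGen (E.baseChange Ω).toAffine) ≤ 1 := by
    rw [← sub_add_cancel (yGen (E.baseChange Ω).toAffine) (algebraMap Ω (FF Ω E) y₀)]
    exact Valuation.map_add_le v hy.le (ptVal_const_le _ _)
  have hp : ∀ p : Polynomial Ω, v (polyFn (E.baseChange Ω).toAffine p) ≤ 1 := by
    intro p
    induction p using Polynomial.induction_on' with
    | add p q hp hq => rw [map_add]; exact Valuation.map_add_le v hp hq
    | monomial n c =>
      rw [← C_mul_X_pow_eq_monomial, map_mul, map_pow, polyFn_C, polyFn_X, map_mul, map_pow]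
      exact mul_le_one' (ptVal_const_le _ c) (pow_le_one' hx' n)
  obtain ⟨p, q, hpq⟩ := exists_algebraMap_eq _ u
  rw [toFn, hpq]
  refine Valuation.map_add_le v (hp p) ?_
  rw [map_mul]
  exact mul_le_one' (hp q) hy'

lemma ptVal_toFn_lt_one_iff {P : (E.baseChange Ω).toAffine.Point} (hP : P ≠ 0)
    (u : (E.baseChange Ω).toAffine.CoordinateRing) : ptVal P (toFn u) < 1 ↔ u ∈ ptIdeal P := by
  have key : ∀ u ∈ ptIdeal P, ptVal P (toFn u) < 1 := by
    intro u hu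
    obtain _ | ⟨x₀, y₀, h⟩ := P
    · exact absurd rfl hP
    rw [ptIdeal_some, CoordinateRing.XYIdeal, Ideal.mem_span_pair] at hu
    obtain ⟨a, b, rfl⟩ := hu
    rw [toFn, map_add, map_mul, map_mul]
    refine Valuation.map_add_lt _ ?_ ?_
    · rw [map_mul]
      refine mul_lt_one_of_nonneg_of_lt_one_right (ptVal_toFn_le_one hP a) zero_le ?_
      rw [XClass_eq, map_sub]
      exact (ptVal_sub_lt_one h).1
    · rw [map_mul]
      refine mul_lt_one_of_nonneg_of_lt_one_right (ptVal_toFn_le_one hP b) zero_le ?_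
      rw [YClass_eq, map_sub]
      exact (ptVal_sub_lt_one h).2
  refine ⟨fun h => ?_, key u⟩
  -- Conversely, `u` differs from its value `c` by an element vanishing at `P`; if `c ≠ 0`, then `c`
  -- would have valuation below one.
  obtain ⟨c, hc⟩ := exists_sub_algebraMap_mem_ptIdeal hP u
  by_cases hc0 : c = 0
  · simpa [hc0] using hc
  · exfalso
    have h1 := key _ hc
    have h2 := Valuation.map_sub_lt (ptVal P) h h1
    rw [toFn, toFn, ← map_sub, sub_sub_cancel] at h2
    have h3 := ptVal_const (E := E) P hc0
    exact absurd (show ptVal (E := E) P (algebraMap Ω (FF Ω E) c) < 1 from h2) (by rw [h3]; exact lt_irrefl 1)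

lemma ord_toFn_nonneg {P : (E.baseChange Ω).toAffine.Point} (hP : P ≠ 0)
    (u : (E.baseChange Ω).toAffine.CoordinateRing) : 0 ≤ ord P (toFn u) := by
  by_cases hu : u = 0
  · simp [hu, ord]
  rw [ord, neg_nonneg]
  have := ptVal_toFn_le_one hP u
  rwa [← WithZero.exp_zero, ← WithZero.log_le_iff_le_exp ((Valuation.ne_zero_iff _).mpr (toFn_ne_zero hu))] at this

lemma ord_toFn_eq_zero {P : (E.baseChange Ω).toAffine.Point} (hP : P ≠ 0)
    {u : (E.baseChange Ω).toAffine.CoordinateRing} (hu : u ∉ ptIdeal P) : ord P (toFn u) = 0 := by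
  have h1 := ptVal_toFn_le_one hP u
  rw [← ptVal_toFn_lt_one_iff hP] at hu
  rw [ord, le_antisymm h1 (not_lt.mp hu), WithZero.log_one, neg_zero]

lemma ord_toFn_pos {P : (E.baseChange Ω).toAffine.Point} (hP : P ≠ 0)
    {u : (E.baseChange Ω).toAffine.CoordinateRing} (hu0 : u ≠ 0) (hu : u ∈ ptIdeal P) :
    0 < ord P (toFn u) := by
  have := (ptVal_toFn_lt_one_iff hP u).mpr hu
  rw [← WithZero.exp_zero, ← WithZero.log_lt_iff_lt_exp ((Valuation.ne_zero_iff _).mpr (toFn_ne_zero hu0))] at this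
  rw [ord]
  omega

/-- The function `x / y` has a simple zero at infinity; translation carries it to `P`. -/
lemma exists_ptVal_eq (P : (E.baseChange Ω).toAffine.Point) : ∃ f : FF Ω E, f ≠ 0 ∧ ord P f = 1 := by
  set w := xGen (E.baseChange Ω).toAffine / yGen (E.baseChange Ω).toAffine
  have hw : inftyVal (E.baseChange Ω).toAffine w = WithZero.exp (-1) := by
    rw [map_div₀, inftyVal_xGen, inftyVal_yGen, ← WithZero.exp_sub]; norm_num
  have hw0 : w ≠ 0 := fun h => by
    rw [h, map_zero] at hw; exact WithZero.exp_ne_zero hw.symm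
  refine ⟨translation (-P) w, translation_ne_zero _ hw0, ?_⟩
  rw [ord_translation, add_neg_cancel, ord, ptVal_apply, translation_zero]
  change -WithZero.log (inftyVal (E.baseChange Ω).toAffine w) = 1
  rw [hw, WithZero.log_exp]
  norm_num

/-- The ideal identity `u * J' ^ r = t ^ r * J` is tested on elements of `J` and `J' ^ r` that are
units at `P`: each of `u` and `t ^ r` divides a local unit multiple of the other, so their orders
agree. -/
lemma ord_eq_mul_ord {P : (E.baseChange Ω).toAffine.Point} (hP : P ≠ 0)
    {u t : (E.baseChange Ω).toAffine.CoordinateRing} (hu : u ≠ 0) (ht : t ≠ 0) {r : ℕ}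
    {J J' : Ideal (E.baseChange Ω).toAffine.CoordinateRing}
    (huJ : Ideal.span {u} = ptIdeal P ^ r * J) (hJ : ¬ J ≤ ptIdeal P)
    (htJ : Ideal.span {t} = ptIdeal P * J') (hJ' : ¬ J' ≤ ptIdeal P) :
    ord P (toFn u) = r * ord P (toFn t) := by
  have hprime := (isMaximal_ptIdeal hP).isPrime
  have hJ'r : ¬ J' ^ r ≤ ptIdeal P := fun h => hJ' (hprime.le_of_pow_le h)
  obtain ⟨j', hj', hj'P⟩ := SetLike.not_le_iff_exists.mp hJ'r
  obtain ⟨j, hj, hjP⟩ := SetLike.not_le_iff_exists.mp hJ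
  have hj0 : j ≠ 0 := fun h => hjP (h ▸ zero_mem _)
  have hj'0 : j' ≠ 0 := fun h => hj'P (h ▸ zero_mem _)
  have heq : Ideal.span {u} * J' ^ r = Ideal.span {t ^ r} * J := by
    rw [huJ, ← Ideal.span_singleton_pow, htJ, mul_pow]; ring
  have h1 : u * j' ∈ Ideal.span {t ^ r} * J := heq ▸ Ideal.mul_mem_mul (Ideal.mem_span_singleton_self u) hj'
  have h2 : t ^ r * j ∈ Ideal.span {u} * J' ^ r :=
    heq ▸ Ideal.mul_mem_mul (Ideal.mem_span_singleton_self _) hj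
  obtain ⟨a, ha⟩ := Ideal.mem_span_singleton.mp (Ideal.mul_le_left h1)
  obtain ⟨b, hb⟩ := Ideal.mem_span_singleton.mp (Ideal.mul_le_left h2)
  have ha0 : a ≠ 0 := by rintro rfl; simp [hu, hj'0] at ha
  have hb0 : b ≠ 0 := by rintro rfl; simp [ht, hj0] at hb
  have o1 : ord P (toFn u) + ord P (toFn j') = r * ord P (toFn t) + ord P (toFn a) := by
    rw [← ord_mul P (toFn_ne_zero hu) (toFn_ne_zero hj'0), ← ord_pow, 
      ← ord_mul P (pow_ne_zero _ (toFn_ne_zero ht)) (toFn_ne_zero ha0), toFn, toFn, toFn, toFn,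
      ← map_mul, ← map_pow, ← map_mul, ha]
  have o2 : r * ord P (toFn t) + ord P (toFn j) = ord P (toFn u) + ord P (toFn b) := by
    rw [← ord_mul P (toFn_ne_zero hu) (toFn_ne_zero hb0), ← ord_pow,
      ← ord_mul P (pow_ne_zero _ (toFn_ne_zero ht)) (toFn_ne_zero hj0), toFn, toFn, toFn, toFn,
      ← map_mul, ← map_pow, ← map_mul, hb]
  have := ord_toFn_nonneg hP a
  have := ord_toFn_nonneg hP b
  have := ord_toFn_eq_zero hP hjP
  have := ord_toFn_eq_zero hP hj'P
  omega

lemma prod_ptIdeal_eq (P : (E.baseChange Ω).toAffine.Point) (hP : P ≠ 0)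
    (s : Multiset (E.baseChange Ω).toAffine.Point) :
    ∃ J, (s.map ptIdeal).prod = ptIdeal P ^ s.count P * J ∧ ¬ J ≤ ptIdeal P := by
  have hprime := (isMaximal_ptIdeal hP).isPrime
  refine ⟨((s.filter (· ≠ P)).map ptIdeal).prod, ?_, fun h => ?_⟩
  · conv_lhs => rw [← Multiset.filter_add_not (· = P) s]
    rw [Multiset.map_add, Multiset.prod_add, Multiset.filter_eq', Multiset.map_replicate,
      Multiset.prod_replicate]
  · obtain ⟨I, hI, hle⟩ := (Ideal.IsPrime.multiset_prod_le hprime).mp h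
    obtain ⟨Q, hQ, rfl⟩ := Multiset.mem_map.mp hI
    rw [Multiset.mem_filter] at hQ
    by_cases hQ0 : Q = 0
    · rw [hQ0, ptIdeal_zero, top_le_iff] at hle
      exact hprime.ne_top hle
    · exact hQ.2 ((ptIdeal_le_iff hQ0 hP).mp hle)

lemma exists_uniformizer {P : (E.baseChange Ω).toAffine.Point} (hP : P ≠ 0) :
    ∃ (t : (E.baseChange Ω).toAffine.CoordinateRing) (J' : Ideal _), t ≠ 0 ∧
      Ideal.span {t} = ptIdeal P * J' ∧ ¬ J' ≤ ptIdeal P ∧ ord P (toFn t) = 1 := by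
  have hbot : ptIdeal P ≠ ⊥ := by
    obtain _ | ⟨x, y, h⟩ := P
    · exact absurd rfl hP
    · intro h0
      have := XClass_mem_ptIdeal h
      rw [h0, Ideal.mem_bot] at this
      exact CoordinateRing.XClass_ne_zero x this
  have hlt : ¬ ptIdeal P ≤ ptIdeal P * ptIdeal P := fun h =>
    ptIdeal_mul_ne hP hbot (le_antisymm Ideal.mul_le_right h)
  -- Take `t` in the ideal of `P` but not in its square. Every order at `P` is a multiple of `ord P
  -- t`, and the order `1` occurs, so the positive integer `ord P t` is `1`.
  obtain ⟨t, ht, ht2⟩ := SetLike.not_le_iff_exists.mp hlt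
  have ht0 : t ≠ 0 := fun h => ht2 (h ▸ zero_mem _)
  obtain ⟨J', hJ'⟩ := exists_eq_ptIdeal_mul ((Ideal.span_singleton_le_iff_mem (ptIdeal P)).mpr ht)
  have hJ'P : ¬ J' ≤ ptIdeal P := fun h => ht2 (by
    have := Ideal.mem_span_singleton_self t
    rw [hJ'] at this
    exact Ideal.mul_mono_right h this)
  refine ⟨t, J', ht0, hJ', hJ'P, ?_⟩
  obtain ⟨f, hf0, hf⟩ := exists_ptVal_eq (E := E) P
  obtain ⟨a, b, hb, rfl⟩ :=
    IsFractionRing.div_surjective (A := (E.baseChange Ω).toAffine.CoordinateRing) f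
  have hb0 : b ≠ 0 := nonZeroDivisors.ne_zero hb
  have ha0 : a ≠ 0 := by rintro rfl; simp at hf0
  have key : ∀ u : (E.baseChange Ω).toAffine.CoordinateRing, u ≠ 0 →
      ∃ r : ℕ, ord P (toFn u) = r * ord P (toFn t) := by
    intro u hu
    obtain ⟨s, -, hs⟩ := exists_prod_ptIdeal (I := Ideal.span {u})
      (by rwa [Ne, Ideal.span_singleton_eq_bot])
    obtain ⟨J, hJ, hJP⟩ := prod_ptIdeal_eq P hP s
    exact ⟨_, ord_eq_mul_ord hP hu ht0 (hs.trans hJ) hJP hJ' hJ'P⟩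
  obtain ⟨r, hr⟩ := key a ha0
  obtain ⟨r', hr'⟩ := key b hb0
  rw [ord_div P (toFn_ne_zero ha0) (toFn_ne_zero hb0), hr, hr', ← sub_mul] at hf
  have hpos := ord_toFn_pos hP ht0 ht
  rcases Int.mul_eq_one_iff_eq_one_or_neg_one.mp hf with h | h
  · exact h.2
  · omega

lemma ord_toFn_eq_count {P : (E.baseChange Ω).toAffine.Point} (hP : P ≠ 0)
    {u : (E.baseChange Ω).toAffine.CoordinateRing} (hu : u ≠ 0)
    {s : Multiset (E.baseChange Ω).toAffine.Point} (hs : Ideal.span {u} = (s.map ptIdeal).prod) :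
    ord P (toFn u) = s.count P := by
  obtain ⟨t, J', ht0, hJ', hJ'P, ht⟩ := exists_uniformizer hP
  obtain ⟨J, hJ, hJP⟩ := prod_ptIdeal_eq P hP s
  rw [ord_eq_mul_ord hP hu ht0 (hs.trans hJ) hJP hJ' hJ'P, ht, mul_one]

/-- The divisor of a function, away from the point at infinity, is a difference of effective
divisors with the same sum. -/
lemma exists_divisor {f : FF Ω E} (hf : f ≠ 0) :
    ∃ s t : Multiset (E.baseChange Ω).toAffine.Point, s.sum = t.sum ∧
      ∀ P, P ≠ 0 → ord P f = s.count P - t.count P := by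
  obtain ⟨a, b, hb, rfl⟩ :=
    IsFractionRing.div_surjective (A := (E.baseChange Ω).toAffine.CoordinateRing) f
  have hb0 : b ≠ 0 := nonZeroDivisors.ne_zero hb
  have ha0 : a ≠ 0 := by rintro rfl; simp at hf
  obtain ⟨s, -, hs⟩ := exists_prod_ptIdeal (I := Ideal.span {a})
    (by rwa [Ne, Ideal.span_singleton_eq_bot])
  obtain ⟨t, -, ht⟩ := exists_prod_ptIdeal (I := Ideal.span {b})
    (by rwa [Ne, Ideal.span_singleton_eq_bot])
  refine ⟨s, t, ?_, fun P hP => ?_⟩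
  · rw [(sum_eq_zero_iff s).mpr ⟨a, ha0, hs.symm⟩, (sum_eq_zero_iff t).mpr ⟨b, hb0, ht.symm⟩]
  · rw [ord_div P (toFn_ne_zero ha0) (toFn_ne_zero hb0), ord_toFn_eq_count hP ha0 hs,
      ord_toFn_eq_count hP hb0 ht]

lemma exists_toFn_of_sum_eq_zero {s : Multiset (E.baseChange Ω).toAffine.Point} (hs : s.sum = 0) :
    ∃ f : FF Ω E, f ≠ 0 ∧ ∀ P, P ≠ 0 → ord P f = s.count P := by
  obtain ⟨u, hu, h⟩ := (sum_eq_zero_iff s).mp hs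
  exact ⟨toFn u, toFn_ne_zero hu, fun P hP => ord_toFn_eq_count hP hu h.symm⟩

/-- Adding the negatives of the points of `t` to both multisets makes both sums zero, so each is the
divisor of a regular function away from infinity; the quotient has divisor `s - t` there. -/
lemma exists_of_sum_eq {s t : Multiset (E.baseChange Ω).toAffine.Point} (h : s.sum = t.sum) :
    ∃ f : FF Ω E, f ≠ 0 ∧ ∀ P, P ≠ 0 → ord P f = s.count P - t.count P := by
  obtain ⟨a, ha, hs⟩ := exists_toFn_of_sum_eq_zero (E := E) (s := s + t.map (- ·))
    (by rw [Multiset.sum_add, Multiset.sum_map_neg', h, add_neg_cancel])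
  obtain ⟨b, hb, ht⟩ := exists_toFn_of_sum_eq_zero (E := E) (s := t + t.map (- ·))
    (by rw [Multiset.sum_add, Multiset.sum_map_neg', add_neg_cancel])
  refine ⟨a / b, div_ne_zero ha hb, fun P hP => ?_⟩
  rw [ord_div P ha hb, hs P hP, ht P hP, Multiset.count_add, Multiset.count_add]
  push_cast
  ring

lemma exists_const_of_ord_eq_zero {f : FF Ω E} (hf : f ≠ 0)
    (h : ∀ P : (E.baseChange Ω).toAffine.Point, P ≠ 0 → ord P f = 0) :
    ∃ c : Ω, f = algebraMap Ω _ c := by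
  obtain ⟨a, b, hb, rfl⟩ :=
    IsFractionRing.div_surjective (A := (E.baseChange Ω).toAffine.CoordinateRing) f
  have hb0 : b ≠ 0 := nonZeroDivisors.ne_zero hb
  have ha0 : a ≠ 0 := by rintro rfl; simp at hf
  obtain ⟨s, hs0, hs⟩ := exists_prod_ptIdeal (I := Ideal.span {a})
    (by rwa [Ne, Ideal.span_singleton_eq_bot])
  obtain ⟨t, ht0, ht⟩ := exists_prod_ptIdeal (I := Ideal.span {b})
    (by rwa [Ne, Ideal.span_singleton_eq_bot])
  have hst : s = t := by
    ext P
    by_cases hP : P = 0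
    · rw [hP, Multiset.count_eq_zero_of_notMem hs0, Multiset.count_eq_zero_of_notMem ht0]
    · have := h P hP
      rw [ord_div P (toFn_ne_zero ha0) (toFn_ne_zero hb0), ord_toFn_eq_count hP ha0 hs,
        ord_toFn_eq_count hP hb0 ht] at this
      omega
  -- Equal divisors mean associated elements. A unit of the coordinate ring has norm of degree zero,
  -- hence no pole at infinity, hence is constant.
  rw [hst, ← ht, Ideal.span_singleton_eq_span_singleton] at hs
  obtain ⟨w, hw⟩ := hs.symm
  obtain ⟨c, hc⟩ := algebraMap_mem_range_of_inftyVal_le (E.baseChange Ω).toAffine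
    (u := (w : (E.baseChange Ω).toAffine.CoordinateRing)) (by
      rw [ringInftyVal_of_ne_zero _ w.ne_zero,
        natDegree_eq_zero_of_isUnit (w.isUnit.map (Algebra.norm (Polynomial Ω)))]
      simp)
  refine ⟨c, ?_⟩
  rw [← hw, map_mul, mul_div_cancel_left₀ _ (toFn_ne_zero hb0), hc]
  rfl

end Divisors

end IteratedExt

namespace IteratedExt

open Polynomial WeierstrassCurve WeierstrassCurve.Affine
open scoped nonZeroDivisors WithZero

/-! ### Torsion points and roots of unity, in place of the Weil pairing. -/

section RootsOfUnityFromTorsion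

variable {K Ω : Type*} [Field K] [Field Ω] [Algebra K Ω] {E : WeierstrassCurve K}
  [DecidableEq Ω] [E.IsElliptic] [IsAlgClosed Ω]

lemma exists_finsupp_of_multiset {A : Type*} [AddCommGroup A] [DecidableEq A] (s : Multiset A) :
    ∃ D : A →₀ ℤ, Finsupp.linearCombination ℤ id D = s.sum ∧ ∀ P, D P = s.count P := by
  induction s using Multiset.induction with
  | empty => exact ⟨0, by simp, by simp⟩
  | cons P s ih =>
    obtain ⟨D, hD, hc⟩ := ih
    refine ⟨D + Finsupp.single P 1, by simp [hD, add_comm], fun Q => ?_⟩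
    rw [Finsupp.add_apply, hc, Multiset.count_cons, Finsupp.single_apply]
    simp [eq_comm]

/-- The divisor of a function, away from the point at infinity, has sum zero. -/
lemma exists_finsupp_divisor {f : FF Ω E} (hf : f ≠ 0) :
    ∃ D : (E.baseChange Ω).toAffine.Point →₀ ℤ, Finsupp.linearCombination ℤ id D = 0 ∧
      ∀ P, P ≠ 0 → ord P f = D P := by
  obtain ⟨s, t, hst, h⟩ := exists_divisor hf
  obtain ⟨D, hD, hDs⟩ := exists_finsupp_of_multiset s
  obtain ⟨D', hD', hDt⟩ := exists_finsupp_of_multiset t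
  refine ⟨D - D', by rw [map_sub, hD, hD', hst, sub_self], fun P hP => ?_⟩
  rw [h P hP, Finsupp.sub_apply, hDs, hDt]

/-- Every divisor is, away from the point at infinity, linearly equivalent to a point. -/
lemma exists_of_finsupp (D : (E.baseChange Ω).toAffine.Point →₀ ℤ) :
    ∃ f : FF Ω E, f ≠ 0 ∧ ∀ P, P ≠ 0 →
      ord P f = D P - if P = Finsupp.linearCombination ℤ id D then 1 else 0 := by
  induction D using Finsupp.induction_linear with
  | zero => exact ⟨1, one_ne_zero, fun P hP => by simp [ord_one, hP]⟩
  | add D D' h h' =>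
    obtain ⟨f, hf, hfD⟩ := h
    obtain ⟨f', hf', hfD'⟩ := h'
    set T := Finsupp.linearCombination ℤ id D
    set T' := Finsupp.linearCombination ℤ id D'
    obtain ⟨k, hk, hkP⟩ := exists_of_sum_eq (E := E) (s := T ::ₘ {T'}) (t := {T + T'}) (by simp)
    refine ⟨f * f' * k, mul_ne_zero (mul_ne_zero hf hf') hk, fun P hP => ?_⟩
    rw [ord_mul P (mul_ne_zero hf hf') hk, ord_mul P hf hf', hfD P hP, hfD' P hP, hkP P hP, map_add,
      Multiset.count_cons, Multiset.count_singleton, Multiset.count_singleton, Finsupp.add_apply]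
    push_cast
    ring
  | single Q n =>
    rw [Finsupp.linearCombination_single, id]
    obtain ⟨n, rfl | rfl⟩ := n.eq_nat_or_neg
    · obtain ⟨k, hk, hkP⟩ := exists_of_sum_eq (E := E) (s := Multiset.replicate n Q)
        (t := {(n : ℤ) • Q}) (by simp)
      refine ⟨k, hk, fun P hP => ?_⟩
      rw [hkP P hP, Multiset.count_replicate, Multiset.count_singleton, Finsupp.single_apply]
      push_cast
      rfl
    · obtain ⟨k, hk, hkP⟩ := exists_of_sum_eq (E := E) (s := 0)
        (t := Multiset.replicate n Q + {(-n : ℤ) • Q}) (by simp)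
      refine ⟨k, hk, fun P hP => ?_⟩
      rw [hkP P hP, Multiset.count_add, Multiset.count_replicate, Multiset.count_singleton,
        Finsupp.single_apply, Multiset.count_zero]
      by_cases h : Q = P <;> simp [h]
      ring

/-- A cyclic sum over the multiples of a point of finite order. -/
lemma sum_range_shift {M : Type*} [AddCommMonoid M] {N : ℕ} {F : ℕ → M} (h : F N = F 0) :
    ∑ i ∈ Finset.range N, F (i + 1) = ∑ i ∈ Finset.range N, F i := by
  cases N with
  | zero => simp
  | succ n => rw [Finset.sum_range_succ, h, Finset.sum_range_succ']

/-- The Lagrange resolvent `∑ ζ⁻ⁱ h(· + iS)`. The `N` translations are distinct characters, so by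
Dedekind's independence it is nonzero for some `h`. No primitivity of `ζ` is required. -/
lemma exists_eigenfunction {N : ℕ} (hN : 0 < N) {S : (E.baseChange Ω).toAffine.Point}
    (hS : addOrderOf S = N) {ζ : Ω} (hζ : ζ ^ N = 1) :
    ∃ g : FF Ω E, g ≠ 0 ∧ translation S g = algebraMap Ω _ ζ * g := by
  have hζ0 : ζ ≠ 0 := by rintro rfl; simp [hN.ne'] at hζ
  let T : Fin N → (FF Ω E →* FF Ω E) := fun i => (translation ((i : ℕ) • S) : FF Ω E →* FF Ω E)
  have hT : Function.Injective T := by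
    intro i j hij
    have h1 : translation ((i : ℕ) • S) = translation (E := E) ((j : ℕ) • S) := by
      exact AlgHom.ext fun f => congr($hij f)
    have h2 := translation_injective h1
    exact Fin.ext (nsmul_injOn_Iio_addOrderOf (by simp [hS]) (by simp [hS]) h2)
  have hli := (linearIndependent_monoidHom (FF Ω E) (FF Ω E)).comp T hT
  rw [Fintype.linearIndependent_iff] at hli
  have hne : ∑ i : Fin N, algebraMap Ω (FF Ω E) (ζ⁻¹ ^ (i : ℕ)) • (⇑(T i) : FF Ω E → FF Ω E) ≠ 0 := by
    intro h0
    have := hli _ h0 ⟨0, hN⟩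
    simp at this
  obtain ⟨h, hh⟩ := Function.ne_iff.mp hne
  rw [Finset.sum_apply] at hh
  let F : ℕ → FF Ω E := fun i => algebraMap Ω (FF Ω E) (ζ⁻¹ ^ i) * translation (i • S) h
  have hg : ∑ i : Fin N, (algebraMap Ω (FF Ω E) (ζ⁻¹ ^ (i : ℕ)) • (⇑(T i) : FF Ω E → FF Ω E)) h =
      ∑ i ∈ Finset.range N, F i := by
    rw [Finset.sum_range]
    rfl
  refine ⟨∑ i ∈ Finset.range N, F i, hg ▸ hh, ?_⟩
  have hFN : F N = F 0 := by
    simp only [F, inv_pow, ← hS, addOrderOf_nsmul_eq_zero]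
    simp [hS, hζ]
  conv_rhs => rw [← sum_range_shift hFN]
  rw [map_sum, Finset.mul_sum]
  refine Finset.sum_congr rfl fun i _ => ?_
  simp only [F, map_mul, translation_const]
  rw [← translation_add_apply, succ_nsmul', ← mul_assoc, ← map_mul]
  congr 2
  rw [pow_succ']
  field_simp

lemma prod_range_shift {M : Type*} [CommMonoid M] {N : ℕ} {F : ℕ → M} (h : F N = F 0) :
    ∏ i ∈ Finset.range N, F (i + 1) = ∏ i ∈ Finset.range N, F i := by
  cases N with
  | zero => simp
  | succ n => rw [Finset.prod_range_succ, h, Finset.prod_range_succ']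

/-- The multiples of `S` run once through the coset of `P`, so only the term at `Q` survives. -/
lemma sum_multiples_eq {A M : Type*} [AddCommGroup A] [AddCommMonoid M] {S P Q : A} {F : A → M}
    (hS : 0 < addOrderOf S) (hPQ : Q - P ∈ AddSubgroup.zmultiples S)
    (hF : ∀ R, R - P ∈ AddSubgroup.zmultiples S → R ≠ Q → F R = 0) :
    ∑ i ∈ Finset.range (addOrderOf S), F (P + i • S) = F Q := by
  classical
  obtain ⟨j, hj, hjQ⟩ := Finset.mem_image.mp
    ((addOrderOf_pos_iff.mp hS).mem_zmultiples_iff_mem_range_addOrderOf.mp hPQ)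
  have hjQ' : P + j • S = Q := by rw [hjQ]; abel
  rw [Finset.sum_eq_single_of_mem j hj, hjQ']
  intro i hi hij
  refine hF _ (by simp [AddSubgroup.nsmul_mem_zmultiples]) fun h => hij ?_
  rw [← hjQ', add_right_inj] at h
  exact nsmul_injOn_Iio_addOrderOf (by simpa using hi) (by simpa using hj) h

/-- An eigenfunction of translation by `S` can be normalized so that its divisor is supported on
the multiples of `S` and on one further coset of torsion points. -/
lemma exists_normalized_eigenfunction {N : ℕ} (hN : 0 < N) {S : (E.baseChange Ω).toAffine.Point}
    (hS : addOrderOf S = N) {ζ : Ω} (hζ : ζ ^ N = 1) :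
    ∃ g : FF Ω E, g ≠ 0 ∧ translation S g = algebraMap Ω _ ζ * g ∧
      ∀ P, (N ^ 2) • P ≠ 0 → ord P g = 0 := by
  have hζ0 : ζ ≠ 0 := by rintro rfl; simp [hN.ne'] at hζ
  obtain ⟨g, hg, hgS⟩ := exists_eigenfunction hN hS hζ
  have hinv : ∀ (n : ℕ) (P : (E.baseChange Ω).toAffine.Point), ord (P + n • S) g = ord P g := by
    intro n P
    induction n with
    | zero => simp
    | succ n ih =>
      rw [succ_nsmul, ← add_assoc, ← ord_translation, hgS, ord_mul _ _ hg, ord_const _ hζ0, zero_add, ih]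
      simpa using hζ0
  have hinv' : ∀ P Q : (E.baseChange Ω).toAffine.Point, Q - P ∈ AddSubgroup.zmultiples S →
      ord Q g = ord P g := by
    intro P Q h
    obtain ⟨j, hj, hjQ⟩ := Finset.mem_image.mp
      ((addOrderOf_pos_iff.mp (hS ▸ hN)).mem_zmultiples_iff_mem_range_addOrderOf.mp h)
    rw [← hinv j P, hjQ]
    congr 1
    abel
  obtain ⟨D, -, hD⟩ := exists_finsupp_divisor hg
  set A := AddSubgroup.zmultiples S with hA
  let rep : (E.baseChange Ω).toAffine.Point → (E.baseChange Ω).toAffine.Point :=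
    fun P => (QuotientAddGroup.mk P : _ ⧸ A).out
  have hrep : ∀ P, rep P - P ∈ A := fun P => by
    have := QuotientAddGroup.out_eq' (QuotientAddGroup.mk P : _ ⧸ A)
    rw [eq_comm, QuotientAddGroup.eq] at this
    rwa [sub_eq_neg_add]
  have hrep' : ∀ P R, R - P ∈ A → rep R = rep P := fun P R h => by
    have : (QuotientAddGroup.mk R : _ ⧸ A) = QuotientAddGroup.mk P := by
      rw [eq_comm, QuotientAddGroup.eq, ← sub_eq_neg_add]
      exact h
    simp only [rep, this]
  classical
  -- The divisor of `g` is invariant under translation by `S`. `D₀` keeps one representative of each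
  -- coset of `A` other than `A` itself, so its translates rebuild the divisor of `g` off `A`.
  let D₀ := D.filter (fun P => P ∉ A ∧ rep P = P)
  obtain ⟨h, hh, hhD⟩ := exists_of_finsupp (E := E) D₀
  set T := Finsupp.linearCombination ℤ id D₀ with hT
  let F : ℕ → FF Ω E := fun i => translation (i • S) h
  have hF0 : ∀ i, F i ≠ 0 := fun i => translation_ne_zero _ hh
  have hprod : ∏ i ∈ Finset.range N, F i ≠ 0 := Finset.prod_ne_zero_iff.mpr fun i _ => hF0 i
  have hprodS : translation S (∏ i ∈ Finset.range N, F i) = ∏ i ∈ Finset.range N, F i := by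
    conv_rhs => rw [← prod_range_shift (F := F) (by simp [F, ← hS, addOrderOf_nsmul_eq_zero])]
    rw [map_prod]
    refine Finset.prod_congr rfl fun i _ => ?_
    simp only [F]
    rw [← translation_add_apply, succ_nsmul']
  -- The product of the translates of `h` is invariant under translation by `S`, so division keeps
  -- the eigenvalue `ζ`. Off `A` it removes the whole divisor of `g` at the price of the coset of
  -- `T`.
  set g' := g / ∏ i ∈ Finset.range N, F i with hg'
  have hg'0 : g' ≠ 0 := div_ne_zero hg hprod
  have hord : ∀ P, P ∉ A → ord P g' = ∑ i ∈ Finset.range N, if P + i • S = T then 1 else 0 := by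
    intro P hP
    have h1 : ∀ i : ℕ, P + i • S ∉ A := fun i hi => hP (by
      have := A.sub_mem hi (AddSubgroup.nsmul_mem_zmultiples S i)
      rwa [add_sub_cancel_right] at this)
    have h2 : ∀ R, R ∉ A → R ≠ 0 := fun R hR h => hR (h ▸ A.zero_mem)
    rw [hg', ord_div P hg hprod, ord_prod P _ (fun i _ => hF0 i)]
    have h3 : ∑ i ∈ Finset.range N, D₀ (P + i • S) = ord P g := by
      rw [← hS, sum_multiples_eq (F := D₀) (hS ▸ hN) (hrep P)]
      · have hrP : rep P ∉ A := fun h => hP (by simpa using A.sub_mem h (hrep P))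
        rw [Finsupp.filter_apply_pos _ _ ⟨hrP, hrep' _ _ (hrep P)⟩, ← hD _ (h2 _ hrP),
          hinv' _ _ (hrep P)]
      · intro R hR hRP
        exact Finsupp.filter_apply_neg _ _ fun h => hRP (by rw [← h.2, hrep' _ _ hR])
    have h4 : ∀ i ∈ Finset.range N, ord P (F i) = D₀ (P + i • S) - if P + i • S = T then 1 else 0 := by
      intro i _
      rw [ord_translation, hhD _ (h2 _ (h1 i))]
    rw [Finset.sum_congr rfl h4, Finset.sum_sub_distrib, h3]
    ring
  -- If `T` is not in `A`, the divisor of `g'` off `A` consists of the `N` points of the coset of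
  -- `T`, each once. A principal divisor sums to zero, and modulo `A` this sum is `N • T`. As `N`
  -- kills `A`, the coset is killed by `N ^ 2`.
  have hNT : N • T ∈ A := by
    by_cases hTA : T ∈ A
    · exact A.nsmul_mem hTA N
    obtain ⟨D', hD'0, hD'⟩ := exists_finsupp_divisor hg'0
    have hTi : ∀ i : ℕ, T + i • S ∉ A := fun i hi => hTA (by
      have := A.sub_mem hi (AddSubgroup.nsmul_mem_zmultiples S i)
      rwa [add_sub_cancel_right] at this)
    have hD'T : ∀ i : ℕ, D' (T + i • S) = 1 := by
      intro i
      rw [← hD' (T + i • S) (fun h => hTi i (h ▸ A.zero_mem)), hord _ (hTi i), ← hS,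
        sum_multiples_eq (Q := T) (F := fun R => if R = T then (1 : ℤ) else 0) (hS ▸ hN)]
      · simp
      · rw [sub_add_cancel_left]
        exact A.neg_mem (AddSubgroup.nsmul_mem_zmultiples S i)
      · intro R _ hR
        simp [hR]
    have hq := congr(QuotientAddGroup.mk' A $hD'0)
    rw [Finsupp.linearCombination_apply, Finsupp.sum, map_sum, map_zero] at hq
    let V := (Finset.range N).image (fun i => T + i • S)
    have hV : V ⊆ D'.support := by
      intro P hP
      obtain ⟨i, -, rfl⟩ := Finset.mem_image.mp hP
      simp [hD'T]
    rw [← Finset.sum_subset hV, Finset.sum_image] at hq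
    · simp only [id, hD'T, one_smul, map_add] at hq
      have : ∀ i : ℕ, QuotientAddGroup.mk' A (i • S) = 0 := fun i =>
        (QuotientAddGroup.eq_zero_iff _).mpr (AddSubgroup.nsmul_mem_zmultiples S i)
      simp only [this, add_zero, Finset.sum_const, Finset.card_range, ← map_nsmul] at hq
      exact (QuotientAddGroup.eq_zero_iff _).mp hq
    · intro i hi j hj hij
      exact nsmul_injOn_Iio_addOrderOf (by simpa [hS] using hi) (by simpa [hS] using hj)
        (add_left_cancel hij)
    · intro P hP hPV
      by_cases hPA : P ∈ A
      · rw [map_zsmul, show QuotientAddGroup.mk' A (id P) = 0 from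
          (QuotientAddGroup.eq_zero_iff _).mpr hPA, smul_zero]
      · exfalso
        rw [Finsupp.mem_support_iff, ← hD' P (fun h => hPA (h ▸ A.zero_mem)), hord P hPA] at hP
        obtain ⟨i, hi, hi'⟩ := Finset.exists_ne_zero_of_sum_ne_zero hP
        have hPT : P + i • S = T := by
          by_contra hne
          simp [hne] at hi'
        have hmem : P - T ∈ A := by
          rw [← hPT, sub_add_cancel_left]
          exact A.neg_mem (AddSubgroup.nsmul_mem_zmultiples S i)
        obtain ⟨j, hj, hjQ⟩ := Finset.mem_image.mp
          ((addOrderOf_pos_iff.mp (hS ▸ hN)).mem_zmultiples_iff_mem_range_addOrderOf.mp hmem)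
        exact hPV (Finset.mem_image.mpr ⟨j, hS ▸ hj, by rw [hjQ]; abel⟩)
  have hAN : ∀ P ∈ A, N • P = 0 := by
    rintro _ ⟨n, rfl⟩
    change N • n • S = 0
    rw [smul_comm, ← hS, addOrderOf_nsmul_eq_zero, smul_zero]
  refine ⟨g', hg'0, ?_, fun P hP => ?_⟩
  · rw [hg', map_div₀, hgS, hprodS, mul_div_assoc]
  · have hPA : P ∉ A := fun h => hP (by rw [sq, mul_smul, hAN P h, smul_zero])
    rw [hord P hPA]
    refine Finset.sum_eq_zero fun i _ => if_neg fun h => hP ?_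
    rw [eq_sub_of_add_eq h, smul_sub, sq, mul_smul, mul_smul, hAN _ hNT,
      hAN _ (AddSubgroup.nsmul_mem_zmultiples S i), smul_zero, sub_zero]

/-- If an automorphism acts as `±1` on the `N ^ 2`-torsion and there is a point of order `N`, then
it fixes the `N`-th roots of unity. -/
theorem map_eq_of_torsion {N : ℕ} (hN : 0 < N) {S : (E.baseChange Ω).toAffine.Point}
    (hS : addOrderOf S = N) {ζ : Ω} (hζ : ζ ^ N = 1) (σ : Ω ≃ₐ[K] Ω) (ε : ℤˣ)
    (hσ : ∀ T : (E.baseChange Ω).toAffine.Point, (N ^ 2) • T = 0 →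
      Point.map (W' := E) (σ : Ω →ₐ[K] Ω) T = (ε : ℤ) • T) : σ ζ = ζ := by
  obtain ⟨g, hg, hgS, hord⟩ := exists_normalized_eigenfunction hN hS hζ
  have hθ : twist σ ε g ≠ 0 := (_root_.map_ne_zero _).mpr hg
  -- The twist moves the order at `P` to the point `P'` with `σ P = ε • P'`. On the `N ^ 2`-torsion
  -- `P = P'`; elsewhere both orders vanish. So `g` and its twist have the same divisor.
  have hmain : ∀ P, P ≠ 0 → ord P (twist σ ε g / g) = 0 := by
    intro P' _
    rw [ord_div P' hθ hg, sub_eq_zero]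
    obtain ⟨P, hP⟩ : ∃ P, Point.map (W' := E) (σ : Ω →ₐ[K] Ω) P = (ε : ℤ) • P' := by
      refine ⟨Point.map (W' := E) (σ.symm : Ω →ₐ[K] Ω) ((ε : ℤ) • P'), ?_⟩
      rw [Point.map_map, show (σ : Ω →ₐ[K] Ω).comp (σ.symm : Ω →ₐ[K] Ω) = AlgHom.id K Ω by
        ext; simp]
      generalize (ε : ℤ) • P' = Q
      cases Q <;> rfl
    rw [ord_twist σ ε hP]
    by_cases h : (N ^ 2) • P = 0
    · have hPP' := hP
      rw [hσ P h] at hPP'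
      have : P = P' := by
        have := congr((ε : ℤ) • $hPP')
        rwa [smul_smul, smul_smul, Int.units_coe_mul_self, one_smul, one_smul] at this
      rw [this]
    · have h' : (N ^ 2) • P' ≠ 0 := by
        intro h'
        have h1 := hσ P' h'
        rw [← hP] at h1
        exact h (Point.map_injective _ h1 ▸ h')
      rw [hord P h, hord P' h']
  obtain ⟨c, hc⟩ := exists_const_of_ord_eq_zero (div_ne_zero hθ hg) hmain
  rw [div_eq_iff hg] at hc
  have hc0 : algebraMap Ω (FF Ω E) c ≠ 0 := fun h => hθ (by rw [hc, h, zero_mul])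
  have hSS : Point.map (W' := E) (σ : Ω →ₐ[K] Ω) S = (ε : ℤ) • S :=
    hσ S (by rw [sq, mul_smul, ← hS, addOrderOf_nsmul_eq_zero, smul_zero])
  -- The twist of `g` is `c * g`. Twisting `g(· + S) = ζ * g` therefore gives eigenvalue `σ ζ` on
  -- one side and `ζ` on the other.
  have h1 := twist_translation σ ε hSS g
  rw [hgS, map_mul, twist_const, hc, map_mul, translation_const, hgS, mul_left_comm,
    mul_right_inj' hc0] at h1
  exact (algebraMap Ω (FF Ω E)).injective (mul_right_cancel₀ hg h1)

end RootsOfUnityFromTorsion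

end IteratedExt

namespace IteratedExt

open Polynomial

/-! ### Binary forms on the projective line. -/

section BinaryForms

variable {Ω : Type*} [Field Ω]

/-- The value of the degree `d` homogenization of `p` at a vector. -/
def homEval (d : ℕ) (p : Polynomial Ω) (a : Ω × Ω) : Ω :=
  ∑ i ∈ Finset.range (d + 1), p.coeff i * a.1 ^ i * a.2 ^ (d - i)

/-- The determinant of two vectors. -/
def bracket (a b : Ω × Ω) : Ω := a.1 * b.2 - a.2 * b.1

/-- Homogeneous coordinates of a point of the projective line. -/
def coords : OnePoint Ω → Ω × Ω
  | ∞ => (1, 0)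
  | (z : Ω) => (z, 1)

lemma coords_infty : coords (∞ : OnePoint Ω) = (1, 0) := rfl

lemma coords_coe (z : Ω) : coords (z : OnePoint Ω) = (z, 1) := rfl

lemma bracket_coords_eq_zero {x y : OnePoint Ω} : bracket (coords x) (coords y) = 0 ↔ x = y := by
  cases x using OnePoint.rec <;> cases y using OnePoint.rec <;>
    simp [bracket, coords_infty, coords_coe, sub_eq_zero]

lemma homEval_one {d : ℕ} {p : Polynomial Ω} (hp : p.natDegree ≤ d) (z : Ω) :
    homEval d p (z, 1) = p.eval z := by
  rw [homEval, eval_eq_sum_range' (Nat.lt_succ_of_le hp)]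
  simp

lemma homEval_infty (d : ℕ) (p : Polynomial Ω) : homEval d p (1, 0) = p.coeff d := by
  rw [homEval, Finset.sum_eq_single_of_mem d (by simp)]
  · simp
  · intro i hi hid
    have : d - i ≠ 0 := by
      have := Finset.mem_range.mp hi
      omega
    simp [this]

lemma homEval_sub_smul (d : ℕ) (p q : Polynomial Ω) (u v : Ω) (a : Ω × Ω) :
    homEval d (C v * p - C u * q) a = bracket (homEval d p a, homEval d q a) (u, v) := by
  simp only [homEval, bracket, coeff_sub, coeff_C_mul, Finset.sum_mul]
  rw [← Finset.sum_sub_distrib]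
  exact Finset.sum_congr rfl fun i _ => by ring

/-- A nonzero binary form over an algebraically closed field is a product of linear forms. -/
lemma exists_factorization [IsAlgClosed Ω] {d : ℕ} {p : Polynomial Ω} (hp0 : p ≠ 0)
    (hp : p.natDegree ≤ d) :
    ∃ (κ : Ω) (X : Multiset (OnePoint Ω)), κ ≠ 0 ∧ X.card = d ∧
      ∀ z, homEval d p (coords z) = κ * (X.map fun x => bracket (coords z) (coords x)).prod := by
  have hs := IsAlgClosed.splits p
  have hcard : p.roots.card = p.natDegree := hs.natDegree_eq_card_roots.symm
  -- The missing `d - deg p` roots lie at infinity. The bracket of an affine point with `∞` is `-1`,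
  -- which accounts for the sign.
  refine ⟨p.leadingCoeff * (-1) ^ (d - p.natDegree), p.roots.map (OnePoint.some : Ω → OnePoint Ω) +
    Multiset.replicate (d - p.natDegree) ∞, mul_ne_zero (leadingCoeff_ne_zero.mpr hp0) (by simp),
    by simp [hcard]; omega, fun z => ?_⟩
  rw [Multiset.map_add, Multiset.prod_add, Multiset.map_map, Multiset.map_replicate,
    Multiset.prod_replicate]
  cases z using OnePoint.rec with
  | infty =>
    rw [coords_infty, homEval_infty]
    have hc : ∀ x : Ω, coords (OnePoint.some x) = (x, 1) := fun _ => rfl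
    simp only [Function.comp_apply, bracket, hc]
    rcases eq_or_lt_of_le hp with h | h
    · rw [← h, Nat.sub_self]
      simp
    · rw [coeff_eq_zero_of_natDegree_lt h]
      have : d - p.natDegree ≠ 0 := by omega
      simp [this]
  | coe z =>
    rw [coords_coe, homEval_one hp]
    have hc : ∀ x : Ω, coords (OnePoint.some x) = (x, 1) := fun _ => rfl
    simp only [Function.comp_apply, bracket, coords_infty, hc]
    rw [hs.eval_eq_prod_roots]
    simp only [mul_one, one_mul, mul_zero, zero_sub]
    have h1 : ((-1 : Ω) ^ (d - p.natDegree)) * (-1) ^ (d - p.natDegree) = 1 := by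
      rw [← mul_pow]; simp
    linear_combination (- p.leadingCoeff * (Multiset.map (fun x => z - x) p.roots).prod) * h1

end BinaryForms

/-! ### Fibres of rational maps. -/

section RatMap

variable {K : Type*} [Field K] {Ω : Type*} [Field Ω] [DecidableEq Ω] [Algebra K Ω] (φ : RatFunc K)

/-- The numerator of a rational function, over an extension field. -/
def numΩ (Ω : Type*) [Field Ω] [Algebra K Ω] (φ : RatFunc K) : Polynomial Ω :=
  φ.num.map (algebraMap K Ω)

/-- The denominator of a rational function, over an extension field. -/
def denΩ (Ω : Type*) [Field Ω] [Algebra K Ω] (φ : RatFunc K) : Polynomial Ω :=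
  φ.denom.map (algebraMap K Ω)

lemma isCoprime_numΩ_denΩ : IsCoprime (numΩ Ω φ) (denΩ Ω φ) :=
  (RatFunc.isCoprime_num_denom φ).map (mapRingHom (algebraMap K Ω))

lemma natDegree_numΩ_le : (numΩ Ω φ).natDegree ≤ ratDegree φ := by
  rw [numΩ, natDegree_map]; exact le_max_left _ _

lemma natDegree_denΩ_le : (denΩ Ω φ).natDegree ≤ ratDegree φ := by
  rw [denΩ, natDegree_map]; exact le_max_right _ _

lemma max_natDegree : max (numΩ Ω φ).natDegree (denΩ Ω φ).natDegree = ratDegree φ := by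
  rw [denΩ, numΩ, natDegree_map, natDegree_map]; rfl

lemma denΩ_ne_zero : denΩ Ω φ ≠ 0 :=
  (Polynomial.map_ne_zero_iff (algebraMap K Ω).injective).mpr (RatFunc.denom_ne_zero φ)

/-- `ratMap` in homogeneous coordinates. -/
lemma ratMap_coords (z : OnePoint Ω) : ∃ c : Ω, c ≠ 0 ∧
    (homEval (ratDegree φ) (numΩ Ω φ) (coords z), homEval (ratDegree φ) (denΩ Ω φ) (coords z)) =
      (c * (coords (ratMap Ω φ z)).1, c * (coords (ratMap Ω φ z)).2) := by
  cases z using OnePoint.rec with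
  | infty =>
    rw [coords_infty, homEval_infty, homEval_infty]
    have h : ratMap Ω φ ∞ = if algebraMap K Ω (φ.denom.coeff (ratDegree φ)) = 0 then ∞
      else ((algebraMap K Ω (φ.num.coeff (ratDegree φ)) /
        algebraMap K Ω (φ.denom.coeff (ratDegree φ)) : Ω) : OnePoint Ω) := rfl
    rw [← coeff_map, ← coeff_map] at h
    change _ = if (denΩ Ω φ).coeff _ = 0 then _ else (((numΩ Ω φ).coeff _ / (denΩ Ω φ).coeff _ : Ω) : OnePoint Ω) at h
    split_ifs at h with h0
    · refine ⟨(numΩ Ω φ).coeff (ratDegree φ), fun hn => ?_, by simp [h, coords_infty, h0]⟩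
      rcases max_choice (numΩ Ω φ).natDegree (denΩ Ω φ).natDegree with hm | hm
      · rw [max_natDegree] at hm
        rw [hm, ← leadingCoeff, leadingCoeff_eq_zero] at hn
        have hu : IsUnit (denΩ Ω φ) := 
          isCoprime_zero_left.mp (hn ▸ isCoprime_numΩ_denΩ (Ω := Ω) φ)
        have hd := natDegree_eq_zero_of_isUnit hu
        rw [hm, hn, natDegree_zero, ← hd, ← leadingCoeff, leadingCoeff_eq_zero] at h0
        exact denΩ_ne_zero φ h0
      · rw [max_natDegree] at hm
        rw [hm, ← leadingCoeff, leadingCoeff_eq_zero] at h0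
        exact denΩ_ne_zero φ h0
    · exact ⟨(denΩ Ω φ).coeff (ratDegree φ), h0, by rw [h, coords_coe]; simp; field_simp⟩
  | coe z =>
    rw [coords_coe, homEval_one (natDegree_numΩ_le φ), homEval_one (natDegree_denΩ_le φ)]
    have h : ratMap Ω φ z = if Polynomial.aeval z φ.denom = 0 then ∞
      else ((Polynomial.aeval z φ.num / Polynomial.aeval z φ.denom : Ω) : OnePoint Ω) := rfl
    rw [← eval_map_algebraMap, ← eval_map_algebraMap] at h
    change _ = if (denΩ Ω φ).eval z = 0 then _ else (((numΩ Ω φ).eval z / (denΩ Ω φ).eval z : Ω) : OnePoint Ω) at h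
    split_ifs at h with h0
    · refine ⟨(numΩ Ω φ).eval z, fun hn => ?_, by simp [h, coords_infty, h0]⟩
      obtain ⟨a, b, hab⟩ := isCoprime_numΩ_denΩ (Ω := Ω) φ
      have := congr(($hab).eval z)
      simp [hn, h0] at this
    · exact ⟨(denΩ Ω φ).eval z, h0, by rw [h, coords_coe]; simp; field_simp⟩

variable {φ}

lemma sub_smul_ne_zero (hd : 0 < ratDegree φ) (c : OnePoint Ω) :
    C (coords c).2 * numΩ Ω φ - C (coords c).1 * denΩ Ω φ ≠ 0 := by
  cases c using OnePoint.rec with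
  | infty => simp [coords_infty, denΩ_ne_zero]
  | coe c =>
    simp only [coords_coe, map_one, one_mul]
    intro h
    have hc := isCoprime_numΩ_denΩ (Ω := Ω) φ
    rw [sub_eq_zero] at h
    rw [h] at hc
    have hu : IsUnit (denΩ Ω φ) := isCoprime_self.mp (IsCoprime.of_mul_left_right hc)
    have hd0 := natDegree_eq_zero_of_isUnit hu
    have := natDegree_C_mul_le c (denΩ Ω φ)
    rw [← h] at this
    rw [← max_natDegree (Ω := Ω)] at hd
    omega

lemma ratMap_eq_iff {x c : OnePoint Ω} : ratMap Ω φ x = c ↔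
    bracket (homEval (ratDegree φ) (numΩ Ω φ) (coords x),
      homEval (ratDegree φ) (denΩ Ω φ) (coords x)) (coords c) = 0 := by
  obtain ⟨a, ha, hax⟩ := ratMap_coords (Ω := Ω) φ x
  have h2 : bracket (a * (coords (ratMap Ω φ x)).1, a * (coords (ratMap Ω φ x)).2)
      (coords c) = a * bracket (coords (ratMap Ω φ x)) (coords c) := by
    simp only [bracket]; ring
  rw [hax, h2, mul_eq_zero, or_iff_right ha, bracket_coords_eq_zero]

/-- The fibre of a rational map, in homogeneous coordinates. -/
lemma exists_fibre [IsAlgClosed Ω] (hd : 0 < ratDegree φ) (c : OnePoint Ω) :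
    ∃ (κ : Ω) (X : Multiset (OnePoint Ω)), κ ≠ 0 ∧ X.card = ratDegree φ ∧
      (∀ z, bracket (homEval (ratDegree φ) (numΩ Ω φ) (coords z),
        homEval (ratDegree φ) (denΩ Ω φ) (coords z)) (coords c) =
          κ * (X.map fun x => bracket (coords z) (coords x)).prod) ∧
      ∀ x, x ∈ X ↔ ratMap Ω φ x = c := by
  obtain ⟨κ, X, hκ, hX, h⟩ := exists_factorization (d := ratDegree φ) (sub_smul_ne_zero hd c) (by
    refine (natDegree_sub_le _ _).trans (max_le ?_ ?_)
    · exact (natDegree_C_mul_le _ _).trans (natDegree_numΩ_le φ)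
    · exact (natDegree_C_mul_le _ _).trans (natDegree_denΩ_le φ))
  refine ⟨κ, X, hκ, hX, fun z => ?_, fun x => ?_⟩
  · rw [← h, homEval_sub_smul]
  · have h1 := h x
    rw [homEval_sub_smul] at h1
    rw [ratMap_eq_iff]
    constructor
    · intro hx
      have : (X.map fun y => bracket (coords x) (coords y)).prod = 0 :=
        Multiset.prod_eq_zero (Multiset.mem_map.mpr ⟨x, hx, bracket_coords_eq_zero.mpr rfl⟩)
      rwa [this, mul_zero] at h1
    · intro hx
      rw [hx, eq_comm, mul_eq_zero, or_iff_right hκ, Multiset.prod_eq_zero_iff,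
        Multiset.mem_map] at h1
      obtain ⟨y, hy, hxy⟩ := h1
      rwa [bracket_coords_eq_zero.mp hxy]

lemma ratMap_surjective [IsAlgClosed Ω] (hd : 0 < ratDegree φ) :
    Function.Surjective (ratMap Ω φ) := by
  intro c
  obtain ⟨κ, X, -, hX, -, h⟩ := exists_fibre (Ω := Ω) hd c
  obtain ⟨x, hx⟩ := Multiset.card_pos_iff_exists_mem.mp (hX ▸ hd)
  exact ⟨x, (h x).mp hx⟩

/-- If the Wronskian vanished, coprimality would make the denominator divide its own derivative, so
both derivatives would vanish. But whichever of the two has degree `ratDegree φ` has a derivative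
with nonzero leading term. -/
lemma wronskian_numΩ_denΩ_ne_zero (hd : ((ratDegree φ : ℕ) : Ω) ≠ 0) :
    derivative (numΩ Ω φ) * denΩ Ω φ - numΩ Ω φ * derivative (denΩ Ω φ) ≠ 0 := by
  intro h
  have hne : ∀ p : Polynomial Ω, p.natDegree = ratDegree φ → derivative p ≠ 0 := by
    intro p hp h0
    have hd0 : ratDegree φ ≠ 0 := fun h => hd (by simp [h])
    have h1 := congr(($h0).coeff (ratDegree φ - 1))
    rw [coeff_derivative, Nat.sub_add_cancel (Nat.pos_of_ne_zero hd0), coeff_zero, ← Nat.cast_succ,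
      Nat.succ_eq_add_one, Nat.sub_add_cancel (Nat.pos_of_ne_zero hd0), ← hp, ← leadingCoeff, hp,
      mul_eq_zero, or_iff_left hd, leadingCoeff_eq_zero] at h1
    rw [h1, natDegree_zero] at hp
    exact hd0 hp.symm
  have hQ : derivative (denΩ Ω φ) = 0 := by
    have h1 : denΩ Ω φ ∣ derivative (denΩ Ω φ) :=
      (isCoprime_numΩ_denΩ (Ω := Ω) φ).symm.dvd_of_dvd_mul_left
        ⟨derivative (numΩ Ω φ), by linear_combination -h⟩
    by_contra h0
    have h2 : (derivative (denΩ Ω φ)).natDegree < (denΩ Ω φ).natDegree := by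
      refine natDegree_derivative_lt fun h3 => h0 ?_
      rw [eq_C_of_natDegree_eq_zero h3, derivative_C]
    exact absurd (natDegree_le_of_dvd h1 h0) (by omega)
  have hP : derivative (numΩ Ω φ) = 0 := by
    rw [hQ, mul_zero, sub_zero, mul_eq_zero] at h
    exact h.resolve_right (denΩ_ne_zero φ)
  rcases max_choice (numΩ Ω φ).natDegree (denΩ Ω φ).natDegree with hm | hm
  · exact hne _ (hm.symm.trans (max_natDegree φ)) hP
  · exact hne _ (hm.symm.trans (max_natDegree φ)) hQ

lemma ratMap_coe_eq_coe_iff {x c : Ω} : ratMap Ω φ x = c ↔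
    (numΩ Ω φ).eval x = c * (denΩ Ω φ).eval x := by
  rw [ratMap_eq_iff, coords_coe, coords_coe, homEval_one (natDegree_numΩ_le φ),
    homEval_one (natDegree_denΩ_le φ)]
  simp only [bracket, mul_one, sub_eq_zero, mul_comm c]

lemma ratMap_infty_eq_coe_iff {c : Ω} : ratMap Ω φ ∞ = c ↔
    (numΩ Ω φ).coeff (ratDegree φ) = c * (denΩ Ω φ).coeff (ratDegree φ) := by
  rw [ratMap_eq_iff, coords_coe, coords_infty, homEval_infty, homEval_infty]
  simp only [bracket, mul_one, sub_eq_zero, mul_comm c]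

/-- In degree prime to the characteristic almost all fibres have full size. -/
lemma finite_ncard_fibre_ne [IsAlgClosed Ω] (hd : ((ratDegree φ : ℕ) : Ω) ≠ 0) :
    {c : OnePoint Ω | {x | ratMap Ω φ x = c}.ncard ≠ ratDegree φ}.Finite := by
  set W := derivative (numΩ Ω φ) * denΩ Ω φ - numΩ Ω φ * derivative (denΩ Ω φ) with hW
  have hW0 : W ≠ 0 := wronskian_numΩ_denΩ_ne_zero hd
  -- Excluded are `∞`, the image of `∞` and the critical values. For the remaining `c` the
  -- polynomial `num - c * den` has full degree and is separable.
  refine Set.Finite.subset (s := insert ∞ (insert (ratMap Ω φ ∞)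
    ((fun x : Ω => ratMap Ω φ x) '' (W.roots.toFinset : Set Ω))))
    (((W.roots.toFinset.finite_toSet.image _).insert _).insert _) fun c hc => ?_
  by_contra hc'
  simp only [Set.mem_insert_iff, Set.mem_image, not_or, not_exists, not_and] at hc'
  obtain ⟨h1, h2, h3⟩ := hc'
  apply hc
  cases c using OnePoint.rec with
  | infty => exact absurd rfl h1
  | coe c =>
  set R := numΩ Ω φ - C c * denΩ Ω φ with hR
  have hcoeff : R.coeff (ratDegree φ) ≠ 0 := fun h0 => h2 (ratMap_infty_eq_coe_iff.mpr (by
    rw [hR, coeff_sub, coeff_C_mul, sub_eq_zero] at h0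
    exact h0)).symm
  have hdeg : R.natDegree = ratDegree φ := le_antisymm ((natDegree_sub_le _ _).trans
    (max_le (natDegree_numΩ_le φ) ((natDegree_C_mul_le _ _).trans (natDegree_denΩ_le φ))))
    (le_natDegree_of_ne_zero hcoeff)
  have hR0 : R ≠ 0 := fun h => hcoeff (by rw [h, coeff_zero])
  have hroot : ∀ x, R.eval x = 0 ↔ ratMap Ω φ x = c := fun x => by
    rw [ratMap_coe_eq_coe_iff, hR, eval_sub, eval_mul, eval_C, sub_eq_zero]
  have hsep : R.Separable := by
    rw [Polynomial.Separable, Polynomial.isCoprime_iff_aeval_ne_zero_of_isAlgClosed Ω Ω]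
    intro x
    by_contra! hx
    obtain ⟨hx1, hx2⟩ := hx
    rw [coe_aeval_eq_eval] at hx1 hx2
    refine h3 x ?_ ((hroot x).mp hx1)
    simp only [Finset.mem_coe, Multiset.mem_toFinset, mem_roots hW0, IsRoot]
    simp only [hR, derivative_sub, derivative_C_mul, eval_sub, eval_mul, eval_C] at hx1 hx2
    simp only [hW, eval_sub, eval_mul]
    linear_combination (eval x (denΩ Ω φ)) * hx2 - (eval x (derivative (denΩ Ω φ))) * hx1
  have hset : {x : OnePoint Ω | ratMap Ω φ x = c} =
      (OnePoint.some : Ω → OnePoint Ω) '' (R.roots.toFinset : Set Ω) := by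
    ext x
    cases x using OnePoint.rec with
    | infty =>
      simp only [Set.mem_ofPred_eq, Set.mem_image]
      exact ⟨fun h => absurd h.symm h2, fun ⟨x, _, hx⟩ => absurd hx (OnePoint.coe_ne_infty x)⟩
    | coe x =>
      simp only [Set.mem_ofPred_eq, Set.mem_image, Finset.mem_coe, Multiset.mem_toFinset,
        mem_roots hR0, IsRoot]
      exact ⟨fun h => ⟨x, (hroot x).mpr h, rfl⟩, fun ⟨y, hy, hyx⟩ =>
        (OnePoint.coe_injective hyx) ▸ (hroot y).mp hy⟩
  rw [hset, Set.ncard_image_of_injective _ OnePoint.coe_injective, Set.ncard_coe_finset,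
    Multiset.toFinset_card_of_nodup (nodup_roots hsep),
    ← (IsAlgClosed.splits R).natDegree_eq_card_roots, hdeg]

end RatMap

end IteratedExt

/-! ### Lattès maps: torsion and signs. -/

namespace IteratedExt

open Polynomial WeierstrassCurve WeierstrassCurve.Affine

/-- An endomorphism that acts by signs on a coset of `G` acts by a single sign on `2G`. -/
lemma exists_sign_of_coset {A : Type*} [AddCommGroup A] (s : A →+ A) (P₀ : A) (G : AddSubgroup A)
    (h : ∀ T ∈ G, s (P₀ + T) = P₀ + T ∨ s (P₀ + T) = -(P₀ + T)) :
    ∃ ε : ℤˣ, ∀ T ∈ G, s (2 • T) = (ε : ℤ) • (2 • T) := by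
  -- After replacing `s` by `-s` if necessary, `s` fixes `P₀`, and then each `T` in `G` satisfies `s
  -- T = T` or `s T = -T - 2 • P₀`.
  have key : ∀ s : A →+ A, (∀ T ∈ G, s (P₀ + T) = P₀ + T ∨ s (P₀ + T) = -(P₀ + T)) →
      s P₀ = P₀ → ∃ ε : ℤˣ, ∀ T ∈ G, s (2 • T) = (ε : ℤ) • (2 • T) := by
    clear h s
    intro s h h0
    have h' : ∀ T ∈ G, s T = T ∨ s T = -T - 2 • P₀ := fun T hT => by
      rcases h T hT with h1 | h1 <;> rw [map_add, h0] at h1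
      · exact Or.inl (add_left_cancel h1)
      · refine Or.inr ?_
        rw [← sub_eq_zero] at h1 ⊢
        rw [← h1]; abel
    by_cases hall : ∀ T ∈ G, s T = T
    · exact ⟨1, fun T hT => by rw [map_nsmul, hall T hT]; simp⟩
    push Not at hall
    obtain ⟨T₁, hT₁, hne⟩ := hall
    have h₁ := (h' T₁ hT₁).resolve_left hne
    -- Once some `T₁` is not fixed, testing `T + T₁` shows that every fixed `T` is killed by two.
    -- Passing to `2G` removes this ambiguity, and the sign there is `-1`.
    have hfix : ∀ T ∈ G, s T = T → 2 • T = 0 := by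
      intro T hT hs
      rcases h' (T + T₁) (G.add_mem hT hT₁) with h2 | h2 <;> rw [map_add, hs] at h2
      · exact absurd (add_left_cancel h2) hne
      · rw [h₁, ← sub_eq_zero] at h2
        rw [← h2]; abel
    refine ⟨-1, fun T hT => ?_⟩
    rw [Units.val_neg, Units.val_one, neg_one_zsmul]
    rcases h' T hT with h2 | h2
    · rw [map_nsmul, h2, hfix T hT h2, neg_zero]
    · rcases h' (2 • T) (G.nsmul_mem hT 2) with h3 | h3
      · rw [h3, eq_neg_iff_add_eq_zero, ← two_nsmul]
        exact hfix _ (G.nsmul_mem hT 2) h3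
      · have h4 : 2 • P₀ = 0 := by
          have h5 := h3
          rw [map_nsmul, h2, ← sub_eq_zero] at h5
          rw [← neg_eq_zero, ← h5]; abel
        rw [h3, h4, sub_zero]
  rcases h 0 G.zero_mem with h0 | h0 <;> rw [add_zero] at h0
  · exact key s h h0
  · obtain ⟨ε, hε⟩ := key (-s) (fun T hT => by
      rcases h T hT with h1 | h1
      · exact Or.inr (by rw [AddMonoidHom.neg_apply, h1])
      · exact Or.inl (by rw [AddMonoidHom.neg_apply, h1, neg_neg]))
      (by rw [AddMonoidHom.neg_apply, h0, neg_neg])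
    refine ⟨-ε, fun T hT => ?_⟩
    have := hε T hT
    rw [AddMonoidHom.neg_apply, neg_eq_iff_eq_neg] at this
    rw [this, Units.val_neg, neg_zsmul]

/-- Points with `P = -P` have `x`-coordinate a root of `4x³ + b₂x² + 2b₄x + b₆`. This polynomial is
nonzero in every characteristic, since the vanishing of `4`, `b₂` and `b₆` would make the
discriminant zero. -/
lemma finite_eq_neg {Ω : Type*} [Field Ω] [DecidableEq Ω] (W : WeierstrassCurve Ω)
    [W.IsElliptic] : {P : W.toAffine.Point | P = -P}.Finite := by
  set p : Polynomial Ω := C 4 * X ^ 3 + C W.b₂ * X ^ 2 + C (2 * W.b₄) * X + C W.b₆ with hp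
  have hp0 : p ≠ 0 := by
    intro h
    have c3 : (4 : Ω) = 0 := by simpa [hp, coeff_X, coeff_C] using congr(($h).coeff 3)
    have c2 : W.b₂ = 0 := by simpa [hp, coeff_X, coeff_C] using congr(($h).coeff 2)
    have c0 : W.b₆ = 0 := by simpa [hp, coeff_X, coeff_C] using congr(($h).coeff 0)
    refine (WeierstrassCurve.isUnit_Δ W).ne_zero ?_
    rw [WeierstrassCurve.Δ, c2, c0]
    linear_combination (-2 * W.b₄ ^ 3) * c3
  let ξ : W.toAffine.Point → Option Ω := fun P => match P with
    | .zero => none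
    | .some x _ _ => some x
  refine Set.Finite.of_finite_image (f := ξ) ?_ ?_
  · refine Set.Finite.subset (s := insert none (some '' (p.roots.toFinset : Set Ω)))
      ((p.roots.toFinset.finite_toSet.image _).insert _) ?_
    rintro _ ⟨P, hP, rfl⟩
    rcases P with _ | ⟨x, y, h⟩
    · exact Or.inl rfl
    · refine Or.inr ⟨x, ?_, rfl⟩
      simp only [Finset.mem_coe, Multiset.mem_toFinset, mem_roots hp0, IsRoot]
      have h1 : y = W.toAffine.negY x y := by
        have : Point.some x y h = -Point.some x y h := hP
        rw [Point.neg_some] at this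
        injection this
      have h2 := (W.toAffine.equation_iff x y).mp h.1
      rw [WeierstrassCurve.Affine.negY] at h1
      simp only [hp, eval_add, eval_mul, eval_C, eval_pow, eval_X, WeierstrassCurve.b₂,
        WeierstrassCurve.b₄, WeierstrassCurve.b₆]
      linear_combination (-4) * h2 + (2 * y + W.a₁ * x + W.a₃) * h1
  · rintro P hP P' hP' h
    rcases P with _ | ⟨x, y, hxy⟩ <;> rcases P' with _ | ⟨x', y', hxy'⟩
    · rfl
    · exact absurd h (by simp [ξ])
    · exact absurd h (by simp [ξ])
    · obtain rfl : x = x' := by simpa [ξ] using h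
      rcases Y_eq_of_X_eq hxy.1 hxy'.1 rfl with h1 | h1
      · subst h1; rfl
      · rw [show (Point.some x y' hxy' : W.toAffine.Point) = -Point.some x y' hxy' from hP',
          Point.neg_some]
        subst h1
        rfl

section Lattes

variable {K : Type*} [Field K] {Ω : Type*} [Field Ω] [DecidableEq Ω] [Algebra K Ω]
  [IsAlgClosed Ω] {E : WeierstrassCurve K} [E.IsElliptic]

/-- The properties of a double covering of the line by the `x`-coordinate that enter in the study of
Lattès maps. -/
structure IsKummerMap (π : (E.baseChange Ω).toAffine.Point → OnePoint Ω) : Prop where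
  eq_iff : ∀ P P', π P = π P' ↔ P = P' ∨ P = -P'
  surjective : Function.Surjective π
  map : ∀ (σ : Ω ≃ₐ[K] Ω) P, π (Point.map (W' := E) (σ : Ω →ₐ[K] Ω) P) = OnePoint.map σ (π P)

variable {π : (E.baseChange Ω).toAffine.Point → OnePoint Ω} (hπ : IsKummerMap π)
  {φ : RatFunc K} {e : ℕ} {Q : (E.baseChange Ω).toAffine.Point}
  (hφ : ∀ P, ratMap Ω φ (π P) = π (e • P + Q)) (hd : 0 < ratDegree φ)

include hπ hφ hd

/-- Since `π` is even, `e • P + Q` equals `-(e • P) + Q` or its negative `e • P - Q`. If `Q ≠ -Q`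
only the first is possible, so every `e • P` is `2`-torsion and `φ` has finite image. -/
lemma neg_eq_of_semiconj : Q = -Q := by
  by_contra hQ
  have h1 : ∀ P : (E.baseChange Ω).toAffine.Point, e • P = -(e • P) := by
    intro P
    have h2 : π (e • P + Q) = π (e • (-P) + Q) := by
      rw [← hφ, ← hφ, (hπ.eq_iff P (-P)).mpr (Or.inr (neg_neg P).symm)]
    rcases (hπ.eq_iff _ _).mp h2 with h3 | h3
    · rw [smul_neg] at h3
      exact add_right_cancel h3
    · rw [smul_neg, neg_add, neg_neg] at h3
      exact absurd (add_left_cancel h3) hQ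
  have hfin : (Set.univ : Set (OnePoint Ω)).Finite := by
    refine ((finite_eq_neg (E.baseChange Ω)).image fun P => π (P + Q)).subset fun c _ => ?_
    obtain ⟨x, rfl⟩ := ratMap_surjective (Ω := Ω) hd c
    obtain ⟨P, rfl⟩ := hπ.surjective x
    exact ⟨e • P, h1 P, (hφ P).symm⟩
  have : Infinite Ω := IsAlgClosed.instInfinite
  exact Set.infinite_univ (hfin)

lemma surjective_smul_add : Function.Surjective fun P => e • P + Q := by
  intro R
  obtain ⟨x, hx⟩ := ratMap_surjective (Ω := Ω) hd (π R)
  obtain ⟨P, rfl⟩ := hπ.surjective x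
  rw [hφ, hπ.eq_iff] at hx
  rcases hx with h | h
  · exact ⟨P, h⟩
  · refine ⟨-P, ?_⟩
    have hQ := neg_eq_of_semiconj hπ hφ hd
    simp only
    rw [smul_neg, hQ, ← neg_add, h, neg_neg]

lemma surjective_smul : Function.Surjective fun P : (E.baseChange Ω).toAffine.Point => e • P := by
  intro R
  obtain ⟨P, hP⟩ := surjective_smul_add hπ hφ hd (R + Q)
  exact ⟨P, add_right_cancel hP⟩

/-- Choose a fibre of full size over a point `π C` with `C ≠ -C`. The kernel of `[e]` acts on the
solutions of `e • P + Q = C`, and these map bijectively to the fibre because the sign is pinned down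
by `C ≠ -C`. -/
lemma card_ker_smul (hd' : ((ratDegree φ : ℕ) : Ω) ≠ 0) :
    {P : (E.baseChange Ω).toAffine.Point | e • P = 0}.ncard = ratDegree φ := by
  have : Infinite Ω := IsAlgClosed.instInfinite
  have hQ := neg_eq_of_semiconj hπ hφ hd
  obtain ⟨c, hc⟩ := ((finite_ncard_fibre_ne (φ := φ) hd').union
    ((finite_eq_neg (E.baseChange Ω)).image π)).exists_notMem
  simp only [Set.mem_union, Set.mem_ofPred_eq, not_or, not_not] at hc
  obtain ⟨hc, hc2⟩ := hc
  obtain ⟨C, rfl⟩ := hπ.surjective c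
  have hC : C ≠ -C := fun h => hc2 ⟨C, h, rfl⟩
  obtain ⟨P₁, hP₁⟩ := surjective_smul_add hπ hφ hd C
  have hP₁ : e • P₁ + Q = C := hP₁
  rw [← hc]
  refine Set.ncard_congr (fun P _ => π (P₁ + P)) ?_ ?_ ?_
  · intro P hP
    rw [Set.mem_ofPred_eq] at hP ⊢
    rw [hφ, smul_add, hP, add_zero, hP₁]
  · intro P P' hP hP' h
    rw [Set.mem_ofPred_eq] at hP hP'
    rcases (hπ.eq_iff _ _).mp h with h | h
    · exact add_left_cancel h
    · refine absurd ?_ hC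
      have h2 := congr(e • $h + Q)
      rw [smul_neg, smul_add, smul_add, hP, hP', add_zero, hP₁] at h2
      refine h2.trans ?_
      rw [hQ, ← neg_add, hP₁]
  · intro x hx
    rw [Set.mem_ofPred_eq] at hx
    obtain ⟨P, rfl⟩ := hπ.surjective x
    rw [hφ, hπ.eq_iff] at hx
    have : ∃ P', π P' = π P ∧ e • P' + Q = C := by
      rcases hx with h | h
      · exact ⟨P, rfl, h⟩
      · refine ⟨-P, (hπ.eq_iff _ _).mpr (Or.inr rfl), ?_⟩
        rw [smul_neg, hQ, ← neg_add, h, neg_neg]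
    obtain ⟨P', h1, h2⟩ := this
    refine ⟨P' - P₁, ?_, ?_⟩
    · rw [Set.mem_ofPred_eq, smul_sub, sub_eq_zero]
      exact add_right_cancel (h2.trans hP₁.symm)
    · simp only [add_sub_cancel]
      exact h1

/-- Cauchy's theorem in the kernel of `[e]`; the order of the point found divides `e`. -/
lemma exists_addOrderOf_eq_prime (hd' : ((ratDegree φ : ℕ) : Ω) ≠ 0) {l : ℕ} (hl : l.Prime)
    (hld : l ∣ ratDegree φ) :
    l ∣ e ∧ ∃ S : (E.baseChange Ω).toAffine.Point, addOrderOf S = l := by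
  have hcard := card_ker_smul hπ hφ hd hd'
  have : Fact l.Prime := ⟨hl⟩
  let G : AddSubgroup (E.baseChange Ω).toAffine.Point := (nsmulAddMonoidHom e).ker
  have hG : Nat.card G = ratDegree φ := hcard
  have : Finite G := Nat.finite_of_card_ne_zero (by omega)
  obtain ⟨S, hS⟩ := exists_prime_addOrderOf_dvd_card' l (hG.symm ▸ hld)
  refine ⟨?_, S, by rw [AddSubgroup.addOrderOf_coe, hS]⟩
  rw [← hS, ← AddSubgroup.addOrderOf_coe]
  exact addOrderOf_dvd_of_nsmul_eq_zero S.2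

lemma surjective_prime_smul {l : ℕ} (hle : l ∣ e) (n : ℕ) :
    Function.Surjective fun P : (E.baseChange Ω).toAffine.Point => l ^ n • P := by
  induction n with
  | zero => exact fun R => ⟨R, by simp⟩
  | succ n ih =>
    intro R
    obtain ⟨R', hR'⟩ := ih R
    obtain ⟨P, hP⟩ := surjective_smul hπ hφ hd R'
    obtain ⟨f, rfl⟩ := hle
    refine ⟨f • P, ?_⟩
    simp only at hP hR' ⊢
    rw [← hR', ← hP, ← mul_smul, ← mul_smul, pow_succ, mul_assoc]

lemma exists_addOrderOf_eq_prime_pow (hd' : ((ratDegree φ : ℕ) : Ω) ≠ 0) {l : ℕ} (hl : l.Prime)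
    (hld : l ∣ ratDegree φ) (n : ℕ) :
    ∃ S : (E.baseChange Ω).toAffine.Point, addOrderOf S = l ^ n := by
  cases n with
  | zero => exact ⟨0, by simp⟩
  | succ n =>
    have : Fact l.Prime := ⟨hl⟩
    obtain ⟨hle, S₁, hS₁⟩ := exists_addOrderOf_eq_prime hπ hφ hd hd' hl hld
    obtain ⟨S, hS⟩ := surjective_prime_smul hπ hφ hd hle n S₁
    have hS : l ^ n • S = S₁ := hS
    refine ⟨S, addOrderOf_eq_prime_pow ?_ ?_⟩
    · rw [hS]
      rintro rfl
      rw [addOrderOf_zero] at hS₁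
      exact hl.one_lt.ne hS₁
    · rw [pow_succ', mul_smul, hS, ← hS₁, addOrderOf_nsmul_eq_zero]

/-- An automorphism fixing a backward orbit acts on the `l`-power torsion by a sign. -/
lemma exists_sign_of_fixes {b : OnePoint K} (σ : Ω ≃ₐ[K] Ω)
    (hσ : ∀ z ∈ iteratedField Ω φ b, σ z = z) {l : ℕ} (hl : l.Prime) (hle : l ∣ e) (j : ℕ) :
    ∃ ε : ℤˣ, ∀ T : (E.baseChange Ω).toAffine.Point, l ^ j • T = 0 →
      Point.map (W' := E) (σ : Ω →ₐ[K] Ω) T = (ε : ℤ) • T := by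
  obtain ⟨B, hB⟩ := hπ.surjective (OnePoint.map (algebraMap K Ω) b)
  set k := j + 1 with hk
  have hiter : ∀ n P, (ratMap Ω φ)^[n] (π P) = π ((fun P => e • P + Q)^[n] P) := fun n P =>
    (Function.Semiconj.iterate_right (f := π) (ga := fun P => e • P + Q) (gb := ratMap Ω φ)
      (fun P => (hφ P).symm) n P).symm
  have hadd : ∀ n (P T : (E.baseChange Ω).toAffine.Point), e ^ n • T = 0 →
      (fun P => e • P + Q)^[n] (P + T) = (fun P => e • P + Q)^[n] P := by
    intro n
    induction n with
    | zero => intro P T hT; simpa using hT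
    | succ n ih =>
      intro P T hT
      rw [Function.iterate_succ_apply, Function.iterate_succ_apply, ← ih (e • P + Q) (e • T)]
      · congr 1
        rw [smul_add]; abel
      · rw [← mul_smul, ← pow_succ, hT]
  obtain ⟨P₀, hP₀⟩ := (surjective_smul_add hπ hφ hd).iterate k B
  have hmem : ∀ T, e ^ k • T = 0 → π (P₀ + T) ∈ backwardOrbit Ω φ b := fun T hT =>
    ⟨k, by rw [hiter, hadd k P₀ T hT, hP₀, hB]⟩
  let G : AddSubgroup (E.baseChange Ω).toAffine.Point := (nsmulAddMonoidHom (e ^ k)).ker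
  obtain ⟨ε, hε⟩ := exists_sign_of_coset (Point.map (W' := E) (σ : Ω →ₐ[K] Ω)) P₀ G
    (fun T hT => by
      rw [← hπ.eq_iff, hπ.map]
      have h1 := hmem T hT
      generalize π (P₀ + T) = z at h1
      cases z using OnePoint.rec with
      | infty => rfl
      | coe z =>
        rw [OnePoint.map_some]
        exact congrArg _ (hσ z (IntermediateField.subset_adjoin _ _ h1)))
  refine ⟨ε, fun T hT => ?_⟩
  have hG : ∀ T : (E.baseChange Ω).toAffine.Point, l ^ k • T = 0 → T ∈ G := fun T hT => by
    obtain ⟨f, rfl⟩ := hle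
    change (l * f) ^ k • T = 0
    rw [mul_pow, mul_comm, mul_smul, hT, smul_zero]
  -- The sign is known only on doubles. For `l = 2` halving costs one more level of torsion, hence
  -- `k = j + 1`; for odd `l`, halving is multiplication by `(l ^ j + 1) / 2`.
  have : ∃ T₂, l ^ k • T₂ = 0 ∧ T = 2 • T₂ := by
    rcases hl.eq_two_or_odd' with rfl | hodd
    · obtain ⟨T₂, hT₂⟩ := surjective_prime_smul hπ hφ hd hle 1 T
      have hT₂ : 2 ^ 1 • T₂ = T := hT₂
      refine ⟨T₂, ?_, by rw [← hT₂, pow_one]⟩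
      rw [hk, pow_succ, mul_smul, ← pow_one 2, ← pow_mul, one_mul, hT₂, hT]
    · obtain ⟨r, hr⟩ := hodd.pow (n := j)
      refine ⟨(r + 1) • T, ?_, ?_⟩
      · rw [hk, pow_succ', mul_smul, smul_comm (l ^ j), hT, smul_zero, smul_zero]
      · rw [← mul_smul, show 2 * (r + 1) = l ^ j + 1 by omega, add_smul, hT, zero_add, one_smul]
  obtain ⟨T₂, h1, rfl⟩ := this
  exact hε T₂ (hG T₂ h1)

/-- An automorphism fixing a backward orbit of a Lattès map fixes the roots of unity whose order
has only prime factors dividing the degree. -/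
lemma fixes_rootsOfUnity (hd' : ((ratDegree φ : ℕ) : Ω) ≠ 0) {b : OnePoint K} (σ : Ω ≃ₐ[K] Ω)
    (hσ : ∀ z ∈ iteratedField Ω φ b, σ z = z) (N : ℕ) (hN : N ≠ 0)
    (hNd : ∀ l, l.Prime → l ∣ N → l ∣ ratDegree φ) (ζ : Ω) (hζ : ζ ^ N = 1) : σ ζ = ζ := by
  induction N using Nat.recOnPosPrimePosCoprime generalizing ζ with
  | zero => exact absurd rfl hN
  | one => rw [pow_one] at hζ; rw [hζ, map_one]
  | prime_pow l n hl hn =>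
    have hld := hNd l hl (dvd_pow_self l hn.ne')
    obtain ⟨S, hS⟩ := exists_addOrderOf_eq_prime_pow hπ hφ hd hd' hl hld n
    -- The sign is needed on the torsion of order `N ^ 2` with `N = l ^ n`, hence the exponent `n *
    -- 2`.
    obtain ⟨ε, hε⟩ := exists_sign_of_fixes hπ hφ hd σ hσ hl
      (exists_addOrderOf_eq_prime hπ hφ hd hd' hl hld).1 (n * 2)
    exact map_eq_of_torsion (pow_pos hl.pos n) hS hζ σ ε fun T hT => hε T (by rw [pow_mul, hT])
  | coprime a b ha hb hab iha ihb =>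
    have hζ0 : ζ ≠ 0 := by
      rintro rfl
      rw [zero_pow hN] at hζ
      exact zero_ne_one hζ
    have h1 : σ (ζ ^ a) = ζ ^ a := ihb (by omega)
      (fun l hl h => hNd l hl (h.mul_left a)) _ (by rw [← pow_mul, hζ])
    have h2 : σ (ζ ^ b) = ζ ^ b := iha (by omega)
      (fun l hl h => hNd l hl (h.mul_right b)) _ (by rw [← pow_mul, mul_comm, hζ])
    have hg := Nat.gcd_eq_gcd_ab a b
    rw [hab.gcd_eq_one] at hg
    have h3 : ζ = (ζ ^ a) ^ (a.gcdA b) * (ζ ^ b) ^ (a.gcdB b) := by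
      rw [← zpow_natCast ζ a, ← zpow_natCast ζ b, ← zpow_mul, ← zpow_mul, ← zpow_add₀ hζ0, ← hg]
      simp
    rw [h3, map_mul, map_zpow₀, map_zpow₀, h1, h2]

end Lattes

end IteratedExt

/-! ### Values of functions, and even coverings of degree two. -/

namespace IteratedExt

open Polynomial WeierstrassCurve WeierstrassCurve.Affine
open scoped nonZeroDivisors WithZero

section Point

variable {Ω : Type*} [Field Ω] [DecidableEq Ω]

/-- The point of the projective line with given homogeneous coordinates. -/
def toPt (s t : Ω) : OnePoint Ω := if t = 0 then ∞ else ((s / t : Ω) : OnePoint Ω)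

lemma toPt_eq_toPt {s t s' t' : Ω} (h : ¬ (s = 0 ∧ t = 0)) (h' : ¬ (s' = 0 ∧ t' = 0))
    (he : s * t' = t * s') : toPt s t = toPt s' t' := by
  unfold toPt
  by_cases ht : t = 0
  · have : t' = 0 := by
      rw [ht, zero_mul, mul_eq_zero] at he
      exact he.resolve_left fun hs => h ⟨hs, ht⟩
    rw [if_pos ht, if_pos this]
  · have : t' ≠ 0 := fun ht' => by
      rw [ht', mul_zero, eq_comm, mul_eq_zero] at he
      exact h' ⟨he.resolve_left ht, ht'⟩
    rw [if_neg ht, if_neg this, OnePoint.coe_eq_coe]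
    field_simp
    linear_combination he

end Point

section Eval

variable {K : Type*} [Field K] {Ω : Type*} [Field Ω] [DecidableEq Ω] [Algebra K Ω]
  (E : WeierstrassCurve K)

variable {E} in
lemma eval₂_aeval_polynomial {x y : Ω} (h : (E.baseChange Ω).toAffine.Equation x y) :
    eval₂ (aeval x : K[X] →ₐ[K] Ω).toRingHom y E.toAffine.polynomial = 0 := by
  rw [equation_iff] at h
  simp [WeierstrassCurve.Affine.polynomial, eval₂_add, eval₂_mul, eval₂_pow] at h ⊢
  linear_combination h

/-- Evaluation of the coordinate ring at a point over an extension field. -/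
def evalAt {x y : Ω} (h : (E.baseChange Ω).toAffine.Equation x y) :
    E.toAffine.CoordinateRing →ₐ[K] Ω :=
  AlgHom.mk (AdjoinRoot.lift (aeval x : K[X] →ₐ[K] Ω).toRingHom y
    (eval₂_aeval_polynomial h)) (fun r => by
    have : algebraMap K E.toAffine.CoordinateRing r = AdjoinRoot.of _ (C r) := rfl
    rw [this]
    simp)

variable {E} {x y : Ω} (h : (E.baseChange Ω).toAffine.Equation x y)

lemma evalAt_poly (p : K[X]) : evalAt E h (CoordinateRing.mk _ (C p)) = aeval x p := by
  refine (AdjoinRoot.lift_mk (eval₂_aeval_polynomial h) _).trans ?_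
  rw [eval₂_C]
  rfl

lemma evalAt_Y : evalAt E h (CoordinateRing.mk _ X) = y := by
  refine (AdjoinRoot.lift_mk (eval₂_aeval_polynomial h) _).trans ?_
  rw [eval₂_X]

/-- The coordinate functions in the coordinate ring. -/
def ringCoords (E : WeierstrassCurve K) : Fin 3 → E.toAffine.CoordinateRing :=
  ![CoordinateRing.mk E.toAffine (C X), CoordinateRing.mk E.toAffine X, 1]

lemma aeval_genericCoords (F : MvPolynomial (Fin 3) K) :
    MvPolynomial.aeval (genericCoords E) F =
      algebraMap _ E.toAffine.FunctionField (MvPolynomial.aeval (ringCoords E) F) := by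
  rw [← MvPolynomial.aeval_algebraMap_apply]
  congr 2
  ext i
  fin_cases i <;> simp [genericCoords, ringCoords]

lemma evalAt_ringCoords (F : MvPolynomial (Fin 3) K) :
    evalAt E h (MvPolynomial.aeval (ringCoords E) F) = MvPolynomial.aeval ![x, y, 1] F := by
  rw [← AlgHom.comp_apply, MvPolynomial.comp_aeval]
  congr 2
  ext i
  fin_cases i
  · exact (evalAt_poly h X).trans (aeval_X x)
  · exact evalAt_Y h
  · exact map_one _

/-- The value at an affine point of a function written as a fraction. -/
lemma isValueAt_some {f : E.toAffine.FunctionField} {a b c : K[X]}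
    (hf : f * polyFn E.toAffine c = polyFn E.toAffine a + polyFn E.toAffine b * yGen E.toAffine)
    (hxy : (E.baseChange Ω).toAffine.Nonsingular x y) {v : OnePoint Ω}
    (hv : IsValueAt f (Point.some x y hxy) v)
    (h0 : ¬ (aeval x a + aeval x b * y = 0 ∧ aeval x c = 0)) :
    v = toPt (aeval x a + aeval x b * y) (aeval x c) := by
  obtain ⟨n, F, G, -, -, hFG, hne, rfl⟩ := hv
  refine toPt_eq_toPt hne h0 ?_
  have h1 : (CoordinateRing.mk E.toAffine (C a) +
      CoordinateRing.mk E.toAffine (C b) * CoordinateRing.mk E.toAffine X) *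
        MvPolynomial.aeval (ringCoords E) G =
      CoordinateRing.mk E.toAffine (C c) * MvPolynomial.aeval (ringCoords E) F := by
    apply IsFractionRing.injective E.toAffine.CoordinateRing E.toAffine.FunctionField
    rw [map_mul, map_mul, ← aeval_genericCoords, ← aeval_genericCoords, map_add, map_mul]
    change (polyFn E.toAffine a + polyFn E.toAffine b * yGen E.toAffine) * _ =
      polyFn E.toAffine c * _
    rw [← hf, ← hFG]
    ring
  have h2 := congrArg (evalAt E hxy.1) h1
  rw [map_mul, map_mul, map_add, map_mul, evalAt_poly, evalAt_poly, evalAt_poly, evalAt_Y,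
    evalAt_ringCoords, evalAt_ringCoords] at h2
  change MvPolynomial.aeval ![x, y, 1] F * _ = MvPolynomial.aeval ![x, y, 1] G * _
  linear_combination -h2

/-- The leading term at infinity of a homogeneous form. -/
lemma inftyVal_aeval_sub_lt {F : MvPolynomial (Fin 3) K} {n : ℕ} (hF : F.IsHomogeneous n) :
    inftyVal E.toAffine (MvPolynomial.aeval (genericCoords E) F -
      algebraMap K _ (MvPolynomial.aeval ![(0 : K), 1, 0] F) * yGen E.toAffine ^ n) <
      WithZero.exp (3 * n : ℤ) := by
  have hg : genericCoords E = ![xGen E.toAffine, yGen E.toAffine, 1] := rfl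
  rw [hg, MvPolynomial.aeval_def, MvPolynomial.aeval_def, MvPolynomial.eval₂_eq',
    MvPolynomial.eval₂_eq', map_sum, Finset.sum_mul, ← Finset.sum_sub_distrib]
  refine Valuation.map_sum_lt _ WithZero.exp_ne_zero fun m hm => ?_
  have hm' : m 0 + m 1 + m 2 = n := by
    have := hF (MvPolynomial.mem_support_iff.mp hm)
    rw [Finsupp.weight_apply, Finsupp.sum_fintype _ _ (by simp)] at this
    simpa [Fin.sum_univ_three] using this
  simp only [Fin.prod_univ_three, Matrix.cons_val_zero, Matrix.cons_val_one, Matrix.cons_val,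
    one_pow, mul_one, Algebra.algebraMap_self, RingHom.id_apply]
  -- A monomial `x ^ i * y ^ j` in a form of degree `n` has pole order `2i + 3j < 3n` unless it is
  -- `y ^ n`, whose coefficient is the value of the form at `(0 : 1 : 0)`.
  by_cases h : m 0 = 0 ∧ m 2 = 0
  · rw [h.1, h.2, show m 1 = n by omega]
    simp
  · have h0 : (0 : K) ^ m 0 * 0 ^ m 2 = 0 := by
      rw [← pow_add]
      exact zero_pow (by omega)
    rw [h0, mul_zero, map_zero (algebraMap K _), zero_mul, sub_zero, map_mul, map_mul, map_pow, map_pow,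
      inftyVal_xGen, inftyVal_yGen, ← WithZero.exp_nsmul, ← WithZero.exp_nsmul,
      ← WithZero.exp_add]
    refine (mul_le_of_le_one_left' (inftyVal_const_le _ _)).trans_lt ?_
    rw [WithZero.exp_lt_exp]
    simp only [nsmul_eq_mul]
    omega

/-- The value at infinity of a fraction of degree one in `x`. -/
lemma isValueAt_zero {f : E.toAffine.FunctionField} {p q : K[X]}
    (hf : f * polyFn E.toAffine q = polyFn E.toAffine p) (hp : p.natDegree ≤ 1)
    (hq : q.natDegree ≤ 1) {v : OnePoint Ω}
    (hv : IsValueAt f (0 : (E.baseChange Ω).toAffine.Point) v)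
    (h0 : ¬ (algebraMap K Ω (p.coeff 1) = 0 ∧ algebraMap K Ω (q.coeff 1) = 0)) :
    v = toPt (algebraMap K Ω (p.coeff 1)) (algebraMap K Ω (q.coeff 1)) := by
  obtain ⟨n, F, G, hF, hG, hFG, hne, rfl⟩ := hv
  have hK : ∀ F : MvPolynomial (Fin 3) K, MvPolynomial.aeval (homogCoords
      (0 : (E.baseChange Ω).toAffine.Point)) F =
        algebraMap K Ω (MvPolynomial.aeval ![(0 : K), 1, 0] F) := by
    intro F
    rw [← MvPolynomial.aeval_algebraMap_apply]
    congr 2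
    ext i
    fin_cases i <;> simp [homogCoords]
  refine toPt_eq_toPt hne h0 ?_
  rw [hK, hK, ← map_mul, ← map_mul]
  congr 1
  have hlt := inftyVal_aeval_sub_lt (E := E) hF
  have hlt' := inftyVal_aeval_sub_lt (E := E) hG
  set cF := MvPolynomial.aeval ![(0 : K), 1, 0] F
  set cG := MvPolynomial.aeval ![(0 : K), 1, 0] G
  set AF := MvPolynomial.aeval (genericCoords E) F
  set AG := MvPolynomial.aeval (genericCoords E) G
  have hlin : ∀ r : K[X], r.natDegree ≤ 1 → polyFn E.toAffine r =
      algebraMap K _ (r.coeff 1) * xGen E.toAffine + algebraMap K _ (r.coeff 0) := by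
    intro r hr
    nth_rw 1 [eq_X_add_C_of_natDegree_le_one hr]
    rw [map_add, map_mul, polyFn_C, polyFn_C, polyFn_X]
  have hle : ∀ r : K[X], r.natDegree ≤ 1 →
      inftyVal E.toAffine (polyFn E.toAffine r) ≤ WithZero.exp 2 := by
    intro r hr
    by_cases h : r = 0
    · simp [h]
    · rw [inftyVal_poly _ h, WithZero.exp_le_exp]
      omega
  have hy : inftyVal E.toAffine (yGen E.toAffine ^ n) = WithZero.exp (3 * n : ℤ) := by
    rw [map_pow, inftyVal_yGen, ← WithZero.exp_nsmul]
    congr 1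
    simp [mul_comm]
  by_contra hcon
  -- Compare the two fractions at pole order `3n + 2`: if the values at infinity differed, the left
  -- side would have exactly this order, while every term on the right has a smaller one.
  have hid : algebraMap K E.toAffine.FunctionField (cF * q.coeff 1 - cG * p.coeff 1) *
      (xGen E.toAffine * yGen E.toAffine ^ n) =
      polyFn E.toAffine p * (AG - algebraMap K _ cG * yGen E.toAffine ^ n) -
      polyFn E.toAffine q * (AF - algebraMap K _ cF * yGen E.toAffine ^ n) +
      algebraMap K _ (cG * p.coeff 0 - cF * q.coeff 0) * yGen E.toAffine ^ n := by
    have h1 : polyFn E.toAffine p * AG = polyFn E.toAffine q * AF := by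
      rw [← hf, ← hFG]; ring
    rw [mul_sub, mul_sub, h1, hlin p hp, hlin q hq]
    simp only [map_sub, map_mul]
    ring
  have hval := congrArg (inftyVal E.toAffine) hid
  rw [map_mul, inftyVal_const _ (sub_ne_zero.mpr hcon), one_mul, map_mul, hy, inftyVal_xGen,
    ← WithZero.exp_add] at hval
  refine absurd hval.le (not_le.mpr ?_)
  refine Valuation.map_add_lt _ (Valuation.map_sub_lt _ ?_ ?_) ?_
  · rw [map_mul, WithZero.exp_add]
    exact mul_lt_mul_of_le_of_lt_of_nonneg_of_pos (hle p hp) hlt' zero_le (by simp)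
  · rw [map_mul, WithZero.exp_add]
    exact mul_lt_mul_of_le_of_lt_of_nonneg_of_pos (hle q hq) hlt zero_le (by simp)
  · rw [map_mul, hy]
    refine (mul_le_of_le_one_left' (inftyVal_const_le _ _)).trans_lt ?_
    rw [WithZero.exp_lt_exp]
    omega

end Eval

section Coordinate

variable {K : Type*} [Field K] (W : WeierstrassCurve.Affine K)

lemma polyFn_injective : Function.Injective (polyFn W) := by
  rw [injective_iff_map_eq_zero]
  intro p hp
  by_contra h
  have := inftyVal_poly W h
  rw [hp, map_zero] at this
  exact WithZero.exp_ne_zero this.symm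

/-- The embedding of the rational function field by the coordinate `x`. -/
def ratFn : RatFunc K →ₐ[K] W.FunctionField :=
  RatFunc.liftAlgHom (S := K) { polyFn W with commutes' := fun _ => rfl }
    (nonZeroDivisors_le_comap_nonZeroDivisors_of_injective _ (polyFn_injective W))

lemma ratFn_apply (r : RatFunc K) : ratFn W r = polyFn W r.num / polyFn W r.denom :=
  RatFunc.liftAlgHom_apply _ _ _

lemma ratFn_algebraMap (p : K[X]) : ratFn W (algebraMap _ _ p) = polyFn W p := by
  rw [ratFn_apply, RatFunc.num_algebraMap, RatFunc.denom_algebraMap, map_one, div_one]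

lemma polyFn_add_eq_zero {p q : K[X]} (h : polyFn W p + polyFn W q * yGen W = 0) : q = 0 := by
  rw [← algebraMap_smul_basis, map_eq_zero_iff _ (IsFractionRing.injective _ _)] at h
  exact (CoordinateRing.smul_basis_eq_zero h).2

lemma exists_fraction (f : W.FunctionField) :
    ∃ a b c : K[X], c ≠ 0 ∧ f * polyFn W c = polyFn W a + polyFn W b * yGen W := by
  obtain ⟨u, w, hw, rfl⟩ := IsFractionRing.div_surjective (A := W.CoordinateRing) f
  obtain ⟨t, ht⟩ := dvd_norm W w
  obtain ⟨a, b, hab⟩ := exists_algebraMap_eq W (u * t)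
  have hw0 : w ≠ 0 := nonZeroDivisors.ne_zero hw
  refine ⟨a, b, Algebra.norm K[X] w, norm_ne_zero W hw0, ?_⟩
  rw [← hab, show polyFn W (Algebra.norm K[X] w) =
    algebraMap _ _ (CoordinateRing.mk W (C (Algebra.norm K[X] w))) from rfl, ht, map_mul, map_mul]
  have : algebraMap _ W.FunctionField w ≠ 0 :=
    (map_ne_zero_iff _ (IsFractionRing.injective _ _)).mpr hw0
  field_simp

/-- Multiplicativity of degrees along `K(f) ⊆ K(x) ⊆ K(E)`: the upper step is not trivial because
`y` is not in `K(x)`, so the lower step, of degree `ratDegree r`, is. -/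
lemma ratDegree_eq_one (r : RatFunc K)
    (h : Module.finrank (IntermediateField.adjoin K {ratFn W r}) W.FunctionField = 2) :
    ratDegree r = 1 := by
  have h1 : IntermediateField.adjoin K {ratFn W r} =
      (IntermediateField.adjoin K {r}).map (ratFn W) := by
    rw [IntermediateField.adjoin_map, Set.image_singleton]
  have h2 := IntermediateField.relfinrank_mul_finrank_top
    (IntermediateField.map_mono (ratFn W) (le_top (a := IntermediateField.adjoin K {r})))
  rw [IntermediateField.relfinrank_map_map, IntermediateField.relfinrank_top_right,
    RatFunc.finrank_eq_max_natDegree, ← h1, h] at h2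
  change ratDegree r * _ = 2 at h2
  have h3 : Module.finrank ((⊤ : IntermediateField K (RatFunc K)).map (ratFn W)) W.FunctionField
      ≠ 1 := by
    intro h3
    rw [IntermediateField.finrank_eq_one_iff_eq_top] at h3
    have h4 : yGen W ∈ (⊤ : IntermediateField K (RatFunc K)).map (ratFn W) := h3 ▸ trivial
    obtain ⟨s, -, hs⟩ := h4
    have hs : ratFn W s = yGen W := hs
    rw [ratFn_apply, div_eq_iff ((map_ne_zero_iff _ (polyFn_injective W)).mpr
      (RatFunc.denom_ne_zero s))] at hs
    refine RatFunc.denom_ne_zero s (polyFn_add_eq_zero W (p := -s.num) ?_)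
    rw [map_neg, hs]; ring
  have h5 : ratDegree r ∣ 2 := ⟨_, h2.symm⟩
  rcases (Nat.dvd_prime Nat.prime_two).mp h5 with h6 | h6
  · exact h6
  · rw [h6] at h2
    omega

end Coordinate

section Kummer

variable {K : Type*} [Field K] {Ω : Type*} [Field Ω] [DecidableEq Ω] [Algebra K Ω]
  [IsAlgClosed Ω] {E : WeierstrassCurve K} [E.IsElliptic]

/-- The `x`-coordinate as a map to the projective line. -/
def xCoord : (E.baseChange Ω).toAffine.Point → OnePoint Ω
  | .zero => ∞
  | .some x _ _ => (x : OnePoint Ω)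

lemma exists_point (x : Ω) : ∃ y, (E.baseChange Ω).toAffine.Nonsingular x y := by
  set W := (E.baseChange Ω).toAffine
  obtain ⟨y, hy⟩ := IsAlgClosed.exists_root
    (C 1 * X ^ 2 + C (W.a₁ * x + W.a₃) * X + C (-(x ^ 3 + W.a₂ * x ^ 2 + W.a₄ * x + W.a₆)))
    (by rw [degree_quadratic one_ne_zero]; decide)
  refine ⟨y, equation_iff_nonsingular.mp ((equation_iff _ _).mpr ?_)⟩
  simp only [IsRoot, eval_add, eval_mul, eval_C, eval_pow, eval_X] at hy
  linear_combination hy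

lemma isKummerMap_xCoord : IsKummerMap (xCoord (Ω := Ω) (E := E)) where
  eq_iff P P' := by
    constructor
    · intro h
      rcases P with _ | ⟨x, y, hxy⟩ <;> rcases P' with _ | ⟨x', y', hxy'⟩
      · exact Or.inl rfl
      · exact absurd h.symm (OnePoint.coe_ne_infty x')
      · exact absurd h (OnePoint.coe_ne_infty x)
      · obtain rfl : x = x' := OnePoint.coe_injective h
        rcases Y_eq_of_X_eq hxy.1 hxy'.1 rfl with h1 | h1
        · subst h1; exact Or.inl rfl
        · rw [Point.neg_some]
          subst h1
          exact Or.inr rfl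
    · rintro (rfl | rfl)
      · rfl
      · rcases P' with _ | ⟨x, y, hxy⟩ <;> rfl
  surjective z := by
    cases z using OnePoint.rec with
    | infty => exact ⟨0, rfl⟩
    | coe x =>
      obtain ⟨y, hy⟩ := exists_point (E := E) x
      exact ⟨.some x y hy, rfl⟩
  map σ P := by rcases P with _ | ⟨x, y, hxy⟩ <;> rfl

lemma ratMap_injective {r : RatFunc K} (hr : ratDegree r = 1) :
    Function.Injective (ratMap Ω r) := by
  intro z z' h
  obtain ⟨κ, X, -, hX, -, hmem⟩ := exists_fibre (Ω := Ω) (φ := r) (by omega) (ratMap Ω r z')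
  rw [hr, Multiset.card_eq_one] at hX
  obtain ⟨a, rfl⟩ := hX
  rw [Multiset.mem_singleton.mp ((hmem z).mpr h), Multiset.mem_singleton.mp ((hmem z').mpr rfl)]

lemma ratMap_map (r : RatFunc K) (σ : Ω ≃ₐ[K] Ω) (z : OnePoint Ω) :
    ratMap Ω r (OnePoint.map σ z) = OnePoint.map σ (ratMap Ω r z) := by
  cases z using OnePoint.rec with
  | infty =>
    change ratMap Ω r ∞ = _
    simp only [ratMap]
    split_ifs
    · rfl
    · rw [OnePoint.map_some, map_div₀, AlgEquiv.commutes, AlgEquiv.commutes]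
  | coe z =>
    rw [OnePoint.map_some]
    simp only [ratMap]
    rw [← AlgEquiv.coe_toAlgHom, aeval_algHom_apply, aeval_algHom_apply, AlgEquiv.coe_toAlgHom]
    by_cases h : aeval z r.denom = 0
    · rw [if_pos h, if_pos (by rw [h, map_zero])]
      rfl
    · rw [if_neg h, if_neg (by rwa [map_eq_zero_iff σ σ.injective]), OnePoint.map_some, map_div₀]

/-- An even covering of degree two of the line by an elliptic curve is the `x`-coordinate up to a
Möbius transformation. -/
lemma isKummerMap_of_even {f : E.toAffine.FunctionField}
    {π : (E.baseChange Ω).toAffine.Point → OnePoint Ω}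
    (hf : Module.finrank (IntermediateField.adjoin K {f}) E.toAffine.FunctionField = 2)
    (hπ : ∀ P, IsValueAt f P (π P)) (heven : ∀ P, π P = π (-P)) : IsKummerMap π := by
  obtain ⟨a, b, c, hc, habc⟩ := exists_fraction E.toAffine f
  -- Write `f = (a + b * y) / c`. Where `b * c` does not vanish, evenness forces `P = -P`. With `b ≠
  -- 0` this would leave only finitely many `x`-coordinates.
  have hb : b = 0 := by
    by_contra hb
    have hbc : (b * c).map (algebraMap K Ω) ≠ 0 :=
      (Polynomial.map_ne_zero_iff (algebraMap K Ω).injective).mpr (mul_ne_zero hb hc)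
    have : Infinite Ω := IsAlgClosed.instInfinite
    have hfin : (Set.univ : Set (OnePoint Ω)).Finite := by
      refine Set.Finite.subset (((finite_eq_neg (E.baseChange Ω)).image xCoord).union
        ((((b * c).map (algebraMap K Ω)).roots.toFinset.finite_toSet.image
          (OnePoint.some : Ω → OnePoint Ω)))) fun z _ => ?_
      obtain ⟨P, rfl⟩ := (isKummerMap_xCoord (E := E)).surjective z
      rcases P with _ | ⟨x, y, hxy⟩
      · exact Or.inl ⟨0, by simp, rfl⟩
      by_cases h0 : aeval x (b * c) = 0
      · refine Or.inr ⟨x, ?_, rfl⟩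
        simp only [Finset.mem_coe, Multiset.mem_toFinset, mem_roots hbc, IsRoot]
        rw [eval_map_algebraMap, h0]
      refine Or.inl ⟨.some x y hxy, ?_, rfl⟩
      rw [map_mul, mul_eq_zero, not_or] at h0
      have h1 := heven (.some x y hxy)
      rw [isValueAt_some habc hxy (hπ _) (fun h => h0.2 h.2), Point.neg_some,
        isValueAt_some habc _ (hπ _) (fun h => h0.2 h.2), toPt, toPt, if_neg h0.2, if_neg h0.2,
        OnePoint.coe_eq_coe, div_left_inj' h0.2, add_right_inj, mul_right_inj' h0.1] at h1
      change Point.some x y hxy = -Point.some x y hxy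
      rw [Point.neg_some]
      congr 1
    exact Set.infinite_univ hfin
  obtain ⟨r, rfl⟩ : ∃ r, f = ratFn E.toAffine r := by
    refine ⟨algebraMap _ _ a / algebraMap _ _ c, ?_⟩
    rw [map_div₀, ratFn_algebraMap, ratFn_algebraMap,
      eq_div_iff ((map_ne_zero_iff _ (polyFn_injective _)).mpr hc), habc, hb]
    simp
  have hr := ratDegree_eq_one E.toAffine r hf
  have hrf : ratFn E.toAffine r * polyFn E.toAffine r.denom = polyFn E.toAffine r.num := by
    rw [ratFn_apply, div_mul_cancel₀ _ ((map_ne_zero_iff _ (polyFn_injective _)).mpr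
      (RatFunc.denom_ne_zero r))]
  have key : ∀ P, π P = ratMap Ω r (xCoord P) := by
    intro P
    rcases P with _ | ⟨x, y, hxy⟩
    · obtain ⟨s, hs, hs'⟩ := ratMap_coords (Ω := Ω) r ∞
      have h1 : ratMap Ω r ∞ = toPt (algebraMap K Ω (r.num.coeff 1))
        (algebraMap K Ω (r.denom.coeff 1)) := by rw [← hr]; rfl
      refine (isValueAt_zero hrf (hr ▸ le_max_left _ _) (hr ▸ le_max_right _ _) (hπ 0) ?_).trans
        h1.symm
      rintro ⟨h2, h3⟩
      rw [coords_infty, homEval_infty, homEval_infty, hr, numΩ, denΩ, coeff_map, coeff_map, h2, h3,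
        Prod.mk.injEq, zero_eq_mul, or_iff_right hs, zero_eq_mul, or_iff_right hs] at hs'
      generalize ratMap Ω r ∞ = z at hs'
      cases z using OnePoint.rec <;> simp [coords_infty, coords_coe] at hs'
    · have h1 : ratMap Ω r x = toPt (aeval x r.num) (aeval x r.denom) := rfl
      have h2 := isValueAt_some (b := 0) (a := r.num) (by rw [hrf]; simp) hxy (hπ _) (by
        rintro ⟨h2, h3⟩
        obtain ⟨u, v, huv⟩ := RatFunc.isCoprime_num_denom r
        have := congrArg (aeval x) huv
        simp only [map_zero, zero_mul, add_zero] at h2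
        simp [h2, h3] at this)
      rw [h2]
      simp only [map_zero, zero_mul, add_zero]
      rfl
  have hx := isKummerMap_xCoord (Ω := Ω) (E := E)
  refine ⟨fun P P' => ?_, fun z => ?_, fun σ P => ?_⟩
  · rw [key, key, (ratMap_injective hr).eq_iff, hx.eq_iff]
  · obtain ⟨w, rfl⟩ := ratMap_surjective (Ω := Ω) (φ := r) (by omega) z
    obtain ⟨P, rfl⟩ := hx.surjective w
    exact ⟨P, key P⟩
  · rw [key, key, hx.map, ratMap_map]

end Kummer

/-! ### Descent from fixing automorphisms to membership. -/

section Descent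

variable {K : Type*} [Field K] {Ω : Type*} [Field Ω] [Algebra K Ω] [IsAlgClosed Ω]
  [Algebra.IsAlgebraic K Ω]

/-- A root of unity of order prime to the characteristic that is fixed by all automorphisms over an
intermediate field lies in that field. -/
lemma rootOfUnity_mem_of_fixed (L : IntermediateField K Ω) {N : ℕ} (hN : (N : Ω) ≠ 0) {ζ : Ω}
    (hζ : ζ ^ N = 1) (h : ∀ σ : Ω ≃ₐ[K] Ω, (∀ z ∈ L, σ z = z) → σ ζ = ζ) : ζ ∈ L := by
  have hN' : (N : L) ≠ 0 := fun h0 => hN (by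
    have := congrArg (algebraMap L Ω) h0
    simpa using this)
  have hN0 : 0 < N := Nat.pos_of_ne_zero fun h0 => hN (by simp [h0])
  have hsep : IsSeparable L ζ := by
    refine (separable_X_pow_sub_C (1 : L) hN' one_ne_zero).of_dvd (minpoly.dvd L ζ ?_)
    simp [hζ]
  have : Algebra.IsAlgebraic L Ω := Algebra.IsAlgebraic.tower_top (K := K) L
  have : IsAlgClosure L Ω := ⟨inferInstance, inferInstance⟩
  have : Normal L Ω := IsAlgClosure.normal L Ω
  by_contra hmem
  have h1 : ζ ∉ (⊥ : Subalgebra L Ω) := by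
    rintro ⟨z, rfl⟩
    exact hmem z.2
  obtain ⟨ξ, hξ, hconj⟩ := (notMem_iff_exists_ne_and_isConjRoot hsep
    (IsAlgClosed.splits _)).mp h1
  obtain ⟨σ, hσ⟩ := isConjRoot_iff_exists_algEquiv.mp hconj.symm
  refine hξ ?_
  rw [← hσ]
  exact (h (σ.restrictScalars K) fun z hz => σ.commutes ⟨z, hz⟩).symm

lemma inExtensionOfDegreeLE_of_le {L M : IntermediateField K Ω} (h : M ≤ L) {n : ℕ} (hn : 1 ≤ n) :
    InExtensionOfDegreeLE L M n :=
  ⟨⊥, inferInstance, by rw [IntermediateField.finrank_bot]; exact hn,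
    fun z hz => (⊥ : IntermediateField L Ω).algebraMap_mem ⟨z, h hz⟩⟩

/-- The iterated extensions of a flexible Lattès map contain roots of unity. -/
theorem cyclotomicField_le_of_isFlexibleLattes [DecidableEq Ω] {φ : RatFunc K} {m : ℕ}
    (hd : 0 < ratDegree φ) (hd' : ((ratDegree φ : ℕ) : Ω) ≠ 0) (hm : m ∣ ratDegree φ)
    (hφ : IsFlexibleLattes Ω φ) (b : OnePoint K) :
    cyclotomicField K Ω m ≤ iteratedField Ω φ b := by
  obtain ⟨E, _, f, π, e, Q, hf, -, hπ, heven, -, hφ⟩ := hφ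
  have hK := isKummerMap_of_even hf hπ heven
  refine IntermediateField.adjoin_le_iff.mpr ?_
  rintro ζ ⟨k, -, hζ⟩
  have hm0 : m ≠ 0 := fun h => by rw [h, zero_dvd_iff] at hm; omega
  have hmΩ : ((m ^ k : ℕ) : Ω) ≠ 0 := by
    obtain ⟨t, ht⟩ := hm
    rw [ht, Nat.cast_mul] at hd'
    rw [Nat.cast_pow]
    exact pow_ne_zero _ (left_ne_zero_of_mul hd')
  exact rootOfUnity_mem_of_fixed _ hmΩ hζ fun σ hσ =>
    fixes_rootsOfUnity hK hφ hd hd' σ hσ (m ^ k) (pow_ne_zero _ hm0)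
      (fun l hl h => (hl.dvd_of_dvd_pow h).trans hm) ζ hζ

end Descent

end IteratedExt

namespace IteratedExt

open Polynomial

/-! ### Adjoining finitely many elements, and systems of roots of unity. -/

section FiniteExtension

variable {K : Type*} [Field K] {Ω : Type*} [Field Ω] [Algebra K Ω]

lemma inFiniteExtension_of_le_sup_adjoin [Algebra.IsAlgebraic K Ω] {L M : IntermediateField K Ω}
    {S : Set Ω} (hS : S.Finite) (h : M ≤ IntermediateField.adjoin K S ⊔ L) :
    InFiniteExtension L M := by
  have : Algebra.IsAlgebraic L Ω := Algebra.IsAlgebraic.tower_top (K := K) L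
  have : Finite S := hS
  refine ⟨IntermediateField.adjoin L S, IntermediateField.finiteDimensional_adjoin
    fun x _ => Algebra.IsIntegral.isIntegral x, h.trans (sup_le ?_ fun z hz => ?_)⟩
  · rw [IntermediateField.adjoin_le_iff]
    exact IntermediateField.subset_adjoin L S
  · exact (IntermediateField.adjoin L S).algebraMap_mem ⟨z, hz⟩

end FiniteExtension

section Roots

variable {Ω : Type*} [Field Ω]

lemma muInfty_ne_zero {d : ℕ} (hd : d ≠ 0) {ζ : Ω} (hζ : ζ ∈ muInfty Ω d) : ζ ≠ 0 := by
  obtain ⟨k, -, hk⟩ := hζ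
  rintro rfl
  rw [zero_pow (pow_ne_zero k hd)] at hk
  exact zero_ne_one hk

lemma muInfty_mul {d : ℕ} {ζ ξ : Ω} (hζ : ζ ∈ muInfty Ω d) (hξ : ξ ∈ muInfty Ω d) :
    ζ * ξ ∈ muInfty Ω d := by
  obtain ⟨k, hk, hζ⟩ := hζ
  obtain ⟨l, -, hξ⟩ := hξ
  refine ⟨k + l, by omega, ?_⟩
  rw [mul_pow, pow_add, pow_mul, hζ, one_pow, one_mul, mul_comm (d ^ k), pow_mul, hξ, one_pow]

lemma muInfty_mono {m d : ℕ} (h : m ∣ d) : muInfty Ω m ⊆ muInfty Ω d := by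
  rintro ζ ⟨k, hk, hζ⟩
  obtain ⟨t, ht⟩ := pow_dvd_pow_of_dvd h k
  exact ⟨k, hk, by rw [ht, pow_mul, hζ, one_pow]⟩

variable [IsAlgClosed Ω]

/-- A primitive root of order `d ^ n ≥ 4` exists because `d` is invertible, and its order does not
divide `2`. -/
lemma exists_muInfty_sq_ne_one {d : ℕ} (hd : 2 ≤ d) (hd' : (d : Ω) ≠ 0) {n : ℕ} (hn : 2 ≤ n) :
    ∃ η : Ω, η ^ d ^ n = 1 ∧ η ^ 2 ≠ 1 := by
  have : NeZero ((d ^ n : ℕ) : Ω) := ⟨by rw [Nat.cast_pow]; exact pow_ne_zero n hd'⟩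
  obtain ⟨η, hη⟩ := HasEnoughRootsOfUnity.exists_primitiveRoot Ω (d ^ n)
  refine ⟨η, hη.pow_eq_one, fun h => ?_⟩
  have h1 := Nat.le_of_dvd two_pos (hη.dvd_of_pow_eq_one 2 h)
  have h2 : 2 ^ 2 ≤ d ^ n :=
    (Nat.pow_le_pow_left hd 2).trans (Nat.pow_le_pow_right (by omega) hn)
  omega

end Roots

/-! ### Chebyshev polynomials. -/

section Chebyshev

variable {K : Type*} [Field K] {Ω : Type*} [Field Ω] [DecidableEq Ω] [Algebra K Ω]

lemma ratMap_chebyshevT (d : ℕ) (z : Ω) :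
    ratMap Ω (chebyshevT K d) z = ((Chebyshev.C Ω d).eval z : Ω) := by
  have h : ratMap Ω (chebyshevT K d) z = toPt (aeval z (chebyshevT K d).num)
    (aeval z (chebyshevT K d).denom) := rfl
  rw [h, chebyshevT, RatFunc.num_algebraMap, RatFunc.denom_algebraMap, map_one, toPt,
    if_neg one_ne_zero, div_one, ← eval_map_algebraMap, Chebyshev.map_C]

lemma eval_chebyshev_C {w : Ω} (hw : w ≠ 0) (d : ℕ) :
    (Chebyshev.C Ω d).eval (w + w⁻¹) = w ^ d + (w ^ d)⁻¹ := by
  rw [← dickson_one_one_eq_chebyshev_C, dickson_one_one_eval_add_inv _ _ (mul_inv_cancel₀ hw),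
    inv_pow]

lemma iterate_ratMap_chebyshevT {w : Ω} (hw : w ≠ 0) (d n : ℕ) :
    (ratMap Ω (chebyshevT K d))^[n] ((w + w⁻¹ : Ω) : OnePoint Ω) =
      ((w ^ d ^ n + (w ^ d ^ n)⁻¹ : Ω) : OnePoint Ω) := by
  induction n with
  | zero => simp
  | succ n ih =>
    rw [Function.iterate_succ_apply', ih, ratMap_chebyshevT, eval_chebyshev_C (pow_ne_zero _ hw),
      ← pow_mul, pow_succ]

variable [IsAlgClosed Ω]

lemma exists_add_inv_eq (b : Ω) : ∃ w : Ω, w ≠ 0 ∧ w + w⁻¹ = b := by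
  obtain ⟨w, hw⟩ := IsAlgClosed.exists_root (C 1 * X ^ 2 + C (-b) * X + C 1 : Polynomial Ω)
    (by rw [degree_quadratic one_ne_zero]; decide)
  simp only [IsRoot, eval_add, eval_mul, eval_C, eval_pow, eval_X] at hw
  have h0 : w ≠ 0 := by
    rintro rfl
    simp at hw
  refine ⟨w, h0, ?_⟩
  field_simp
  linear_combination hw

/-- A field containing a full backward orbit of the Chebyshev polynomial contains the traces of the
roots of unity. -/
lemma add_inv_mem_of_backwardOrbit {d : ℕ} (hd : 2 ≤ d) (hd' : (d : Ω) ≠ 0)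
    (L : IntermediateField K Ω) (b : Ω)
    (hL : ∀ (n : ℕ) (w : Ω), w ≠ 0 → w ^ d ^ n + (w ^ d ^ n)⁻¹ = b → w + w⁻¹ ∈ L)
    {ζ : Ω} (hζ : ζ ∈ muInfty Ω d) : ζ + ζ⁻¹ ∈ L := by
  have hζ0 := muInfty_ne_zero (by omega) hζ
  obtain ⟨k, hk, hζ⟩ := hζ
  obtain ⟨w, hw, rfl⟩ := exists_add_inv_eq b
  -- One level above `k`, so that `n ≥ 2` and a root of order above two is available at level `n`.
  set n := k + 1
  have hN : 0 < d ^ n := pow_pos (by omega) n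
  have hζn : ζ ^ d ^ n = 1 := by rw [pow_succ, pow_mul, hζ, one_pow]
  obtain ⟨y₀, hy₀⟩ := IsAlgClosed.exists_pow_nat_eq w hN
  -- The quotient below divides by `y + y⁻¹`, which vanishes exactly when `y ^ 2 = -1`; in that case
  -- `y₀` is multiplied by a root of unity with square different from `1`.
  obtain ⟨y, hy, hy2⟩ : ∃ y : Ω, y ^ d ^ n = w ∧ y ^ 2 ≠ -1 := by
    by_cases h : y₀ ^ 2 = -1
    · obtain ⟨η, hη, hη2⟩ := exists_muInfty_sq_ne_one hd hd' (n := n) (by omega)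
      refine ⟨η * y₀, by rw [mul_pow, hη, one_mul, hy₀], fun h2 => hη2 ?_⟩
      rw [mul_pow, h] at h2
      linear_combination -h2
    · exact ⟨y₀, hy₀, h⟩
  have hy0 : y ≠ 0 := by
    rintro rfl
    rw [zero_pow hN.ne'] at hy
    exact hw hy.symm
  have hmem : ∀ z : Ω, z ≠ 0 → z ^ d ^ n = 1 → z * y + (z * y)⁻¹ ∈ L := by
    intro z hz hz1
    refine hL n _ (mul_ne_zero hz hy0) ?_
    rw [mul_pow, hz1, one_mul, hy]
  have h1 := hmem 1 one_ne_zero (one_pow _)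
  have h2 := L.add_mem (hmem ζ hζ0 hζn) (hmem ζ⁻¹ (inv_ne_zero hζ0) (by rw [inv_pow, hζn, inv_one]))
  have h3 : (1 * y + (1 * y)⁻¹ : Ω) ≠ 0 := by
    intro h
    rw [one_mul] at h
    field_simp at h
    exact hy2 (by linear_combination h)
  have h4 : ζ + ζ⁻¹ = (ζ * y + (ζ * y)⁻¹ + (ζ⁻¹ * y + (ζ⁻¹ * y)⁻¹)) / (1 * y + (1 * y)⁻¹) := by
    rw [eq_div_iff h3]
    field_simp
    ring
  rw [h4]
  exact L.div_mem h2 h1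

/-- A field containing the traces of the roots of unity and one root of unity outside the prime
field contains all of them. -/
lemma mem_of_add_inv_mem {d : ℕ} (hd : d ≠ 0) {M : IntermediateField K Ω}
    (hM : ∀ ζ ∈ muInfty Ω d, ζ + ζ⁻¹ ∈ M) {η : Ω} (hη : η ∈ muInfty Ω d) (hη2 : η ^ 2 ≠ 1)
    (hηM : η ∈ M) {ζ : Ω} (hζ : ζ ∈ muInfty Ω d) : ζ ∈ M := by
  have hζ0 := muInfty_ne_zero hd hζ
  have hη0 := muInfty_ne_zero hd hη
  have h0 : η - η⁻¹ ≠ 0 := by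
    intro h
    field_simp at h
    exact hη2 (by linear_combination h)
  have h1 : ζ = ((ζ * η + (ζ * η)⁻¹) - (ζ + ζ⁻¹) * η⁻¹) / (η - η⁻¹) := by
    rw [eq_div_iff h0]
    field_simp
    ring
  rw [h1]
  exact M.div_mem (M.sub_mem (hM _ (muInfty_mul hζ hη)) (M.mul_mem (hM _ hζ) (M.inv_mem hηM)))
    (M.sub_mem hηM (M.inv_mem hηM))

lemma realCyclotomicField_le_chebyshevT {d : ℕ} (hd : 2 ≤ d) (hd' : (d : Ω) ≠ 0) (b : K) :
    realCyclotomicField K Ω d ≤ iteratedField Ω (chebyshevT K d) (b : OnePoint K) := by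
  refine IntermediateField.adjoin_le_iff.mpr ?_
  rintro _ ⟨ζ, hζ, rfl⟩
  exact add_inv_mem_of_backwardOrbit hd hd' _ (algebraMap K Ω b)
    (fun n w hw hwb => IntermediateField.subset_adjoin _ _ (show _ ∈ backwardOrbit _ _ _ from
      ⟨n, by rw [iterate_ratMap_chebyshevT hw, hwb]; rfl⟩)) hζ

lemma inExtensionOfDegreeLE_chebyshevT [Algebra.IsAlgebraic K Ω] {d : ℕ} (hd : 2 ≤ d)
    (hd' : (d : Ω) ≠ 0) (b : K) :
    InExtensionOfDegreeLE (iteratedField Ω (chebyshevT K d) (b : OnePoint K))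
      (cyclotomicField K Ω d) 2 := by
  set L := iteratedField Ω (chebyshevT K d) (b : OnePoint K)
  have hL := IntermediateField.adjoin_le_iff.mp (realCyclotomicField_le_chebyshevT hd hd' b)
  have : Algebra.IsAlgebraic L Ω := Algebra.IsAlgebraic.tower_top (K := K) L
  obtain ⟨η, hη, hη2⟩ := exists_muInfty_sq_ne_one hd hd' le_rfl
  have hη : η ∈ muInfty Ω d := ⟨2, by norm_num, hη⟩
  have hInt : IsIntegral L η := Algebra.IsIntegral.isIntegral η
  refine ⟨IntermediateField.adjoin L {η}, IntermediateField.adjoin.finiteDimensional hInt, ?_, ?_⟩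
  · rw [IntermediateField.adjoin.finrank hInt]
    set p : Polynomial L := C 1 * X ^ 2 + C (-⟨η + η⁻¹, hL ⟨η, hη, rfl⟩⟩) * X + C 1 with hp
    have hdeg : p.natDegree = 2 := natDegree_quadratic one_ne_zero
    have hmonic : p.Monic := by rw [Monic, leadingCoeff, hdeg]; simp [hp, coeff_one]
    rw [← hdeg]
    refine natDegree_le_natDegree (minpoly.min L η hmonic ?_)
    have h0 := muInfty_ne_zero (by omega) hη
    simp only [hp, map_add, map_mul, aeval_C, map_pow, aeval_X, map_one, map_neg, one_mul]
    change η ^ 2 + -(η + η⁻¹) * η + 1 = 0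
    field_simp
    ring
  · refine IntermediateField.adjoin_le_iff.mpr fun ζ hζ => ?_
    refine mem_of_add_inv_mem (by omega) (fun ξ hξ => ?_) hη hη2
      (IntermediateField.mem_adjoin_simple_self L η) hζ
    exact (IntermediateField.adjoin L {η}).algebraMap_mem ⟨ξ + ξ⁻¹, hL ⟨ξ, hξ, rfl⟩⟩

end Chebyshev

/-! ### Conjugation by Möbius transformations. -/

section Conjugates

variable {K : Type*} [Field K] {Ω : Type*} [Field Ω] [DecidableEq Ω] [Algebra K Ω]

lemma iterate_of_isConjVia {g : GL (Fin 2) Ω} {φ : RatFunc K} {ψ : RatFunc Ω}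
    (h : IsConjVia Ω g φ ψ) (n : ℕ) (z : OnePoint Ω) :
    g • (ratMap Ω φ)^[n] z = (ratMap Ω ψ)^[n] (g • z) :=
  Function.Semiconj.iterate_right (f := fun z => g • z) (fun z => h z) n z

lemma mem_backwardOrbit_iff_of_isConjVia {g : GL (Fin 2) Ω} {φ : RatFunc K} {ψ : RatFunc Ω}
    (h : IsConjVia Ω g φ ψ) (b : OnePoint K) (z : OnePoint Ω) :
    z ∈ backwardOrbit Ω φ b ↔
      ∃ n, (ratMap Ω ψ)^[n] (g • z) = g • OnePoint.map (algebraMap K Ω) b := by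
  refine exists_congr fun n => ?_
  rw [← iterate_of_isConjVia h, (MulAction.injective g).eq_iff]

lemma mem_of_smul_eq_coe (L : IntermediateField K Ω) {g : GL (Fin 2) Ω} (hg : ∀ i j, g i j ∈ L)
    {z : OnePoint Ω} (hz : ∀ x : Ω, z = x → x ∈ L) {x : Ω} (hx : g • z = x) : x ∈ L := by
  cases z using OnePoint.rec with
  | infty =>
    rw [OnePoint.smul_infty_eq_ite] at hx
    split_ifs at hx with h
    · exact absurd hx.symm (OnePoint.coe_ne_infty x)
    · rw [← OnePoint.coe_injective hx]
      exact L.div_mem (hg _ _) (hg _ _)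
  | coe z =>
    rw [OnePoint.smul_some_eq_ite] at hx
    have hz := hz z rfl
    split_ifs at hx with h
    · exact absurd hx.symm (OnePoint.coe_ne_infty x)
    · rw [← OnePoint.coe_injective hx]
      exact L.div_mem (L.add_mem (L.mul_mem (hg _ _) hz) (hg _ _))
        (L.add_mem (L.mul_mem (hg _ _) hz) (hg _ _))

variable [IsAlgClosed Ω] [Algebra.IsAlgebraic K Ω]

/-- Adjoin the entries of `g`, which carry the orbit of `φ` to that of the Chebyshev polynomial, and
one root of unity `η`. The image of `b` is finite, since `∞` is its own only preimage and would make
`b` exceptional. -/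
lemma inFiniteExtension_of_conj_chebyshevT {d m : ℕ} (hd : 2 ≤ d) (hd' : (d : Ω) ≠ 0)
    (hm : m ∣ d) {φ : RatFunc K} {g : GL (Fin 2) Ω} (hg : IsConjVia Ω g φ (chebyshevT Ω d))
    {b : OnePoint K} (hb : ¬ IsExceptional Ω φ b) :
    InFiniteExtension (iteratedField Ω φ b) (cyclotomicField K Ω m) := by
  set b' := g • OnePoint.map (algebraMap K Ω) b with hb'
  have hinfty : ∀ n (z : OnePoint Ω), (ratMap Ω (chebyshevT Ω d))^[n] z = ∞ → z = ∞ := by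
    intro n
    induction n with
    | zero => exact fun z hz => hz
    | succ n ih =>
      intro z hz
      rw [Function.iterate_succ_apply] at hz
      have h1 := ih _ hz
      cases z using OnePoint.rec with
      | infty => rfl
      | coe z =>
        rw [ratMap_chebyshevT] at h1
        exact absurd h1 (OnePoint.coe_ne_infty _)
  have hb'c : ∃ c : Ω, b' = c := by
    by_contra! hcon
    have h0 : b' = ∞ := by
      generalize b' = z at hcon
      cases z using OnePoint.rec with
      | infty => rfl
      | coe z => exact absurd rfl (hcon z)
    refine hb (Set.Finite.subset (Set.finite_singleton (g⁻¹ • (∞ : OnePoint Ω))) fun z hz => ?_)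
    obtain ⟨n, hn⟩ := (mem_backwardOrbit_iff_of_isConjVia hg b z).mp hz
    rw [← hb', h0] at hn
    rw [Set.mem_singleton_iff, ← hinfty n _ hn, inv_smul_smul]
  obtain ⟨c, hc⟩ := hb'c
  obtain ⟨η, hη, hη2⟩ := exists_muInfty_sq_ne_one hd hd' le_rfl
  have hη : η ∈ muInfty Ω d := ⟨2, by norm_num, hη⟩
  have hS : (insert η (Set.range fun ij : Fin 2 × Fin 2 => g ij.1 ij.2)).Finite :=
    (Set.finite_range _).insert _
  refine inFiniteExtension_of_le_sup_adjoin hS (IntermediateField.adjoin_le_iff.mpr fun ζ hζ => ?_)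
  set M := IntermediateField.adjoin K
    (insert η (Set.range fun ij : Fin 2 × Fin 2 => g ij.1 ij.2)) ⊔ iteratedField Ω φ b with hM
  have hSM : ∀ x ∈ insert η (Set.range fun ij : Fin 2 × Fin 2 => g ij.1 ij.2), x ∈ M := fun x hx =>
    (le_sup_left : _ ≤ M) (IntermediateField.subset_adjoin _ _ hx)
  refine mem_of_add_inv_mem (by omega) (fun ξ hξ => ?_) hη hη2 (hSM η (Or.inl rfl))
    (muInfty_mono hm hζ)
  refine add_inv_mem_of_backwardOrbit hd hd' M c (fun n w hw hwc => ?_) hξ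
  have hmem : g⁻¹ • ((w + w⁻¹ : Ω) : OnePoint Ω) ∈ backwardOrbit Ω φ b := by
    refine (mem_backwardOrbit_iff_of_isConjVia hg b _).mpr ⟨n, ?_⟩
    rw [smul_inv_smul, iterate_ratMap_chebyshevT hw, hwc, ← hc]
  refine mem_of_smul_eq_coe M (g := g) (fun i j => hSM _ (Or.inr ⟨(i, j), rfl⟩))
    (z := g⁻¹ • ((w + w⁻¹ : Ω) : OnePoint Ω)) (fun x hx => ?_) (smul_inv_smul _ _)
  rw [hx] at hmem
  exact (le_sup_right : _ ≤ M) (IntermediateField.subset_adjoin _ _ hmem)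

end Conjugates

end IteratedExt

namespace IteratedExt

open Polynomial

/-! ### Cross ratios and fibres. -/

section CrossRatio

variable {Ω : Type*} [Field Ω]

/-- The cross ratio of four points of the projective line. -/
def crossRatio (c c' p q : OnePoint Ω) : Ω :=
  (bracket (coords p) (coords c) * bracket (coords q) (coords c')) /
    (bracket (coords p) (coords c') * bracket (coords q) (coords c))

lemma crossRatio_zero_infty (c c' : Ω) :
    crossRatio (c : OnePoint Ω) c' ((0 : Ω) : OnePoint Ω) ∞ = c / c' := by
  simp [crossRatio, bracket, coords_infty, coords_coe, neg_div_neg_eq]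

lemma crossRatio_mem {K : Type*} [Field K] [Algebra K Ω] (L : IntermediateField K Ω)
    {c c' p q : OnePoint Ω} (hc : ∀ x : Ω, c = x → x ∈ L) (hc' : ∀ x : Ω, c' = x → x ∈ L)
    (hp : ∀ x : Ω, p = x → x ∈ L) (hq : ∀ x : Ω, q = x → x ∈ L) : crossRatio c c' p q ∈ L := by
  have key : ∀ z w : OnePoint Ω, (∀ x : Ω, z = x → x ∈ L) → (∀ x : Ω, w = x → x ∈ L) →
      bracket (coords z) (coords w) ∈ L := by
    have h1 : ∀ z : OnePoint Ω, (∀ x : Ω, z = x → x ∈ L) →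
        (coords z).1 ∈ L ∧ (coords z).2 ∈ L := by
      intro z hz
      cases z using OnePoint.rec with
      | infty => exact ⟨L.one_mem, L.zero_mem⟩
      | coe z => exact ⟨hz z rfl, L.one_mem⟩
    intro z w hz hw
    exact L.sub_mem (L.mul_mem (h1 z hz).1 (h1 w hw).2) (L.mul_mem (h1 z hz).2 (h1 w hw).1)
  exact L.div_mem (L.mul_mem (key _ _ hp hc) (key _ _ hq hc'))
    (L.mul_mem (key _ _ hp hc') (key _ _ hq hc))

lemma coords_smul [DecidableEq Ω] (g : GL (Fin 2) Ω) (z : OnePoint Ω) : ∃ t : Ω, t ≠ 0 ∧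
    g 0 0 * (coords z).1 + g 0 1 * (coords z).2 = t * (coords (g • z)).1 ∧
    g 1 0 * (coords z).1 + g 1 1 * (coords z).2 = t * (coords (g • z)).2 := by
  have hdet : g 0 0 * g 1 1 - g 0 1 * g 1 0 ≠ 0 := by
    have := g.det_ne_zero
    rwa [Matrix.det_fin_two] at this
  cases z using OnePoint.rec with
  | infty =>
    rw [OnePoint.smul_infty_eq_ite]
    split_ifs with h
    · refine ⟨g 0 0, fun h0 => hdet (by rw [h0, h]; ring), ?_, ?_⟩ <;> simp [coords_infty, h]
    · refine ⟨g 1 0, h, ?_, ?_⟩ <;> simp [coords_infty, coords_coe]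
      field_simp
  | coe z =>
    rw [OnePoint.smul_some_eq_ite]
    split_ifs with h
    · refine ⟨g 0 0 * z + g 0 1, fun h0 => hdet ?_, ?_, ?_⟩
      · by_cases hz : z = 0
        · rw [hz, mul_zero, zero_add] at h h0
          rw [h, h0]; ring
        · refine (mul_eq_zero.mp (?_ : z * _ = 0)).resolve_left hz
          linear_combination g 1 1 * h0 - g 0 1 * h
      · simp [coords_infty, coords_coe]
      · simpa [coords_infty, coords_coe] using h
    · refine ⟨g 1 0 * z + g 1 1, h, ?_, ?_⟩ <;> simp [coords_coe]
      rw [mul_div_cancel₀ _ h]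

lemma crossRatio_smul [DecidableEq Ω] (g : GL (Fin 2) Ω) (c c' p q : OnePoint Ω) :
    crossRatio (g • c) (g • c') (g • p) (g • q) = crossRatio c c' p q := by
  have hdet : g 0 0 * g 1 1 - g 0 1 * g 1 0 ≠ 0 := by
    have := g.det_ne_zero
    rwa [Matrix.det_fin_two] at this
  choose t ht h1 h2 using coords_smul g
  have key : ∀ z w, bracket (coords (g • z)) (coords (g • w)) =
      (g 0 0 * g 1 1 - g 0 1 * g 1 0) / (t z * t w) * bracket (coords z) (coords w) := by
    intro z w
    have := ht z
    have := ht w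
    have e1 := h1 z
    have e2 := h2 z
    have e3 := h1 w
    have e4 := h2 w
    rw [div_mul_eq_mul_div, eq_div_iff (mul_ne_zero (ht z) (ht w))]
    simp only [bracket]
    calc _ = (t z * (coords (g • z)).1) * (t w * (coords (g • w)).2) -
          (t z * (coords (g • z)).2) * (t w * (coords (g • w)).1) := by ring
      _ = _ := by rw [← e1, ← e2, ← e3, ← e4]; ring
  rw [crossRatio, crossRatio, key, key, key, key]
  have h0 : (g 0 0 * g 1 1 - g 0 1 * g 1 0) / (t p * t c) *
      ((g 0 0 * g 1 1 - g 0 1 * g 1 0) / (t q * t c')) ≠ 0 :=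
    mul_ne_zero (div_ne_zero hdet (mul_ne_zero (ht _) (ht _)))
      (div_ne_zero hdet (mul_ne_zero (ht _) (ht _)))
  rw [← mul_div_mul_left (bracket (coords p) (coords c) * bracket (coords q) (coords c')) _ h0]
  congr 1
  · ring
  · field_simp

variable [DecidableEq Ω] [IsAlgClosed Ω] {ψ : RatFunc Ω}

/-- The cross ratio of image points is a product of cross ratios over the fibres. -/
lemma crossRatio_ratMap_mem (hψ : 0 < ratDegree ψ) (S : Submonoid Ω) {c c' a b : OnePoint Ω}
    (h : ∀ x x', ratMap Ω ψ x = c → ratMap Ω ψ x' = c' → crossRatio x x' a b ∈ S) :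
    crossRatio c c' (ratMap Ω ψ a) (ratMap Ω ψ b) ∈ S := by
  have fibre : ∀ c : OnePoint Ω, ∃ (κ : Ω) (x : Fin (ratDegree ψ) → OnePoint Ω), κ ≠ 0 ∧
      (∀ z, bracket (homEval (ratDegree ψ) (numΩ Ω ψ) (coords z),
        homEval (ratDegree ψ) (denΩ Ω ψ) (coords z)) (coords c) =
          κ * ∏ i, bracket (coords z) (coords (x i))) ∧ ∀ i, ratMap Ω ψ (x i) = c := by
    intro c
    obtain ⟨κ, X, hκ, hX, h1, h2⟩ := exists_fibre (Ω := Ω) hψ c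
    obtain ⟨l, rfl⟩ := Quotient.exists_rep X
    have hl : l.length = ratDegree ψ := hX
    rw [← hl] at h1 ⊢
    refine ⟨κ, fun i => l[(i : ℕ)], hκ, fun z => ?_, fun i => (h2 _).mp ?_⟩
    · rw [h1, Fin.prod_univ_fun_getElem l fun x => bracket (coords z) (coords x)]
      rfl
    · exact List.getElem_mem i.2
  obtain ⟨κ, x, hκ, h1, h2⟩ := fibre c
  obtain ⟨κ', x', hκ', h1', h2'⟩ := fibre c'
  have scale : ∀ z : OnePoint Ω, ∃ t : Ω, t ≠ 0 ∧ ∀ c : OnePoint Ω,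
      bracket (homEval (ratDegree ψ) (numΩ Ω ψ) (coords z),
        homEval (ratDegree ψ) (denΩ Ω ψ) (coords z)) (coords c) =
          t * bracket (coords (ratMap Ω ψ z)) (coords c) := by
    intro z
    obtain ⟨t, ht, h⟩ := ratMap_coords (Ω := Ω) ψ z
    refine ⟨t, ht, fun c => ?_⟩
    rw [h]
    simp only [bracket]
    ring
  obtain ⟨s, hs, hs'⟩ := scale a
  obtain ⟨t, ht, ht'⟩ := scale b
  have e1 := (hs' c).symm.trans (h1 a)
  have e2 := (ht' c').symm.trans (h1' b)
  have e3 := (hs' c').symm.trans (h1' a)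
  have e4 := (ht' c).symm.trans (h1 b)
  -- All scalars cancel in the cross ratio. The two fibres are listed with multiplicity and may be
  -- paired in any order. The identity also holds for a zero denominator, where division gives `0`.
  have key : crossRatio c c' (ratMap Ω ψ a) (ratMap Ω ψ b) =
      ∏ i, crossRatio (x i) (x' i) a b := by
    simp only [crossRatio]
    rw [← mul_div_mul_left _ _ (mul_ne_zero hs ht), mul_mul_mul_comm s t, mul_mul_mul_comm s t, e1, e2, e3,
      e4, Finset.prod_div_distrib, Finset.prod_mul_distrib, Finset.prod_mul_distrib,
      mul_mul_mul_comm κ, mul_mul_mul_comm κ', mul_comm κ' κ, mul_div_mul_left _ _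
        (mul_ne_zero hκ hκ')]
  rw [key]
  exact S.prod_mem fun i _ => h _ _ (h2 i) (h2' i)

lemma crossRatio_iterate_mem (hψ : 0 < ratDegree ψ) (S : Submonoid Ω) {c c' : OnePoint Ω} (n : ℕ)
    {a b : OnePoint Ω}
    (h : ∀ x x', (ratMap Ω ψ)^[n] x = c → (ratMap Ω ψ)^[n] x' = c' → crossRatio x x' a b ∈ S) :
    crossRatio c c' ((ratMap Ω ψ)^[n] a) ((ratMap Ω ψ)^[n] b) ∈ S := by
  induction n generalizing a b with
  | zero => exact h c c' rfl rfl
  | succ n ih =>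
    rw [Function.iterate_succ_apply, Function.iterate_succ_apply]
    refine ih fun u u' hu hu' => crossRatio_ratMap_mem hψ S fun x x' hx hx' => ?_
    exact h x x' (by rw [Function.iterate_succ_apply, hx, hu])
      (by rw [Function.iterate_succ_apply, hx', hu'])

end CrossRatio

/-! ### Rational functions of `x ^ m`. -/

section PowerMap

variable {Ω : Type*} [Field Ω] [DecidableEq Ω]

lemma toPt_mul_left {k : Ω} (hk : k ≠ 0) (s t : Ω) : toPt (k * s) (k * t) = toPt s t := by
  unfold toPt
  by_cases ht : t = 0
  · simp [ht]
  · rw [if_neg ht, if_neg (mul_ne_zero hk ht), mul_div_mul_left _ _ hk]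

lemma exists_num_eq {ψ : RatFunc Ω} {p q : Polynomial Ω} (hpq : IsCoprime p q) (hq : q ≠ 0)
    (h : ψ = algebraMap _ _ p / algebraMap _ _ q) :
    ∃ k : Ω, k ≠ 0 ∧ ψ.num = C k * p ∧ ψ.denom = C k * q := by
  have h1 : ψ.num * q = p * ψ.denom := by
    have hq' : algebraMap (Polynomial Ω) (RatFunc Ω) q ≠ 0 := RatFunc.algebraMap_ne_zero hq
    have hd' : algebraMap (Polynomial Ω) (RatFunc Ω) ψ.denom ≠ 0 :=
      RatFunc.algebraMap_ne_zero (RatFunc.denom_ne_zero ψ)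
    have h2 := (RatFunc.num_div_denom ψ).trans h
    rw [div_eq_div_iff hd' hq', ← map_mul, ← map_mul] at h2
    exact RatFunc.algebraMap_injective Ω h2
  have h2 : q ∣ ψ.denom := hpq.symm.dvd_of_dvd_mul_left ⟨ψ.num, by rw [← h1, mul_comm]⟩
  have h3 : ψ.denom ∣ q := (RatFunc.isCoprime_num_denom ψ).symm.dvd_of_dvd_mul_left
    ⟨p, by rw [h1, mul_comm]⟩
  obtain ⟨u, hu⟩ := associated_of_dvd_dvd h2 h3
  obtain ⟨k, hk, hku⟩ := Polynomial.isUnit_iff.mp u.isUnit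
  refine ⟨k, hk.ne_zero, ?_, by rw [hku, mul_comm, hu]⟩
  rw [← hu, ← hku] at h1
  refine mul_right_cancel₀ hq (h1.trans ?_)
  ring

lemma exists_of_mem_adjoin_X_pow {ψ : RatFunc Ω} {m : ℕ} (hm : m ≠ 0)
    (h : ψ ∈ IntermediateField.adjoin Ω {(RatFunc.X ^ m : RatFunc Ω)}) :
    ∃ χ : RatFunc Ω, ratDegree ψ = ratDegree χ * m ∧ ratMap Ω ψ ∞ = ratMap Ω χ ∞ ∧
      ∀ x : Ω, ratMap Ω ψ x = ratMap Ω χ ((x ^ m : Ω) : OnePoint Ω) := by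
  obtain ⟨χ, hχ⟩ : ∃ χ : RatFunc Ω, ψ = algebraMap _ _ (expand Ω m χ.num) /
      algebraMap _ _ (expand Ω m χ.denom) := by
    obtain ⟨r, s, hrs⟩ := (IntermediateField.mem_adjoin_simple_iff Ω ψ).mp h
    have haev : ∀ r : Polynomial Ω, aeval (RatFunc.X ^ m : RatFunc Ω) r =
        algebraMap _ _ (expand Ω m r) := by
      intro r
      rw [← RatFunc.algebraMap_X, ← map_pow, aeval_algebraMap_apply, expand_eq_comp_X_pow, comp,
        aeval_def]
      rfl
    rw [haev, haev] at hrs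
    by_cases hs : s = 0
    · exact ⟨0, by rw [hrs, hs]; simp⟩
    · refine ⟨algebraMap _ _ r / algebraMap _ _ s, ?_⟩
      set χ : RatFunc Ω := algebraMap _ _ r / algebraMap _ _ s with hχ
      have hs' : algebraMap (Polynomial Ω) (RatFunc Ω) s ≠ 0 := RatFunc.algebraMap_ne_zero hs
      have hd' : algebraMap (Polynomial Ω) (RatFunc Ω) χ.denom ≠ 0 :=
        RatFunc.algebraMap_ne_zero (RatFunc.denom_ne_zero χ)
      have h2 := (RatFunc.num_div_denom χ).trans hχ
      rw [div_eq_div_iff hd' hs', ← map_mul, ← map_mul] at h2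
      have h3 := congrArg (expand Ω m) (RatFunc.algebraMap_injective Ω h2)
      have he : ∀ p : Polynomial Ω, p ≠ 0 →
          algebraMap (Polynomial Ω) (RatFunc Ω) (expand Ω m p) ≠ 0 := fun p hp =>
        RatFunc.algebraMap_ne_zero ((expand_ne_zero (Nat.pos_of_ne_zero hm)).mpr hp)
      rw [hrs, div_eq_div_iff (he _ hs) (he _ (RatFunc.denom_ne_zero χ)), ← map_mul, ← map_mul,
        ← map_mul, ← map_mul]
      exact congrArg _ h3.symm
  obtain ⟨k, hk, hn, hd⟩ := exists_num_eq ((isCoprime_expand hm).mpr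
    (RatFunc.isCoprime_num_denom χ)) ((expand_ne_zero (Nat.pos_of_ne_zero hm)).mpr
      (RatFunc.denom_ne_zero χ)) hχ
  have hdeg : ratDegree ψ = ratDegree χ * m := by
    rw [ratDegree, hn, hd, natDegree_C_mul hk, natDegree_C_mul hk, natDegree_expand,
      natDegree_expand, ratDegree, Nat.mul_max_mul_right]
  refine ⟨χ, hdeg, ?_, fun x => ?_⟩
  · change toPt (algebraMap Ω Ω (ψ.num.coeff (ratDegree ψ)))
      (algebraMap Ω Ω (ψ.denom.coeff (ratDegree ψ))) =
      toPt (algebraMap Ω Ω (χ.num.coeff (ratDegree χ)))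
      (algebraMap Ω Ω (χ.denom.coeff (ratDegree χ)))
    simp only [Algebra.algebraMap_self, RingHom.id_apply]
    rw [hdeg, hn, hd, coeff_C_mul, coeff_C_mul, coeff_expand_mul (Nat.pos_of_ne_zero hm),
      coeff_expand_mul (Nat.pos_of_ne_zero hm), toPt_mul_left hk]
  · change toPt (aeval x ψ.num) (aeval x ψ.denom) =
      toPt (aeval (x ^ m) χ.num) (aeval (x ^ m) χ.denom)
    rw [hn, hd, map_mul, map_mul, aeval_C, Algebra.algebraMap_self, RingHom.id_apply,
      toPt_mul_left hk, expand_aeval, expand_aeval]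

lemma ratDegree_pos_of_surjective [Infinite Ω] {ψ : RatFunc Ω}
    (h : Function.Surjective (ratMap Ω ψ)) : 0 < ratDegree ψ := by
  by_contra h0
  have h1 : ψ.num.natDegree = 0 ∧ ψ.denom.natDegree = 0 := by
    have := le_max_left ψ.num.natDegree ψ.denom.natDegree
    have := le_max_right ψ.num.natDegree ψ.denom.natDegree
    unfold ratDegree at h0
    omega
  have h2 : ∀ x : Ω, ratMap Ω ψ x = ratMap Ω ψ (0 : Ω) := by
    intro x
    change toPt (aeval x ψ.num) (aeval x ψ.denom) = toPt (aeval 0 ψ.num) (aeval 0 ψ.denom)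
    rw [eq_C_of_natDegree_eq_zero h1.1, eq_C_of_natDegree_eq_zero h1.2]
    simp
  have h3 : (Set.univ : Set (OnePoint Ω)) ⊆ {ratMap Ω ψ ∞, ratMap Ω ψ (0 : Ω)} := by
    intro c _
    obtain ⟨z, rfl⟩ := h c
    cases z using OnePoint.rec with
    | infty => exact Or.inl rfl
    | coe z => exact Or.inr (h2 z)
  exact Set.infinite_univ ((Set.toFinite _).subset h3)

variable [IsAlgClosed Ω]

/-- For a rational function of `x ^ m`, the cross ratio with the images of `0` and `∞` is an
`m`-th power. -/
lemma crossRatio_power_mem {ψ χ : RatFunc Ω} {m : ℕ} (hm : m ≠ 0) (hχ : 0 < ratDegree χ)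
    (hinf : ratMap Ω ψ ∞ = ratMap Ω χ ∞)
    (hcoe : ∀ x : Ω, ratMap Ω ψ x = ratMap Ω χ ((x ^ m : Ω) : OnePoint Ω)) (S : Submonoid Ω)
    {c c' : OnePoint Ω} (h0 : ∀ z ∈ ({c, c'} : Set (OnePoint Ω)),
      z ≠ ratMap Ω ψ (0 : Ω) ∧ z ≠ ratMap Ω ψ ∞)
    (h : ∀ x x' : Ω, ratMap Ω ψ x = c → ratMap Ω ψ x' = c' → x / x' ∈ S) :
    crossRatio c c' (ratMap Ω ψ (0 : Ω)) (ratMap Ω ψ ∞) ∈ S.map (powMonoidHom m) := by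
  have hz : ratMap Ω ψ (0 : Ω) = ratMap Ω χ (0 : Ω) := by rw [hcoe, zero_pow hm]
  rw [hz, hinf]
  -- It is `χ`, not `ψ`, whose fibres are used: its points are `m`-th powers of points in the fibres
  -- of `ψ`, and none is `∞` because `c` and `c'` differ from `ψ ∞`.
  refine crossRatio_ratMap_mem hχ _ fun t t' ht ht' => ?_
  have lift : ∀ z ∈ ({c, c'} : Set (OnePoint Ω)), ∀ t, ratMap Ω χ t = z →
      ∃ x : Ω, t = ((x ^ m : Ω) : OnePoint Ω) ∧ ratMap Ω ψ x = z := by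
    intro z hz t ht
    cases t using OnePoint.rec with
    | infty => exact absurd (ht.symm.trans hinf.symm) (h0 z hz).2
    | coe t =>
      obtain ⟨x, rfl⟩ := IsAlgClosed.exists_pow_nat_eq t (Nat.pos_of_ne_zero hm)
      exact ⟨x, rfl, by rw [hcoe, ht]⟩
  obtain ⟨x, rfl, hx⟩ := lift c (by simp) t ht
  obtain ⟨x', rfl, hx'⟩ := lift c' (by simp) t' ht'
  rw [crossRatio_zero_infty, ← div_pow]
  exact ⟨x / x', h x x' hx hx', rfl⟩

end PowerMap

/-! ### Roots of unity from iterated roots. -/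

section RootsOfUnity

variable {Ω : Type*} [Field Ω]

/-- The part of `m` prime to the characteristic. -/
lemma exists_eq_mul_ne_zero {m : ℕ} (hm : m ≠ 0) : ∃ q n : ℕ, m = q * n ∧ (n : Ω) ≠ 0 ∧
    ∀ z : Ω, z ^ q = 1 → z = 1 := by
  obtain ⟨p, hp⟩ := CharP.exists Ω
  rcases CharP.char_is_prime_or_zero Ω p with hprime | rfl
  · obtain ⟨a, n, hn, rfl⟩ := Nat.exists_eq_pow_mul_and_not_dvd hm p hprime.ne_one
    have : Fact p.Prime := ⟨hprime⟩
    refine ⟨p ^ a, n, rfl, fun h => hn ((CharP.cast_eq_zero_iff Ω p n).mp h), fun z hz => ?_⟩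
    exact iterateFrobenius_inj Ω p a (by rw [iterateFrobenius_def, hz, map_one])
  · have : CharZero Ω := CharP.charP_to_charZero Ω
    exact ⟨1, m, (one_mul m).symm, Nat.cast_ne_zero.mpr hm, fun z hz => by rwa [pow_one] at hz⟩

/-- With `n` the part of `m` prime to the characteristic, an `m ^ k`-th root of a primitive `n`-th
root of unity yields an element of exact order `n ^ (k + 1)`, whose powers include every root of
unity killed by `m ^ k`. The remaining factor of `m` is a power of the characteristic exponent and
contributes no roots. -/
lemma muInfty_subset_of_roots [IsAlgClosed Ω] {K : Type*} [Field K] [Algebra K Ω]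
    (L : IntermediateField K Ω) {m : ℕ} (hm : m ≠ 0)
    (h : ∀ ζ : Ω, ζ ^ m = 1 → ∀ k : ℕ, ∃ y ∈ L, y ^ m ^ k = ζ) : muInfty Ω m ⊆ L := by
  rintro ζ ⟨k, -, hζ⟩
  obtain ⟨q, n, rfl, hn, hq⟩ := exists_eq_mul_ne_zero (Ω := Ω) hm
  have hq' : ∀ (k : ℕ) (z : Ω), z ^ q ^ k = 1 → z = 1 := by
    intro k
    induction k with
    | zero => intro z hz; simpa using hz
    | succ k ih => exact fun z hz => hq z (ih _ (by rw [← pow_mul, ← pow_succ', hz]))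
  have hn0 : n ≠ 0 := fun h0 => hn (by simp [h0])
  have hζn : ζ ^ n ^ k = 1 := hq' k _ (by rw [← pow_mul, mul_comm, ← mul_pow, hζ])
  have : NeZero (n : Ω) := ⟨hn⟩
  obtain ⟨ξ, hξ⟩ := HasEnoughRootsOfUnity.exists_primitiveRoot Ω n
  obtain ⟨y, hy, hyξ⟩ := h ξ (by rw [mul_comm, pow_mul, hξ.pow_eq_one, one_pow]) k
  have hyn : (y ^ q ^ k) ^ n ^ k = ξ := by rw [← pow_mul, ← mul_pow, hyξ]
  have hord : orderOf (y ^ q ^ k) = n ^ (k + 1) := by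
    refine orderOf_eq_of_pow_and_pow_div_prime (pow_pos (Nat.pos_of_ne_zero hn0) _) ?_ ?_
    · rw [pow_succ, pow_mul, hyn, hξ.pow_eq_one]
    · intro l hl hln
      obtain ⟨t, rfl⟩ := hl.dvd_of_dvd_pow hln
      have ht : t ≠ 0 := fun h0 => hn0 (by simp [h0])
      rw [pow_succ, show (l * t) ^ k * (l * t) = ((l * t) ^ k * t) * l by ring,
        Nat.mul_div_cancel _ hl.pos, pow_mul, hyn]
      refine hξ.pow_ne_one_of_pos_of_lt ht ?_
      have := hl.two_le
      nlinarith [Nat.pos_of_ne_zero ht]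
  have hprim : IsPrimitiveRoot (y ^ q ^ k) (n ^ (k + 1)) := hord ▸ IsPrimitiveRoot.orderOf _
  have : NeZero (n ^ (k + 1)) := ⟨pow_ne_zero _ hn0⟩
  obtain ⟨i, -, hi⟩ := hprim.eq_pow_of_pow_eq_one
    (show ζ ^ n ^ (k + 1) = 1 by rw [pow_succ, pow_mul, hζn, one_pow])
  rw [← hi]
  exact pow_mem (pow_mem hy _) _

end RootsOfUnity

/-! ### Backward orbits of functions of `x ^ m`. -/

section Main

variable {K : Type*} [Field K] {Ω : Type*} [Field Ω] [DecidableEq Ω] [Algebra K Ω] [IsAlgClosed Ω]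

/-- Ratios of points in a backward orbit are iterated `m`-th powers. -/
lemma exists_pow_eq_div {ψ : RatFunc Ω} {m : ℕ} (hm : m ≠ 0) (hψ : 0 < ratDegree ψ)
    (hmem : ψ ∈ IntermediateField.adjoin Ω {(RatFunc.X ^ m : RatFunc Ω)})
    (h0 : ((0 : Ω) : OnePoint Ω) ∈ Function.periodicPts (ratMap Ω ψ))
    (hinf : (∞ : OnePoint Ω) ∈ Function.periodicPts (ratMap Ω ψ)) (b : OnePoint Ω)
    (S : Submonoid Ω)
    (hS : ∀ c c' : Ω, c ≠ 0 → c' ≠ 0 → (∃ n, (ratMap Ω ψ)^[n] c = b) →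
      (∃ n, (ratMap Ω ψ)^[n] c' = b) → c / c' ∈ S) (k : ℕ) :
    ∀ c c' : Ω, c ≠ 0 → c' ≠ 0 → (∃ n, (ratMap Ω ψ)^[n] c = b) →
      (∃ n, (ratMap Ω ψ)^[n] c' = b) → c / c' ∈ S.map (powMonoidHom (m ^ k)) := by
  obtain ⟨χ, hdeg, hχinf, hχ⟩ := exists_of_mem_adjoin_X_pow hm hmem
  have hχ0 : 0 < ratDegree χ := Nat.pos_of_ne_zero fun h => by rw [h, zero_mul] at hdeg; omega
  obtain ⟨n₁, hn₁, hp₁⟩ := h0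
  obtain ⟨n₂, hn₂, hp₂⟩ := hinf
  -- A common period `n + 1` of `0` and `∞`, split into one application of `ψ`, which produces the
  -- `m`-th power, and `n` further ones.
  obtain ⟨n, hn⟩ : ∃ n, n₁ * n₂ = n + 1 := ⟨n₁ * n₂ - 1, by have := Nat.mul_pos hn₁ hn₂; omega⟩
  have hp₁ : (ratMap Ω ψ)^[n + 1] ((0 : Ω) : OnePoint Ω) = ((0 : Ω) : OnePoint Ω) :=
    hn ▸ hp₁.mul_const n₂
  have hp₂ : (ratMap Ω ψ)^[n + 1] ∞ = ∞ := hn ▸ hp₂.const_mul n₁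
  induction k with
  | zero =>
    intro c c' hc hc' hb hb'
    exact ⟨c / c', hS c c' hc hc' hb hb', by simp⟩
  | succ k ih =>
    intro c c' hc hc' hb hb'
    have hmap : S.map (powMonoidHom (m ^ (k + 1))) =
        (S.map (powMonoidHom (m ^ k))).map (powMonoidHom m) := by
      rw [Submonoid.map_map]
      congr 1
      ext x
      simp [pow_succ, pow_mul]
    rw [hmap, ← crossRatio_zero_infty]
    have hp₁' := hp₁
    have hp₂' := hp₂
    rw [Function.iterate_succ_apply] at hp₁' hp₂'
    -- View `0` and `∞` as their own images under `ψ` iterated `n + 1` times. The quotient `c / c'`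
    -- then becomes a product of `m`-th powers of quotients of points in the `(n + 1)`-fold fibres
    -- of `c` and `c'`, to which the induction hypothesis applies.
    nth_rw 1 [← hp₁', ← hp₂']
    refine crossRatio_iterate_mem hψ _ n fun u u' hu hu' => ?_
    refine crossRatio_power_mem hm hχ0 hχinf hχ _ ?_ fun x x' hx hx' => ?_
    · rintro z (rfl | rfl)
      · refine ⟨?_, ?_⟩ <;> rintro rfl
        · rw [hp₁'] at hu
          exact hc (OnePoint.coe_injective hu).symm
        · rw [hp₂'] at hu
          exact OnePoint.coe_ne_infty c hu.symm
      · refine ⟨?_, ?_⟩ <;> rintro rfl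
        · rw [hp₁'] at hu'
          exact hc' (OnePoint.coe_injective hu').symm
        · rw [hp₂'] at hu'
          exact OnePoint.coe_ne_infty c' hu'.symm
    · have hx1 : (ratMap Ω ψ)^[n + 1] x = c := by rw [Function.iterate_succ_apply, hx, hu]
      have hx1' : (ratMap Ω ψ)^[n + 1] x' = c' := by rw [Function.iterate_succ_apply, hx', hu']
      refine ih x x' ?_ ?_ ?_ ?_
      · rintro rfl
        rw [hp₁] at hx1
        exact hc (OnePoint.coe_injective hx1).symm
      · rintro rfl
        rw [hp₁] at hx1'
        exact hc' (OnePoint.coe_injective hx1').symm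
      · obtain ⟨j, hj⟩ := hb
        exact ⟨j + (n + 1), by rw [Function.iterate_add_apply, hx1, hj]⟩
      · obtain ⟨j, hj⟩ := hb'
        exact ⟨j + (n + 1), by rw [Function.iterate_add_apply, hx1', hj]⟩

/-- The iterated extensions of a map conjugate to a rational function of `x ^ m` with `0` and `∞`
periodic contain roots of unity. -/
theorem cyclotomicField_le_of_mem_adjoin_X_pow {φ : RatFunc K} (hφ : 0 < ratDegree φ) {m : ℕ}
    (hm : m ≠ 0) {g : GL (Fin 2) Ω} {ψ : RatFunc Ω} (hg : IsConjVia Ω g φ ψ)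
    (hmem : ψ ∈ IntermediateField.adjoin Ω {(RatFunc.X ^ m : RatFunc Ω)})
    (h0 : ((0 : Ω) : OnePoint Ω) ∈ Function.periodicPts (ratMap Ω ψ))
    (hinf : (∞ : OnePoint Ω) ∈ Function.periodicPts (ratMap Ω ψ)) {b : OnePoint K}
    (hb : ¬ IsExceptional Ω φ b) :
    cyclotomicField K Ω m ≤
      fieldOfPoints K {g⁻¹ • ((0 : Ω) : OnePoint Ω), g⁻¹ • (∞ : OnePoint Ω)} ⊔
        iteratedField Ω φ b := by
  have : Infinite Ω := IsAlgClosed.instInfinite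
  have hψ : 0 < ratDegree ψ := by
    refine ratDegree_pos_of_surjective fun c => ?_
    obtain ⟨z, hz⟩ := ratMap_surjective (Ω := Ω) hφ (g⁻¹ • c)
    exact ⟨g • z, by rw [← hg, hz, smul_inv_smul]⟩
  set L := fieldOfPoints K {g⁻¹ • ((0 : Ω) : OnePoint Ω), g⁻¹ • (∞ : OnePoint Ω)} ⊔
        iteratedField Ω φ b with hL
  set b' := g • OnePoint.map (algebraMap K Ω) b with hb'
  have horb : ∀ z : OnePoint Ω, (∃ n, (ratMap Ω ψ)^[n] z = b') → ∀ x : Ω, g⁻¹ • z = x → x ∈ L := by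
    intro z hz x hx
    refine (le_sup_right : _ ≤ L) (IntermediateField.subset_adjoin _ _ ?_)
    rw [Set.mem_ofPred_eq, ← hx, mem_backwardOrbit_iff_of_isConjVia hg, smul_inv_smul]
    exact hz
  have hpow := exists_pow_eq_div hm hψ hmem h0 hinf b' L.toSubfield.toSubmonoid (by
    intro c c' hc hc' hcb hcb'
    -- Invariance of the cross ratio places `c / c'` in the compositum using only the points `g⁻¹ •
    -- 0` and `g⁻¹ • ∞`, not the entries of `g`.
    rw [← crossRatio_zero_infty, ← crossRatio_smul g⁻¹]
    refine crossRatio_mem L (horb _ hcb) (horb _ hcb') (fun x hx => ?_) (fun x hx => ?_)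
    · exact (le_sup_left : _ ≤ L) (IntermediateField.subset_adjoin _ _ (Or.inl hx.symm))
    · exact (le_sup_left : _ ≤ L) (IntermediateField.subset_adjoin _ _ (Or.inr hx.symm)))
  -- Avoiding `b` as well as the preimages of `0` and `∞` forces at least one iteration from `z` to
  -- `b`, so that `ζ * c` reaches the same point as `c` through `x ^ m`.
  obtain ⟨z, hz, hzn⟩ := (Set.not_finite.mp hb).exists_notMem_finite
    (Set.toFinite {g⁻¹ • ((0 : Ω) : OnePoint Ω), g⁻¹ • (∞ : OnePoint Ω), g⁻¹ • b'})
  obtain ⟨n, hn⟩ := (mem_backwardOrbit_iff_of_isConjVia hg b z).mp hz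
  simp only [Set.mem_insert_iff, Set.mem_singleton_iff, not_or, eq_inv_smul_iff] at hzn
  obtain ⟨hz0, hzinf, hzb⟩ := hzn
  generalize g • z = c at hn hz0 hzinf hzb
  cases c using OnePoint.rec with
  | infty => exact absurd rfl hzinf
  | coe c =>
  have hc : c ≠ 0 := fun h => hz0 (by rw [h])
  obtain ⟨χ, -, -, hχ⟩ := exists_of_mem_adjoin_X_pow hm hmem
  refine IntermediateField.adjoin_le_iff.mpr (muInfty_subset_of_roots L hm fun ζ hζ k => ?_)
  have hζ0 : ζ ≠ 0 := by
    rintro rfl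
    rw [zero_pow hm] at hζ
    exact zero_ne_one hζ
  obtain ⟨j, rfl⟩ : ∃ j, n = j + 1 := Nat.exists_eq_succ_of_ne_zero (by
    rintro rfl
    exact hzb hn)
  have hζc : (ratMap Ω ψ)^[j + 1] ((ζ * c : Ω) : OnePoint Ω) = b' := by
    rw [Function.iterate_succ_apply, hχ, mul_pow, hζ, one_mul, ← hχ, ← Function.iterate_succ_apply,
      hn]
  obtain ⟨y, hy, hyζ⟩ := hpow k (ζ * c) c (mul_ne_zero hζ0 hc) hc ⟨_, hζc⟩ ⟨_, hn⟩
  refine ⟨y, hy, ?_⟩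
  rw [mul_div_cancel_right₀ _ hc] at hyζ
  exact hyζ

end Main

end IteratedExt

end

/-! ### The theorem. -/

open IteratedExt IntermediateField in
theorem theorem1p1 {K Ω : Type*} [Field K] [Field Ω] [DecidableEq Ω] [Algebra K Ω]
    [IsAlgClosure K Ω] (φ : RatFunc K) (d m : ℕ) (hφ : ratDegree φ = d) (hd : 2 ≤ d)
    (hchar : ¬ ringChar K ∣ d) (hm : 2 ≤ m) :
    -- maps conjugate to a rational function in `x ^ m` for which `0` and `∞` are periodic
    (∀ (g : GL (Fin 2) Ω) (ψ : RatFunc Ω), IsConjVia Ω g φ ψ →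
      ψ ∈ Ω⟮(RatFunc.X ^ m : RatFunc Ω)⟯ →
      ((0 : Ω) : OnePoint Ω) ∈ Function.periodicPts (ratMap Ω ψ) →
      (∞ : OnePoint Ω) ∈ Function.periodicPts (ratMap Ω ψ) →
      ∀ b : OnePoint K, ¬ IsExceptional Ω φ b →
        cyclotomicField K Ω m ≤
          fieldOfPoints K {g⁻¹ • ((0 : Ω) : OnePoint Ω), g⁻¹ • (∞ : OnePoint Ω)} ⊔
            iteratedField Ω φ b ∧
        InFiniteExtension (iteratedField Ω φ b) (cyclotomicField K Ω m)) ∧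
    -- Chebyshev polynomials and their conjugates
    (∀ b : K,
      realCyclotomicField K Ω d ≤ iteratedField Ω (chebyshevT K d) (b : OnePoint K) ∧
      InExtensionOfDegreeLE (iteratedField Ω (chebyshevT K d) (b : OnePoint K))
        (cyclotomicField K Ω d) 2) ∧
    (m ∣ d → ∀ g : GL (Fin 2) Ω, IsConjVia Ω g φ (chebyshevT Ω d) →
      ∀ b : OnePoint K, ¬ IsExceptional Ω φ b →
        InFiniteExtension (iteratedField Ω φ b) (cyclotomicField K Ω m)) ∧
    -- flexible Lattès maps
    (m ∣ d → IsFlexibleLattes Ω φ → ∀ b : OnePoint K,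
      InExtensionOfDegreeLE (iteratedField Ω φ b) (cyclotomicField K Ω m) 8) := by
  have : IsAlgClosed Ω := IsAlgClosure.isAlgClosed K
  have : Algebra.IsAlgebraic K Ω := IsAlgClosure.isAlgebraic
  subst hφ
  have hdK : ((ratDegree φ : ℕ) : K) ≠ 0 := fun h => hchar ((ringChar.spec K _).mp h)
  have hdΩ : ((ratDegree φ : ℕ) : Ω) ≠ 0 := by
    rw [← map_natCast (algebraMap K Ω)]
    exact (map_ne_zero _).mpr hdK
  have hpos : 0 < ratDegree φ := by omega
  refine ⟨fun g ψ hg hψ h0 hinf b hb => ?_, fun b => ⟨realCyclotomicField_le_chebyshevT hd hdΩ b,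
    inExtensionOfDegreeLE_chebyshevT hd hdΩ b⟩, fun hmd g hg b hb =>
    inFiniteExtension_of_conj_chebyshevT hd hdΩ hmd hg hb, fun hmd hφ b =>
    inExtensionOfDegreeLE_of_le (cyclotomicField_le_of_isFlexibleLattes hpos hdΩ hmd hφ b)
      (by norm_num)⟩
  have h := cyclotomicField_le_of_mem_adjoin_X_pow hpos (by omega) hg hψ h0 hinf hb
  refine ⟨h, inFiniteExtension_of_le_sup_adjoin (Set.Finite.preimage
    OnePoint.coe_injective.injOn (Set.toFinite _)) h⟩
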